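/- Theorem 1.3. Let $\Gamma$ be a group with property (T;FD), and let $$1\to\mathbb Z\to\widetilde\Gamma\to\Gamma\to1$$ be a central extension in which $\widetilde\Gamma$ has finite abelianization. If $\Gamma$ is (flexibly) Hilbert–Schmidt stable, then $\widetilde\Gamma$ is not hyperlinear. Here the terms are as follows. - *Property (T;FD)*: there are a finite symmetric generating set $S\subset\Gamma$ (in particular $\Gamma$ is finitely generated) and $\lambda>0$ such that for every finite-dimensional unitary representation $\rho$ of $\Gamma$ the positive operator $1-\frac1{|S|}\sum_{s\in S}\rho(s)$ has no spectrum in the open interval $(0,\lambda)$. - For $x\in M_m(\mathbb C)$ put $\|x\|_2=\left(\frac1m\operatorname{tr}(x^*x)\right)^{1/2}$. An *asymptotic representation* of a group $G$ is a sequence of maps $\pi_n\colon G\to U(d_n)$, $d_n\ge1$, with $\lim_n\|\pi_n(gh)-\pi_n(g)\pi_n(h)\|_2=0$ for all $g,h\in G$. - $G$ is *hyperlinear* if it has an asymptotic representation such that $\lim_n\|\pi_n(g)-\pi_n(h)\|_2=\sqrt2$ whenever $g\ne h$. - $G$ is *(flexibly) Hilbert–Schmidt stable* if for every asymptotic representation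 $\pi_n\colon G\to U(d_n)$ there are integers $D_n\ge d_n$ and unitary representations (homomorphisms) $\rho_n\colon G\to U(D_n)$ such that $\lim_n\|(\pi_n(g)\oplus 0_{D_n-d_n})-\rho_n(g)\|_2=0$ for every $g\in G$, where the norm is the one on $M_{D_n}(\mathbb C)$. -/

import Mathlib

open Filter Topology Matrix

noncomputable section

/-- The normalized Hilbert-Schmidt norm `(tr (x* x) / m) ^ (1/2)` on `m × m` complex matrices. -/
def hsNorm {m : ℕ} (x : Matrix (Fin m) (Fin m) ℂ) : ℝ :=
  Real.sqrt ((xᴴ * x).trace.re / m)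

/-- For `n ≤ m`, the `m × m` block matrix `x ⊕ 0` with `x` in the upper left corner. -/
def padZero {n : ℕ} (m : ℕ) (x : Matrix (Fin n) (Fin n) ℂ) : Matrix (Fin m) (Fin m) ℂ :=
  Matrix.of fun i j =>
    if h : (i : ℕ) < n ∧ (j : ℕ) < n then x ⟨i, h.1⟩ ⟨j, h.2⟩ else 0

/-- The generalized Hilbert-Schmidt distance `‖x ⊕ 0 - y‖₂` between an `n × n` matrix `x` and an
`m × m` matrix `y`, where `n ≤ m`. -/
def hsDist {n m : ℕ} (x : Matrix (Fin n) (Fin n) ℂ) (y : Matrix (Fin m) (Fin m) ℂ) : ℝ :=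
  hsNorm (padZero m x - y)

/-- A sequence of maps `π k : G → U(d k)`, with `d k ≥ 1`, is an asymptotic representation if
`‖π k (g h) - π k g π k h‖₂ → 0` for all `g` and `h`. -/
def IsAsymptoticRep {G : Type*} [Group G] (d : ℕ → ℕ)
    (π : ∀ k, G → Matrix.unitaryGroup (Fin (d k)) ℂ) : Prop :=
  (∀ k, 0 < d k) ∧
    ∀ g h : G, Tendsto (fun k => hsNorm
      ((π k (g * h) : Matrix (Fin (d k)) (Fin (d k)) ℂ) -
        (π k g : Matrix (Fin (d k)) (Fin (d k)) ℂ) * (π k h : Matrix (Fin (d k)) (Fin (d k)) ℂ)))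
      atTop (𝓝 0)

/-- A group is hyperlinear if it has an asymptotic representation for which
`‖π k g - π k h‖₂ → √2` whenever `g ≠ h`. -/
def IsHyperlinear (G : Type*) [Group G] : Prop :=
  ∃ (d : ℕ → ℕ) (π : ∀ k, G → Matrix.unitaryGroup (Fin (d k)) ℂ),
    IsAsymptoticRep d π ∧
    ∀ g h : G, g ≠ h → Tendsto (fun k => hsNorm
      ((π k g : Matrix (Fin (d k)) (Fin (d k)) ℂ) - (π k h : Matrix (Fin (d k)) (Fin (d k)) ℂ)))
      atTop (𝓝 (Real.sqrt 2))

/-- (Flexible) Hilbert-Schmidt stability: every asymptotic representation `π k : G → U(d k)` is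
pointwise asymptotically close to honest representations `ρ k : G → U(D k)` with `D k ≥ d k`. -/
def IsHSStable (G : Type*) [Group G] : Prop :=
  ∀ (d : ℕ → ℕ) (π : ∀ k, G → Matrix.unitaryGroup (Fin (d k)) ℂ), IsAsymptoticRep d π →
    ∃ (D : ℕ → ℕ) (ρ : ∀ k, G →* Matrix.unitaryGroup (Fin (D k)) ℂ),
      (∀ k, d k ≤ D k) ∧
      ∀ g : G, Tendsto (fun k => hsDist
        (π k g : Matrix (Fin (d k)) (Fin (d k)) ℂ) (ρ k g : Matrix (Fin (D k)) (Fin (D k)) ℂ))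
        atTop (𝓝 0)

/-- The image `1 - |S|⁻¹ ∑_{s ∈ S} ρ(s)` of the combinatorial Laplacian of `S` under a
finite-dimensional unitary representation. -/
def repLaplacian {G : Type*} [Group G] (S : Finset G) {n : ℕ}
    (ρ : G →* Matrix.unitaryGroup (Fin n) ℂ) : Matrix (Fin n) (Fin n) ℂ :=
  1 - (S.card : ℂ)⁻¹ • ∑ s ∈ S, (ρ s : Matrix (Fin n) (Fin n) ℂ)

/-- Property (T;FD): `G` has a finite symmetric generating set `S` and a `gap > 0` such that for
every finite-dimensional unitary representation the (positive semidefinite) image of the Laplacian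
of `S` has no spectrum in the open interval `(0, gap)`. -/
def HasPropertyTFD (G : Type*) [Group G] : Prop :=
  ∃ S : Finset G, (∀ s ∈ S, s⁻¹ ∈ S) ∧ Subgroup.closure (S : Set G) = ⊤ ∧
    ∃ gap : ℝ, 0 < gap ∧
      ∀ (n : ℕ) (ρ : G →* Matrix.unitaryGroup (Fin n) ℂ),
        spectrum ℝ (repLaplacian S ρ) ∩ Set.Ioo 0 gap = ∅

end

/-! Let `z` generate the central copy of ℤ and let N be the order of the finite abelianization of
the extension. Suppose that the extension has an asymptotic representation π as in the definition of
hyperlinearity. Two opposing facts about scalar values of `z` give a contradiction.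

Flexibility of the scalar. Since `z` has infinite order, the real parts of the normalized moments of
π(z) tend to 0, so the spectrum of π(z) has mass near ω or near its conjugate, for every ω on the
circle. As `z` is central, a suitably cut spectral subspace almost commutes with all π(g).
Compression to it gives an asymptotic representation σ with σ(z) → ω' · 1, where ω' is ω or its
conjugate (`exists_corner`, `exists_compression`, `IsAsymptoticRep.exists_tendsto_scalar`).

Rigidity of the scalar. Take ω close to 1 with ω^N ≠ 1, and restrict σ to a section of the quotient
map. The result is multiplicative up to a cocycle with values in powers of ω, hence up to a small
fixed error, and stability gives honest representations ρ at a small fixed distance ε. In σ ⊗ conj σ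
the cocycle cancels, so this is a true asymptotic representation of the quotient, and stability
gives τ at a distance η → 0. Let ξ be the maximally entangled vector in ℂ^d ⊗ ℂ^D. It is invariant
under σ ⊗ conj ρ up to O(ε). To improve on ε, average the projection onto ξ over conjugation by σ ⊗
conj ρ. After regrouping tensor legs, this action becomes X ↦ (σ ⊗ conj σ) X (ρ ⊗ conj ρ)*, which is
η-close to an honest representation, so the gap of (T;FD) applies. The average stays O(ε)-close to
the projection, but is invariant up to O(kη) + O((1 - gap/2)^k) (`averaged_state_bounds`). Its top
eigenvalue is simple, so its top eigenvector is an almost eigenvector of every σ(s) ⊗ conj ρ(s)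
(`exists_almost_eigenvector`). In the limit the eigenvalues form a character χ of the extension with
χ(z) = ω (`exists_character_of_almost_eigenvector`), which forces ω^N = 1.

Errors here are small only in normalized Hilbert–Schmidt norm. They can be multiplied because the
averaged operator and its eigenvector keep operator norm bounds of order 1/d and 1/√d (`opBall`,
`densityBall`). -/

/-! ### Frobenius norms, isometries and unitaries -/

section Frobenius

open scoped Matrix.Norms.Frobenius Kronecker

variable {l m n : Type*} [Fintype l] [Fintype m] [Fintype n]

theorem frobenius_norm_sq (x : Matrix m n ℂ) : ‖x‖ ^ 2 = ∑ i, ∑ j, ‖x i j‖ ^ 2 := by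
  rw [Matrix.frobenius_norm_def, ← Real.sqrt_eq_rpow, Real.sq_sqrt (by positivity)]
  norm_cast

theorem frobenius_norm_sq_eq_trace (x : Matrix m n ℂ) : ‖x‖ ^ 2 = (xᴴ * x).trace.re := by
  rw [frobenius_norm_sq, Finset.sum_comm]
  simp only [Matrix.trace, Matrix.diag_apply, Matrix.mul_apply, Matrix.conjTranspose_apply,
    Complex.re_sum]
  refine Finset.sum_congr rfl fun i _ => Finset.sum_congr rfl fun j _ => ?_
  rw [Complex.star_def, Complex.conj_mul']
  norm_cast

theorem hsNorm_eq {k : ℕ} (x : Matrix (Fin k) (Fin k) ℂ) : hsNorm x = ‖x‖ / √k := by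
  rw [hsNorm, ← frobenius_norm_sq_eq_trace, Real.sqrt_div (by positivity),
    Real.sqrt_sq (norm_nonneg _)]

theorem norm_isometry_mul [DecidableEq m] {W : Matrix l m ℂ} (hW : Wᴴ * W = 1)
    (x : Matrix m n ℂ) : ‖W * x‖ = ‖x‖ := by
  rw [← sq_eq_sq₀ (norm_nonneg _) (norm_nonneg _), frobenius_norm_sq_eq_trace,
    frobenius_norm_sq_eq_trace, Matrix.conjTranspose_mul, Matrix.mul_assoc,
    ← Matrix.mul_assoc Wᴴ, hW, Matrix.one_mul]

theorem norm_mul_isometry_conjTranspose [DecidableEq m] {W : Matrix l m ℂ} (hW : Wᴴ * W = 1)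
    (x : Matrix n m ℂ) : ‖x * Wᴴ‖ = ‖x‖ := by
  rw [← Matrix.frobenius_norm_conjTranspose, Matrix.conjTranspose_mul,
    Matrix.conjTranspose_conjTranspose, norm_isometry_mul hW, Matrix.frobenius_norm_conjTranspose]

theorem norm_mul_coisometry [DecidableEq m] {W : Matrix m l ℂ} (hW : W * Wᴴ = 1)
    (x : Matrix n m ℂ) : ‖x * W‖ = ‖x‖ := by
  have := norm_mul_isometry_conjTranspose (W := Wᴴ) (by simpa using hW) x
  simpa using this

/-- Pythagoras for the orthogonal splitting of `x` into `W * Wᴴ * x` and the rest. -/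
theorem norm_isometry_conjTranspose_mul_le [DecidableEq m] [DecidableEq l] {W : Matrix l m ℂ}
    (hW : Wᴴ * W = 1) (x : Matrix l n ℂ) : ‖Wᴴ * x‖ ≤ ‖x‖ := by
  have h1 : ‖x‖ ^ 2 = ‖Wᴴ * x‖ ^ 2 + ‖x - W * (Wᴴ * x)‖ ^ 2 := by
    rw [frobenius_norm_sq_eq_trace, frobenius_norm_sq_eq_trace, frobenius_norm_sq_eq_trace,
      ← Complex.add_re, ← Matrix.trace_add]
    congr 2
    simp only [Matrix.conjTranspose_mul, Matrix.conjTranspose_sub,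
      Matrix.conjTranspose_conjTranspose, Matrix.sub_mul, Matrix.mul_sub, Matrix.mul_assoc]
    rw [← Matrix.mul_assoc Wᴴ W, hW, Matrix.one_mul]
    abel
  nlinarith [norm_nonneg x, norm_nonneg (Wᴴ * x), sq_nonneg ‖x - W * (Wᴴ * x)‖]

theorem norm_mul_isometry_le [DecidableEq m] [DecidableEq l] {W : Matrix l m ℂ}
    (hW : Wᴴ * W = 1) (x : Matrix n l ℂ) : ‖x * W‖ ≤ ‖x‖ := by
  rw [← Matrix.frobenius_norm_conjTranspose, Matrix.conjTranspose_mul]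
  exact (norm_isometry_conjTranspose_mul_le hW _).trans_eq (Matrix.frobenius_norm_conjTranspose _)

theorem conjTranspose_mul_self_of_unitary [DecidableEq m] (U : Matrix.unitaryGroup m ℂ) :
    (U : Matrix m m ℂ)ᴴ * U = 1 := U.2.1

theorem mul_conjTranspose_self_of_unitary [DecidableEq m] (U : Matrix.unitaryGroup m ℂ) :
    (U : Matrix m m ℂ) * (U : Matrix m m ℂ)ᴴ = 1 := U.2.2

theorem norm_unitary_mul [DecidableEq m] (U : Matrix.unitaryGroup m ℂ) (x : Matrix m n ℂ) :
    ‖(U : Matrix m m ℂ) * x‖ = ‖x‖ :=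
  norm_isometry_mul (conjTranspose_mul_self_of_unitary U) x

theorem norm_mul_unitary [DecidableEq m] (U : Matrix.unitaryGroup m ℂ) (x : Matrix n m ℂ) :
    ‖x * (U : Matrix m m ℂ)‖ = ‖x‖ :=
  norm_mul_coisometry (mul_conjTranspose_self_of_unitary U) x

theorem norm_unitary_conjTranspose_mul [DecidableEq m] (U : Matrix.unitaryGroup m ℂ)
    (x : Matrix m n ℂ) : ‖(U : Matrix m m ℂ)ᴴ * x‖ = ‖x‖ :=
  norm_unitary_mul (star U) x

theorem norm_mul_unitary_conjTranspose [DecidableEq m] (U : Matrix.unitaryGroup m ℂ)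
    (x : Matrix n m ℂ) : ‖x * (U : Matrix m m ℂ)ᴴ‖ = ‖x‖ :=
  norm_mul_unitary (star U) x

theorem frobenius_norm_one_sq [DecidableEq m] : ‖(1 : Matrix m m ℂ)‖ ^ 2 = Fintype.card m := by
  rw [frobenius_norm_sq_eq_trace]; simp

theorem norm_unitary [DecidableEq m] (U : Matrix.unitaryGroup m ℂ) :
    ‖(U : Matrix m m ℂ)‖ = √(Fintype.card m) := by
  rw [← frobenius_norm_one_sq (m := m), Real.sqrt_sq (norm_nonneg _),
    ← norm_unitary_mul U (1 : Matrix m m ℂ), Matrix.mul_one]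

theorem frobenius_norm_kronecker {k : Type*} [Fintype k] (x : Matrix l m ℂ) (y : Matrix n k ℂ) :
    ‖x ⊗ₖ y‖ = ‖x‖ * ‖y‖ := by
  rw [← sq_eq_sq₀ (norm_nonneg _) (by positivity), mul_pow, frobenius_norm_sq, frobenius_norm_sq,
    frobenius_norm_sq, Fintype.sum_prod_type, Finset.sum_mul]
  refine Finset.sum_congr rfl fun i _ => ?_
  rw [Finset.mul_sum]
  refine Finset.sum_congr rfl fun j _ => ?_
  rw [Fintype.sum_prod_type, Finset.sum_mul]
  refine Finset.sum_congr rfl fun p _ => ?_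
  rw [Finset.mul_sum]
  refine Finset.sum_congr rfl fun q _ => ?_
  simp [mul_pow]

theorem frobenius_norm_map_star (x : Matrix m n ℂ) : ‖x.map star‖ = ‖x‖ :=
  Matrix.frobenius_norm_map_eq _ _ fun a => norm_star a

theorem frobenius_norm_submatrix_equiv {k : Type*} [Fintype k] (x : Matrix m n ℂ) (e : l ≃ m)
    (f : k ≃ n) : ‖x.submatrix e f‖ = ‖x‖ := by
  rw [← sq_eq_sq₀ (norm_nonneg _) (norm_nonneg _), frobenius_norm_sq, frobenius_norm_sq]
  simp only [Matrix.submatrix_apply]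
  rw [← e.sum_comp]
  exact Finset.sum_congr rfl fun i _ => f.sum_comp fun j => ‖x (e i) j‖ ^ 2

theorem frobenius_norm_diagonal_mul_sq [DecidableEq m] (a : m → ℂ) (x : Matrix m n ℂ) :
    ‖Matrix.diagonal a * x‖ ^ 2 = ∑ i, ‖a i‖ ^ 2 * ∑ j, ‖x i j‖ ^ 2 := by
  rw [frobenius_norm_sq]
  simp [Matrix.diagonal_mul, mul_pow, Finset.mul_sum]

end Frobenius

/-! ### Polar decomposition and nearby unitaries -/

section Polar

open scoped Matrix.Norms.Frobenius ComplexOrder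

/-- A matrix whose Gram matrix is diagonal is a unitary times the diagonal of column norms. -/
theorem exists_unitary_mul_diagonal {n : Type*} [Fintype n] [DecidableEq n] (B : Matrix n n ℂ)
    (s : n → ℝ)
    (hB : Bᴴ * B = Matrix.diagonal fun i => ((s i ^ 2 : ℝ) : ℂ)) :
    ∃ U : Matrix.unitaryGroup n ℂ, B = U * Matrix.diagonal fun i => (s i : ℂ) := by
  let col : n → EuclideanSpace ℂ n := fun j => WithLp.toLp 2 fun i => B i j
  have hcol : ∀ i j, inner ℂ (col i) (col j) = if i = j then ((s i ^ 2 : ℝ) : ℂ) else 0 := by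
    intro i j
    have := congrFun (congrFun hB i) j
    rw [Matrix.diagonal_apply] at this
    rw [← this]
    simp [col, PiLp.inner_apply, Matrix.mul_apply, mul_comm]
  -- Columns with `s j = 0` vanish, so only the others are normalized. Any completion to an
  -- orthonormal basis supplies the remaining columns of the unitary.
  let v : n → EuclideanSpace ℂ n := fun j => ((s j)⁻¹ : ℂ) • col j
  have hv : Orthonormal ℂ (({i | s i ≠ 0} : Set n).domRestrict v) := by
    rw [orthonormal_iff_ite]
    rintro ⟨i, hi⟩ ⟨j, hj⟩
    simp only [Set.mem_ofPred_eq] at hi hj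
    simp only [Set.domRestrict_apply, v, inner_smul_left, inner_smul_right, hcol, Subtype.mk.injEq]
    split_ifs with h
    · subst h
      have : (s i : ℂ) ≠ 0 := by exact_mod_cast hi
      simp
      field_simp
    · simp
  obtain ⟨b, hb⟩ := hv.exists_orthonormalBasis_extension_of_card_eq
    (by simp)
  let c := (EuclideanSpace.basisFun n ℂ).toBasis.toMatrix b
  have hc : c ∈ Matrix.unitaryGroup n ℂ :=
    (EuclideanSpace.basisFun n ℂ).toMatrix_orthonormalBasis_mem_unitary b
  refine ⟨⟨c, hc⟩, ?_⟩
  ext i j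
  rw [Matrix.mul_diagonal]
  have hcij : c i j = b j i := by
    simp [c, Module.Basis.toMatrix_apply]
  change B i j = c i j * (s j : ℂ)
  rw [hcij]
  by_cases hj : s j = 0
  · have h0 : inner ℂ (col j) (col j) = 0 := by rw [hcol]; simp [hj]
    rw [inner_self_eq_zero] at h0
    have : B i j = col j i := rfl
    rw [this, h0, hj]
    simp
  · rw [hb j hj]
    have : (s j : ℂ) ≠ 0 := by exact_mod_cast hj
    simp only [v, col, PiLp.smul_apply, smul_eq_mul]
    field_simp

/-- Every matrix `A` is within `‖A* A - 1‖` of a unitary matrix. -/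
theorem exists_unitary_norm_sub_le {n : Type*} [Fintype n] [DecidableEq n] (A : Matrix n n ℂ) :
    ∃ U : Matrix.unitaryGroup n ℂ, ‖A - U‖ ≤ ‖Aᴴ * A - 1‖ := by
  have hpsd : (Aᴴ * A).PosSemidef := Matrix.posSemidef_conjTranspose_mul_self A
  have hA := hpsd.isHermitian
  set V := hA.eigenvectorUnitary
  set μ := hA.eigenvalues
  have hμ : ∀ i, 0 ≤ μ i := hpsd.eigenvalues_nonneg
  have hspec : Aᴴ * A = V * Matrix.diagonal (fun i => (μ i : ℂ)) * (V : Matrix n n ℂ)ᴴ := by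
    have := hA.spectral_theorem
    rw [Unitary.conjStarAlgAut_apply] at this
    exact this
  obtain ⟨U, hU⟩ := exists_unitary_mul_diagonal (A * (V : Matrix n n ℂ)) (fun i => √(μ i))
    (by
      simp only [Real.sq_sqrt (hμ _)]
      rw [Matrix.conjTranspose_mul, Matrix.mul_assoc, ← Matrix.mul_assoc Aᴴ, hspec]
      simp only [Matrix.mul_assoc]
      rw [conjTranspose_mul_self_of_unitary, Matrix.mul_one, ← Matrix.mul_assoc,
        conjTranspose_mul_self_of_unitary, Matrix.one_mul])
  -- This is the unitary factor of the polar decomposition of `A`. In the eigenbasis the claim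
  -- becomes |√μ - 1| ≤ |μ - 1|, which holds since μ - 1 = (√μ - 1)(√μ + 1).
  refine ⟨U * star V, ?_⟩
  have h1 : ‖A - ((U * star V : Matrix.unitaryGroup n ℂ) : Matrix n n ℂ)‖ =
      ‖Matrix.diagonal (fun i => ((√(μ i) : ℝ) : ℂ)) - 1‖ := by
    rw [← norm_mul_unitary V, ← norm_unitary_mul U (_ - 1), Matrix.sub_mul, hU]
    congr 1
    have : ((U * star V : Matrix.unitaryGroup n ℂ) : Matrix n n ℂ) = U * (V : Matrix n n ℂ)ᴴ := rfl
    rw [this, Matrix.mul_assoc, conjTranspose_mul_self_of_unitary, Matrix.mul_sub]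
  have h2 : ‖Aᴴ * A - 1‖ = ‖Matrix.diagonal (fun i => (μ i : ℂ)) - 1‖ := by
    rw [← norm_mul_unitary V, ← norm_unitary_mul V (_ - 1), hspec, Matrix.sub_mul,
      Matrix.mul_assoc _ _ (V : Matrix n n ℂ), conjTranspose_mul_self_of_unitary, Matrix.mul_sub]
    simp
  rw [h1, h2, ← sq_le_sq₀ (norm_nonneg _) (norm_nonneg _), ← Matrix.diagonal_one,
    Matrix.diagonal_sub, Matrix.diagonal_sub, ← Matrix.mul_one (Matrix.diagonal _),
    ← Matrix.mul_one (Matrix.diagonal fun i => (μ i : ℂ) - 1), frobenius_norm_diagonal_mul_sq,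
    frobenius_norm_diagonal_mul_sq]
  refine Finset.sum_le_sum fun i _ => mul_le_mul_of_nonneg_right ?_ (by positivity)
  have e1 : ((√(μ i) : ℝ) : ℂ) - 1 = ((√(μ i) - 1 : ℝ) : ℂ) := by push_cast; ring
  have e2 : (μ i : ℂ) - 1 = ((μ i - 1 : ℝ) : ℂ) := by push_cast; ring
  rw [e1, e2, Complex.norm_real, Complex.norm_real, Real.norm_eq_abs, Real.norm_eq_abs, sq_abs,
    sq_abs]
  have h3 := Real.sq_sqrt (hμ i)
  have h4 := Real.sqrt_nonneg (μ i)
  have : μ i - 1 = (√(μ i) - 1) * (√(μ i) + 1) := by nlinarith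
  rw [this, mul_pow]
  nlinarith [sq_nonneg (√(μ i) - 1)]

end Polar

/-! ### Spectral gap and powers of the lazy Markov operator -/

section Gap

open scoped Matrix.Norms.Frobenius ComplexOrder Kronecker

/-- Property (T;FD) with a nonempty generating set and with a gap at most `1`. -/
theorem HasPropertyTFD.exists_nonempty {G : Type*} [Group G] (h : HasPropertyTFD G) :
    ∃ S : Finset G, S.Nonempty ∧ (∀ s ∈ S, s⁻¹ ∈ S) ∧ Subgroup.closure (S : Set G) = ⊤ ∧
      ∃ gap : ℝ, 0 < gap ∧ gap ≤ 1 ∧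
        ∀ (n : ℕ) (ρ : G →* Matrix.unitaryGroup (Fin n) ℂ),
          spectrum ℝ (repLaplacian S ρ) ∩ Set.Ioo 0 gap = ∅ := by
  obtain ⟨S, hsymm, hgen, gap, hpos, hgap⟩ := h
  rcases S.eq_empty_or_nonempty with rfl | hS
  -- An empty generating set means that the group is trivial. Then `{1}` serves, with Laplacian 0.
  · refine ⟨{1}, by simp, by simp, ?_, 1, one_pos, le_rfl, fun n ρ => ?_⟩
    · rw [Finset.coe_empty, Subgroup.closure_empty] at hgen
      rw [Finset.coe_singleton, Subgroup.closure_singleton_one, hgen]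
    · have : repLaplacian {1} ρ = 0 := by simp [repLaplacian]
      rw [this, Set.eq_empty_iff_forall_notMem]
      rintro x ⟨hx, hx0, -⟩
      rw [spectrum.mem_iff, sub_zero] at hx
      apply hx
      exact (IsUnit.mk0 x hx0.ne').map (algebraMap ℝ (Matrix (Fin n) (Fin n) ℂ))
  · refine ⟨S, hS, hsymm, hgen, min gap 1, lt_min hpos one_pos, min_le_right _ _, fun n ρ => ?_⟩
    rw [← Set.subset_empty_iff, ← hgap n ρ]
    exact Set.inter_subset_inter_right _ (Set.Ioo_subset_Ioo_right (min_le_left _ _))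

variable {G : Type*} [Group G]

/-- The Markov operator `(1 + |S|⁻¹ ∑ ρ(s)) / 2` of a unitary representation. -/
noncomputable def lazyMarkov (S : Finset G) {n : ℕ} (ρ : G →* Matrix.unitaryGroup (Fin n) ℂ) :
    Matrix (Fin n) (Fin n) ℂ :=
  1 - (2 : ℂ)⁻¹ • repLaplacian S ρ

theorem repLaplacian_isHermitian {S : Finset G} (hS : ∀ s ∈ S, s⁻¹ ∈ S) {n : ℕ}
    (ρ : G →* Matrix.unitaryGroup (Fin n) ℂ) : (repLaplacian S ρ).IsHermitian := by
  rw [Matrix.IsHermitian, repLaplacian, Matrix.conjTranspose_sub, Matrix.conjTranspose_smul,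
    Matrix.conjTranspose_one, Matrix.conjTranspose_sum]
  congr 2
  · simp
  · refine Finset.sum_bij' (fun s _ => s⁻¹) (fun s _ => s⁻¹) hS hS (by simp) (by simp) ?_
    intro s _
    rw [map_inv]
    rfl

/-- The Dirichlet form of the Laplacian. -/
theorem sum_norm_sub_sq_eq {S : Finset G} (hS : S.Nonempty) {n : ℕ}
    (ρ : G →* Matrix.unitaryGroup (Fin n) ℂ) {m : Type*} [Fintype m] (x : Matrix (Fin n) m ℂ) :
    ∑ s ∈ S, ‖(ρ s : Matrix (Fin n) (Fin n) ℂ) * x - x‖ ^ 2 =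
      2 * S.card * (xᴴ * (repLaplacian S ρ * x)).trace.re := by
  have hcard : (S.card : ℂ) ≠ 0 := by exact_mod_cast hS.card_pos.ne'
  have key : ∀ s : G, ‖(ρ s : Matrix (Fin n) (Fin n) ℂ) * x - x‖ ^ 2 =
      2 * (xᴴ * x).trace.re - 2 * (xᴴ * ((ρ s : Matrix (Fin n) (Fin n) ℂ) * x)).trace.re := by
    intro s
    have hre : (xᴴ * ((ρ s : Matrix (Fin n) (Fin n) ℂ)ᴴ * x)).trace.re =
        (xᴴ * ((ρ s : Matrix (Fin n) (Fin n) ℂ) * x)).trace.re := by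
      have : xᴴ * ((ρ s : Matrix (Fin n) (Fin n) ℂ)ᴴ * x) =
          (xᴴ * ((ρ s : Matrix (Fin n) (Fin n) ℂ) * x))ᴴ := by
        simp [Matrix.conjTranspose_mul, Matrix.mul_assoc]
      rw [this, Matrix.trace_conjTranspose]
      simp
    rw [frobenius_norm_sq_eq_trace]
    simp only [Matrix.conjTranspose_sub, Matrix.conjTranspose_mul, Matrix.sub_mul, Matrix.mul_sub,
      Matrix.mul_assoc, Matrix.trace_sub, Complex.sub_re, hre]
    rw [← Matrix.mul_assoc _ (ρ s : Matrix (Fin n) (Fin n) ℂ) x,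
      conjTranspose_mul_self_of_unitary, Matrix.one_mul]
    ring
  simp only [key]
  rw [repLaplacian, Matrix.sub_mul, Matrix.mul_sub, Matrix.one_mul, Matrix.trace_sub,
    Matrix.smul_mul, Matrix.mul_smul, Matrix.trace_smul, Matrix.sum_mul, Matrix.mul_sum,
    Matrix.trace_sum, Complex.sub_re, Finset.sum_sub_distrib, Finset.sum_const, nsmul_eq_mul,
    smul_eq_mul, ← Complex.ofReal_natCast, ← Complex.ofReal_inv, Complex.re_ofReal_mul,
    Complex.re_sum, ← Finset.mul_sum]
  have : (S.card : ℝ) ≠ 0 := by exact_mod_cast hS.card_pos.ne'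
  field_simp

theorem trace_conj_diagonal_re {n m : Type*} [Fintype n] [DecidableEq n] [Fintype m]
    (V : Matrix n n ℂ) (a : n → ℝ) (x : Matrix n m ℂ) :
    (xᴴ * (V * Matrix.diagonal (fun i => (a i : ℂ)) * Vᴴ * x)).trace.re =
      ∑ i, a i * ∑ j, ‖(Vᴴ * x) i j‖ ^ 2 := by
  have h1 : xᴴ * (V * Matrix.diagonal (fun i => (a i : ℂ)) * Vᴴ * x) =
      (Vᴴ * x)ᴴ * (Matrix.diagonal (fun i => (a i : ℂ)) * (Vᴴ * x)) := by
    simp [Matrix.conjTranspose_mul, Matrix.mul_assoc]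
  rw [h1]
  set y := Vᴴ * x
  have h2 : Matrix.diagonal (fun i => (a i : ℂ)) * y = Matrix.of fun i j => (a i : ℂ) * y i j := by
    ext i j
    simp [Matrix.diagonal_mul]
  simp only [h2, Matrix.trace, Matrix.diag_apply, Matrix.mul_apply, Matrix.of_apply,
    Matrix.conjTranspose_apply, Complex.re_sum, Finset.mul_sum]
  rw [Finset.sum_comm]
  refine Finset.sum_congr rfl fun i _ => Finset.sum_congr rfl fun j _ => ?_
  rw [mul_left_comm, Complex.re_ofReal_mul, Complex.star_def, Complex.conj_mul']
  norm_cast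

theorem conj_diagonal_pow {n : Type*} [Fintype n] [DecidableEq n] {V : Matrix n n ℂ}
    (hV : Vᴴ * V = 1) (a : n → ℂ) (k : ℕ) :
    (V * Matrix.diagonal a * Vᴴ) ^ k = V * Matrix.diagonal (fun i => a i ^ k) * Vᴴ := by
  have hV' : V * Vᴴ = 1 := mul_eq_one_comm.mp hV
  induction k with
  | zero => simp [hV']
  | succ k ih =>
    rw [pow_succ, ih]
    calc _ = V * Matrix.diagonal (fun i => a i ^ k) * (Vᴴ * V) * Matrix.diagonal a * Vᴴ := by
          simp only [Matrix.mul_assoc]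
      _ = _ := by
          rw [hV, Matrix.mul_one, Matrix.mul_assoc V, Matrix.diagonal_mul_diagonal]
          simp [pow_succ]

theorem norm_conj_diagonal_mul_sq {n m : Type*} [Fintype n] [DecidableEq n] [Fintype m]
    {V : Matrix n n ℂ} (hV : Vᴴ * V = 1) (a : n → ℂ) (x : Matrix n m ℂ) :
    ‖V * Matrix.diagonal a * Vᴴ * x‖ ^ 2 = ∑ i, ‖a i‖ ^ 2 * ∑ j, ‖(Vᴴ * x) i j‖ ^ 2 := by
  rw [Matrix.mul_assoc, Matrix.mul_assoc, norm_isometry_mul hV, frobenius_norm_diagonal_mul_sq]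

/-- Under a spectral gap, the powers of the Markov operator move almost invariant vectors little
and send every vector to vectors which are invariant up to an exponentially small error. -/
theorem lazyMarkov_pow_bounds {S : Finset G} (hS : S.Nonempty) (hsymm : ∀ s ∈ S, s⁻¹ ∈ S)
    {gap : ℝ} (hgap0 : 0 < gap) {n : ℕ}
    (ρ : G →* Matrix.unitaryGroup (Fin n) ℂ)
    (hgap : spectrum ℝ (repLaplacian S ρ) ∩ Set.Ioo 0 gap = ∅)
    {m : Type} [Fintype m] (x : Matrix (Fin n) m ℂ) (k : ℕ) :
    ‖lazyMarkov S ρ ^ k * x - x‖ ^ 2 ≤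
        (∑ s ∈ S, ‖(ρ s : Matrix (Fin n) (Fin n) ℂ) * x - x‖ ^ 2) / (2 * S.card * gap) ∧
      ∑ s ∈ S, ‖(ρ s : Matrix (Fin n) (Fin n) ℂ) * (lazyMarkov S ρ ^ k * x) -
          lazyMarkov S ρ ^ k * x‖ ^ 2 ≤ 4 * S.card * ((1 - gap / 2) ^ k) ^ 2 * ‖x‖ ^ 2 := by
  have hL := repLaplacian_isHermitian hsymm ρ
  obtain ⟨V, hV⟩ : ∃ V : Matrix.unitaryGroup (Fin n) ℂ, V = hL.eigenvectorUnitary := ⟨_, rfl⟩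
  set a := hL.eigenvalues with ha
  have hV1 := conjTranspose_mul_self_of_unitary V
  have hV2 := mul_conjTranspose_self_of_unitary V
  have hspec : repLaplacian S ρ =
      V * Matrix.diagonal (fun i => (a i : ℂ)) * (V : Matrix (Fin n) (Fin n) ℂ)ᴴ := by
    have := hL.spectral_theorem
    rw [Unitary.conjStarAlgAut_apply, ← hV] at this
    exact this
  have hcard : (0 : ℝ) < S.card := by exact_mod_cast hS.card_pos
  have hdir : ∀ {m : Type} [Fintype m] (x : Matrix (Fin n) m ℂ),
      ∑ s ∈ S, ‖(ρ s : Matrix (Fin n) (Fin n) ℂ) * x - x‖ ^ 2 = 2 * S.card *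
        ∑ i, a i * ∑ j, ‖((V : Matrix (Fin n) (Fin n) ℂ)ᴴ * x) i j‖ ^ 2 := by
    intro m _ x
    rw [sum_norm_sub_sq_eq hS, hspec, trace_conj_diagonal_re]
  -- Evaluating the Dirichlet form at the `i`-th eigenvector bounds `a i` between 0 and 2. Hence the
  -- lazy operator has spectrum in [0, 1], with no eigenvalue near -1 to obstruct convergence of its
  -- powers.
  have hrange : ∀ i, a i = 0 ∨ (gap ≤ a i ∧ a i ≤ 2) := by
    intro i
    let e : Matrix (Fin n) (Fin n) ℂ := Matrix.single i i 1
    have h0 := hdir ((V : Matrix (Fin n) (Fin n) ℂ) * e)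
    have hnorm : ‖(V : Matrix (Fin n) (Fin n) ℂ) * e‖ = 1 := by
      rw [norm_unitary_mul, ← sq_eq_sq₀ (norm_nonneg _) zero_le_one, frobenius_norm_sq]
      simp [e, Matrix.single_apply, ite_and, apply_ite]
    have h1 : ∑ i', a i' * ∑ j, ‖((V : Matrix (Fin n) (Fin n) ℂ)ᴴ *
        ((V : Matrix (Fin n) (Fin n) ℂ) * e)) i' j‖ ^ 2 = a i := by
      rw [← Matrix.mul_assoc, hV1, Matrix.one_mul]
      simp [e, Matrix.single_apply, ite_and, apply_ite]
    rw [h1] at h0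
    have h2 : ∑ s ∈ S, ‖(ρ s : Matrix (Fin n) (Fin n) ℂ) * ((V : Matrix (Fin n) (Fin n) ℂ) * e) -
        (V : Matrix (Fin n) (Fin n) ℂ) * e‖ ^ 2 ≤ S.card * 4 := by
      rw [← nsmul_eq_mul]
      refine Finset.sum_le_card_nsmul _ _ _ fun s _ => ?_
      have := norm_sub_le ((ρ s : Matrix (Fin n) (Fin n) ℂ) * ((V : Matrix (Fin n) (Fin n) ℂ) * e))
        ((V : Matrix (Fin n) (Fin n) ℂ) * e)
      rw [norm_unitary_mul, hnorm] at this
      nlinarith [norm_nonneg ((ρ s : Matrix (Fin n) (Fin n) ℂ) *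
        ((V : Matrix (Fin n) (Fin n) ℂ) * e) - (V : Matrix (Fin n) (Fin n) ℂ) * e)]
    have h3 : 0 ≤ ∑ s ∈ S, ‖(ρ s : Matrix (Fin n) (Fin n) ℂ) *
        ((V : Matrix (Fin n) (Fin n) ℂ) * e) - (V : Matrix (Fin n) (Fin n) ℂ) * e‖ ^ 2 :=
      Finset.sum_nonneg fun _ _ => by positivity
    rw [h0] at h2 h3
    have h4 : 0 ≤ a i := by
      by_contra! h
      nlinarith
    have h5 : a i ≤ 2 := by
      by_contra! h
      nlinarith
    rcases h4.eq_or_lt with h6 | h6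
    · exact Or.inl h6.symm
    · refine Or.inr ⟨?_, h5⟩
      by_contra! h7
      have : a i ∈ spectrum ℝ (repLaplacian S ρ) ∩ Set.Ioo 0 gap :=
        ⟨hL.eigenvalues_mem_spectrum_real i, h6, h7⟩
      rw [hgap] at this
      exact this
  have hM : lazyMarkov S ρ = V * Matrix.diagonal (fun i => ((1 - a i / 2 : ℝ) : ℂ)) *
      (V : Matrix (Fin n) (Fin n) ℂ)ᴴ := by
    have : (Matrix.diagonal fun i => ((1 - a i / 2 : ℝ) : ℂ)) =
        1 - (2 : ℂ)⁻¹ • Matrix.diagonal (fun i => (a i : ℂ)) := by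
      rw [← Matrix.diagonal_one, ← Matrix.diagonal_smul, Matrix.diagonal_sub]
      congr 1
      ext i
      simp
      ring
    rw [this, lazyMarkov, hspec, Matrix.mul_sub, Matrix.sub_mul, Matrix.mul_one, hV2]
    simp
  have hMk : lazyMarkov S ρ ^ k = V * Matrix.diagonal (fun i => (((1 - a i / 2) ^ k : ℝ) : ℂ)) *
      (V : Matrix (Fin n) (Fin n) ℂ)ᴴ := by
    rw [hM, conj_diagonal_pow hV1]
    simp
  have hMk1 : lazyMarkov S ρ ^ k - 1 =
      V * Matrix.diagonal (fun i => (((1 - a i / 2) ^ k - 1 : ℝ) : ℂ)) *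
      (V : Matrix (Fin n) (Fin n) ℂ)ᴴ := by
    have : (Matrix.diagonal fun i => (((1 - a i / 2) ^ k - 1 : ℝ) : ℂ)) =
        Matrix.diagonal (fun i => (((1 - a i / 2) ^ k : ℝ) : ℂ)) - 1 := by
      rw [← Matrix.diagonal_one, Matrix.diagonal_sub]
      congr 1
      ext i
      push_cast
      rfl
    rw [this, Matrix.mul_sub, Matrix.sub_mul, Matrix.mul_one, hV2, ← hMk]
  have hw : ∀ i, 0 ≤ ∑ j, ‖((V : Matrix (Fin n) (Fin n) ℂ)ᴴ * x) i j‖ ^ 2 := fun i => by positivity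
  have hbase : ∀ i, 0 ≤ 1 - a i / 2 ∧ 1 - a i / 2 ≤ 1 := by
    intro i
    rcases hrange i with h | h <;> constructor <;> linarith
  constructor
  · have : lazyMarkov S ρ ^ k * x - x = (lazyMarkov S ρ ^ k - 1) * x := by
      rw [Matrix.sub_mul, Matrix.one_mul]
    rw [this, hMk1, norm_conj_diagonal_mul_sq hV1, hdir,
      le_div_iff₀ (mul_pos (mul_pos two_pos hcard) hgap0), Finset.sum_mul, Finset.mul_sum]
    refine Finset.sum_le_sum fun i _ => ?_
    rw [Complex.norm_real, Real.norm_eq_abs, sq_abs]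
    -- The invariant part (`a i = 0`) does not move. On the rest the left side is at most `gap ≤ a
    -- i`, so the displacement is controlled by the Dirichlet form uniformly in `k`.
    have h1 : ((1 - a i / 2) ^ k - 1) ^ 2 * gap ≤ a i := by
      rcases hrange i with h | h
      · simp [h]
      · have h2 := pow_nonneg (hbase i).1 k
        have h3 := pow_le_one₀ (n := k) (hbase i).1 (hbase i).2
        have : ((1 - a i / 2) ^ k - 1) ^ 2 ≤ 1 := by nlinarith
        nlinarith
    nlinarith [mul_le_mul_of_nonneg_right h1 (mul_nonneg hcard.le (hw i))]
  · rw [hdir]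
    have hx : ‖x‖ ^ 2 = ∑ i, ∑ j, ‖((V : Matrix (Fin n) (Fin n) ℂ)ᴴ * x) i j‖ ^ 2 := by
      rw [← frobenius_norm_sq, norm_unitary_conjTranspose_mul]
    have hy : (V : Matrix (Fin n) (Fin n) ℂ)ᴴ * (lazyMarkov S ρ ^ k * x) =
        Matrix.diagonal (fun i => (((1 - a i / 2) ^ k : ℝ) : ℂ)) *
          ((V : Matrix (Fin n) (Fin n) ℂ)ᴴ * x) := by
      rw [hMk]
      simp only [Matrix.mul_assoc]
      rw [← Matrix.mul_assoc _ (V : Matrix (Fin n) (Fin n) ℂ), hV1, Matrix.one_mul]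
    rw [hx, hy, Finset.mul_sum, Finset.mul_sum]
    refine Finset.sum_le_sum fun i _ => ?_
    simp only [Matrix.diagonal_mul, norm_mul, mul_pow, Complex.norm_real, Real.norm_eq_abs, sq_abs]
    rw [← Finset.mul_sum]
    have h1 : a i * ((1 - a i / 2) ^ k) ^ 2 ≤ 2 * ((1 - gap / 2) ^ k) ^ 2 := by
      rcases hrange i with h | h
      · simp only [h, zero_mul]
        positivity
      · have h3 := pow_le_pow_left₀ (hbase i).1
          (show 1 - a i / 2 ≤ 1 - gap / 2 by linarith [h.1]) k
        have h4 := pow_le_pow_left₀ (pow_nonneg (hbase i).1 k) h3 2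
        have : 0 ≤ ((1 - a i / 2) ^ k) ^ 2 := by positivity
        nlinarith [h.1, h.2]
    nlinarith [mul_le_mul_of_nonneg_right h1 (mul_nonneg hcard.le (hw i))]

end Gap

/-! ### The representation `X ↦ τ(g) X R(g)*` -/

section Bimodule

open scoped Matrix.Norms.Frobenius Kronecker

variable {G : Type*}

/-- The lazy average `(X + |S|⁻¹ ∑ f(s) X h(s)*) / 2`. -/
noncomputable def conjAvg {m n : Type*} [Fintype m] [Fintype n] (S : Finset G)
    (f : G → Matrix m m ℂ) (h : G → Matrix n n ℂ) (X : Matrix m n ℂ) : Matrix m n ℂ :=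
  (2 : ℂ)⁻¹ • (X + (S.card : ℂ)⁻¹ • ∑ s ∈ S, f s * X * (h s)ᴴ)

variable [Group G]

/-- The unitary representation `X ↦ τ(g) X R(g)*` on matrices, in coordinates. -/
noncomputable def bimoduleRep {p n : Type*} [Fintype p] [DecidableEq p] [Fintype n] [DecidableEq n]
    {N : ℕ} (e : Fin N ≃ n × p) (τ : G →* Matrix.unitaryGroup p ℂ)
    (R : G →* Matrix.unitaryGroup n ℂ) : G →* Matrix.unitaryGroup (Fin N) ℂ where
  toFun g := ⟨(((R g : Matrix n n ℂ).map star) ⊗ₖ (τ g : Matrix p p ℂ)).submatrix e e, by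
    have h := Matrix.kronecker_mem_unitary
      (Matrix.map_star_mem_unitaryGroup_iff.2 (R g).2) (τ g).2
    rw [Matrix.mem_unitaryGroup_iff, Matrix.star_eq_conjTranspose, Matrix.conjTranspose_submatrix,
      Matrix.submatrix_mul_equiv, ← Matrix.star_eq_conjTranspose, Matrix.mem_unitaryGroup_iff.1 h,
      Matrix.submatrix_one_equiv]⟩
  map_one' := by
    apply Subtype.ext
    simp
  map_mul' g h := by
    apply Subtype.ext
    have : (((R g : Matrix n n ℂ) * (R h : Matrix n n ℂ)).map star) =
        (R g : Matrix n n ℂ).map star * (R h : Matrix n n ℂ).map star :=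
      Matrix.map_mul (f := starRingEnd ℂ)
    simp only [map_mul, Submonoid.coe_mul, this, Matrix.mul_kronecker_mul]
    rw [Matrix.submatrix_mul_equiv]

/-- The entries of a matrix as a column, in the coordinates `e`. -/
noncomputable def vecCol {p n : Type*} {N : ℕ} (e : Fin N ≃ n × p) :
    Matrix p n ℂ →ₗ[ℂ] Matrix (Fin N) Unit ℂ where
  toFun X := Matrix.of fun i _ => X.vec (e i)
  map_add' X Y := by ext; simp
  map_smul' c X := by ext; simp

theorem vecCol_apply {p n : Type*} {N : ℕ} (e : Fin N ≃ n × p) (X : Matrix p n ℂ) (i : Fin N)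
    (j : Unit) : vecCol e X i j = X (e i).2 (e i).1 := rfl

theorem norm_vecCol {p n : Type*} [Fintype p] [Fintype n] {N : ℕ} (e : Fin N ≃ n × p)
    (X : Matrix p n ℂ) : ‖vecCol e X‖ = ‖X‖ := by
  rw [← sq_eq_sq₀ (norm_nonneg _) (norm_nonneg _), frobenius_norm_sq, frobenius_norm_sq]
  simp only [vecCol_apply, Finset.univ_unique, Finset.sum_const, Finset.card_singleton, one_smul]
  rw [e.sum_comp fun q => ‖X q.2 q.1‖ ^ 2, Fintype.sum_prod_type, Finset.sum_comm]

/-- This is vec(A X B) = (Bᵀ ⊗ A) vec X with B = R(g)*, whence the entrywise conjugate of `R` in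
`bimoduleRep`. It turns the two-sided action into a representation on column vectors, to which
(T;FD) applies. -/
theorem bimoduleRep_mul_vecCol {p n : Type*} [Fintype p] [DecidableEq p] [Fintype n]
    [DecidableEq n] {N : ℕ} (e : Fin N ≃ n × p) (τ : G →* Matrix.unitaryGroup p ℂ)
    (R : G →* Matrix.unitaryGroup n ℂ) (g : G) (X : Matrix p n ℂ) :
    (bimoduleRep e τ R g : Matrix (Fin N) (Fin N) ℂ) * vecCol e X =
      vecCol e ((τ g : Matrix p p ℂ) * X * (R g : Matrix n n ℂ)ᴴ) := by
  have h1 := Matrix.kronecker_mulVec_vec (τ g : Matrix p p ℂ) X ((R g : Matrix n n ℂ).map star)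
  have h2 : ((R g : Matrix n n ℂ).map star)ᵀ = (R g : Matrix n n ℂ)ᴴ := rfl
  rw [h2] at h1
  ext i j
  have h3 := congrFun h1 (e i)
  rw [Matrix.mulVec, dotProduct, ← e.sum_comp] at h3
  rw [Matrix.mul_apply]
  exact h3

theorem lazyMarkov_bimoduleRep_mul_vecCol {p n : Type*} [Fintype p] [DecidableEq p] [Fintype n]
    [DecidableEq n] {N : ℕ} (e : Fin N ≃ n × p) (τ : G →* Matrix.unitaryGroup p ℂ)
    (R : G →* Matrix.unitaryGroup n ℂ) (S : Finset G) (X : Matrix p n ℂ) :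
    lazyMarkov S (bimoduleRep e τ R) * vecCol e X =
      vecCol e (conjAvg S (fun g => (τ g : Matrix p p ℂ)) (fun g => (R g : Matrix n n ℂ)) X) := by
  have h : vecCol e (∑ s ∈ S, (τ s : Matrix p p ℂ) * X * (R s : Matrix n n ℂ)ᴴ) =
      (∑ s ∈ S, (bimoduleRep e τ R s : Matrix (Fin N) (Fin N) ℂ)) * vecCol e X := by
    rw [map_sum, Matrix.sum_mul]
    exact Finset.sum_congr rfl fun s _ => (bimoduleRep_mul_vecCol e τ R s X).symm
  rw [conjAvg, map_smul, map_add, map_smul, h, lazyMarkov, repLaplacian]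
  simp only [Matrix.sub_mul, Matrix.one_mul, Matrix.smul_mul]
  module

/-- The spectral gap of `G` applied to the representation `X ↦ τ(g) X R(g)*`. -/
theorem conjAvg_iterate_bounds {S : Finset G} (hS : S.Nonempty) (hsymm : ∀ s ∈ S, s⁻¹ ∈ S)
    {gap : ℝ} (hgap0 : 0 < gap)
    (hgap : ∀ (n : ℕ) (ρ : G →* Matrix.unitaryGroup (Fin n) ℂ),
      spectrum ℝ (repLaplacian S ρ) ∩ Set.Ioo 0 gap = ∅)
    {p n : Type*} [Fintype p] [DecidableEq p] [Fintype n] [DecidableEq n]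
    (τ : G →* Matrix.unitaryGroup p ℂ) (R : G →* Matrix.unitaryGroup n ℂ)
    (X : Matrix p n ℂ) (k : ℕ) :
    ‖(conjAvg S (fun g => (τ g : Matrix p p ℂ)) (fun g => (R g : Matrix n n ℂ)))^[k] X - X‖ ^ 2 ≤
        (∑ s ∈ S, ‖(τ s : Matrix p p ℂ) * X * (R s : Matrix n n ℂ)ᴴ - X‖ ^ 2) /
          (2 * S.card * gap) ∧
      ∑ s ∈ S, ‖(τ s : Matrix p p ℂ) *
          (conjAvg S (fun g => (τ g : Matrix p p ℂ)) (fun g => (R g : Matrix n n ℂ)))^[k] X *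
          (R s : Matrix n n ℂ)ᴴ -
          (conjAvg S (fun g => (τ g : Matrix p p ℂ)) (fun g => (R g : Matrix n n ℂ)))^[k] X‖ ^ 2 ≤
        4 * S.card * ((1 - gap / 2) ^ k) ^ 2 * ‖X‖ ^ 2 := by
  let e : Fin (Fintype.card (n × p)) ≃ n × p := (Fintype.equivFin (n × p)).symm
  have hiter : ∀ k, lazyMarkov S (bimoduleRep e τ R) ^ k * vecCol e X =
      vecCol e ((conjAvg S (fun g => (τ g : Matrix p p ℂ))
        (fun g => (R g : Matrix n n ℂ)))^[k] X) := by
    intro k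
    induction k with
    | zero => simp
    | succ k ih =>
      rw [Function.iterate_succ_apply', ← lazyMarkov_bimoduleRep_mul_vecCol, ← ih, pow_succ',
        Matrix.mul_assoc]
  have h := lazyMarkov_pow_bounds hS hsymm hgap0 (bimoduleRep e τ R) (hgap _ _) (vecCol e X) k
  simp only [hiter, bimoduleRep_mul_vecCol, ← map_sub, norm_vecCol] at h
  exact h

end Bimodule

/-! ### Linearity and convexity of the lazy average -/

section ConjAvg

variable {G : Type*}

theorem conjAvg_sub {m n : Type*} [Fintype m] [Fintype n] (S : Finset G)
    (f : G → Matrix m m ℂ) (h : G → Matrix n n ℂ) (X Y : Matrix m n ℂ) :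
    conjAvg S f h (X - Y) = conjAvg S f h X - conjAvg S f h Y := by
  simp only [conjAvg, Matrix.mul_sub, Matrix.sub_mul, Finset.sum_sub_distrib]
  module

/-- A convex set which is invariant under all `X ↦ f(s) X h(s)*` is invariant under the lazy
average. -/
theorem conjAvg_mem {m n : Type*} [Fintype m] [Fintype n] {S : Finset G} (hS : S.Nonempty)
    {f : G → Matrix m m ℂ} {h : G → Matrix n n ℂ} {C : Set (Matrix m n ℂ)} (hC : Convex ℝ C)
    {X : Matrix m n ℂ} (hX : X ∈ C) (hf : ∀ s ∈ S, f s * X * (h s)ᴴ ∈ C) :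
    conjAvg S f h X ∈ C := by
  have hcard : (0 : ℝ) < S.card := by exact_mod_cast hS.card_pos
  have h1 : ∑ s ∈ S, (S.card : ℝ)⁻¹ • (f s * X * (h s)ᴴ) ∈ C :=
    hC.sum_mem (fun _ _ => by positivity) (by simp [hcard.ne']) hf
  have h2 := hC hX h1 (show (0 : ℝ) ≤ 2⁻¹ by norm_num) (show (0 : ℝ) ≤ 2⁻¹ by norm_num)
    (by norm_num)
  convert h2 using 1
  rw [conjAvg, smul_add, ← Finset.smul_sum]
  ext i j
  simp

end ConjAvg

/-! ### Padding by zeros as conjugation with a coisometry -/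

section Padding

open scoped Matrix.Norms.Frobenius

/-- The `n × m` matrix with ones on the diagonal. -/
def padInc (n m : ℕ) : Matrix (Fin n) (Fin m) ℂ :=
  Matrix.of fun i j => if (i : ℕ) = j then 1 else 0

theorem padInc_mul_conjTranspose {n m : ℕ} (h : n ≤ m) :
    padInc n m * (padInc n m)ᴴ = 1 := by
  ext i j
  rw [Matrix.mul_apply, Finset.sum_eq_single (Fin.castLE h i)]
  · simp [padInc, Matrix.one_apply, Fin.ext_iff, eq_comm]
  · intro b _ hb
    have : (i : ℕ) ≠ b := fun h' => hb (Fin.ext h'.symm)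
    simp [padInc, this]
  · simp

theorem padZero_eq {n m : ℕ} (x : Matrix (Fin n) (Fin n) ℂ) :
    padZero m x = (padInc n m)ᴴ * x * padInc n m := by
  ext i j
  have h1 : ∀ (a : Fin n), (∑ b, x a b * padInc n m b j) =
      if h : (j : ℕ) < n then x a ⟨j, h⟩ else 0 := by
    intro a
    split_ifs with h
    · rw [Finset.sum_eq_single ⟨j, h⟩]
      · simp [padInc]
      · intro b _ hb
        have : (b : ℕ) ≠ j := fun h' => hb (Fin.ext h')
        simp [padInc, this]
      · simp
    · refine Finset.sum_eq_zero fun b _ => ?_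
      have : (b : ℕ) ≠ j := fun h' => h (h' ▸ b.2)
      simp [padInc, this]
  rw [Matrix.mul_assoc, Matrix.mul_apply]
  simp only [Matrix.mul_apply, h1]
  by_cases hi : (i : ℕ) < n
  · rw [Finset.sum_eq_single ⟨i, hi⟩]
    · simp [padInc, padZero, hi]
    · intro b _ hb
      have : (b : ℕ) ≠ i := fun h' => hb (Fin.ext h')
      simp [padInc, this]
    · simp
  · rw [Finset.sum_eq_zero]
    · simp [padZero, hi]
    · intro b _
      have : (b : ℕ) ≠ i := fun h' => hi (h' ▸ b.2)
      simp [padInc, this]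

/-- `hsDist` is normalized by the larger dimension `m`, while later estimates need the scale √n. A
distance `t ≤ 1/2` forces √m ≤ 2√n: the unitary `y` has norm √m, the padded `x` has norm √n, and
they differ by `t * √m`. This costs the factor 2 and makes flexible stability as useful as strict
stability. -/
theorem norm_intertwine_le_of_hsDist {n m : ℕ} (h : n ≤ m)
    (x : Matrix.unitaryGroup (Fin n) ℂ) (y : Matrix.unitaryGroup (Fin m) ℂ)
    (hd : hsDist (x : Matrix (Fin n) (Fin n) ℂ) (y : Matrix (Fin m) (Fin m) ℂ) ≤ 1 / 2) :
    ‖(x : Matrix (Fin n) (Fin n) ℂ) * padInc n m - padInc n m * (y : Matrix (Fin m) (Fin m) ℂ)‖ ≤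
        2 * hsDist (x : Matrix (Fin n) (Fin n) ℂ) (y : Matrix (Fin m) (Fin m) ℂ) * √n ∧
    ‖(padInc n m)ᴴ * (x : Matrix (Fin n) (Fin n) ℂ) -
        (y : Matrix (Fin m) (Fin m) ℂ) * (padInc n m)ᴴ‖ ≤
        2 * hsDist (x : Matrix (Fin n) (Fin n) ℂ) (y : Matrix (Fin m) (Fin m) ℂ) * √n := by
  have hI := padInc_mul_conjTranspose h
  set I := padInc n m with hIdef
  have hW : (Iᴴ)ᴴ * Iᴴ = 1 := by rw [Matrix.conjTranspose_conjTranspose, hI]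
  set t := hsDist (x : Matrix (Fin n) (Fin n) ℂ) (y : Matrix (Fin m) (Fin m) ℂ) with ht
  rw [hsDist, hsNorm_eq, padZero_eq, ← hIdef] at ht
  set X := (x : Matrix (Fin n) (Fin n) ℂ)
  set Y := (y : Matrix (Fin m) (Fin m) ℂ)
  set P := Iᴴ * X * I - Y
  rcases Nat.eq_zero_or_pos m with hm | hm
  · obtain rfl : n = 0 := by omega
    have h1 : X * I - I * Y = 0 := by ext i; exact i.elim0
    have h2 : Iᴴ * X - Y * Iᴴ = 0 := by ext i j; exact j.elim0
    rw [h1, h2]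
    simp
  have hm' : (0 : ℝ) < √m := Real.sqrt_pos.2 (by exact_mod_cast hm)
  have hP : ‖P‖ = t * √m := by rw [ht]; field_simp
  have ht0 : 0 ≤ t := by rw [ht]; positivity
  have h1 : X * I - I * Y = I * P := by
    simp only [P, Matrix.mul_sub]
    rw [← Matrix.mul_assoc, ← Matrix.mul_assoc, hI, Matrix.one_mul]
  have h2 : Iᴴ * X - Y * Iᴴ = P * Iᴴ := by
    simp only [P, Matrix.sub_mul]
    rw [Matrix.mul_assoc _ I, hI, Matrix.mul_one]
  have h3 : ‖I * P‖ ≤ ‖P‖ := by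
    have := norm_isometry_conjTranspose_mul_le hW P
    rwa [Matrix.conjTranspose_conjTranspose] at this
  have h4 : ‖P * Iᴴ‖ ≤ ‖P‖ := norm_mul_isometry_le hW P
  have h5 : √m ≤ t * √m + √n := by
    have hY : ‖Y‖ = √m := by rw [norm_unitary]; simp
    have hX : ‖Iᴴ * X * I‖ = √n := by
      rw [norm_mul_coisometry hI, norm_isometry_mul hW, norm_unitary]; simp
    have : Y = Iᴴ * X * I - P := by simp [P]
    calc √m = ‖Y‖ := hY.symm
      _ ≤ ‖Iᴴ * X * I‖ + ‖P‖ := by conv_lhs => rw [this]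
                                   exact norm_sub_le _ _
      _ = _ := by rw [hX, hP]; ring
  have h6 : t * √m ≤ 2 * t * √n := by
    have h7 : √m ≤ 2 * √n := by nlinarith
    nlinarith
  rw [h1, h2]
  constructor <;> linarith

end Padding

/-! ### Finitary form of stability -/

section Countable

theorem exists_exhaustion (G : Type*) [Nonempty G] [Countable G] :
    ∃ K : ℕ → Finset G, ∀ g, ∀ᶠ j in atTop, g ∈ K j := by
  classical
  obtain ⟨f, hf⟩ := exists_surjective_nat G
  refine ⟨fun j => (Finset.range j).image f, fun g => ?_⟩
  obtain ⟨i, rfl⟩ := hf g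
  filter_upwards [eventually_gt_atTop i] with j hj
  exact Finset.mem_image_of_mem f (Finset.mem_range.2 hj)

variable {G : Type*} [Group G]

/-- `π` is multiplicative up to `δ` on `K`. -/
def IsAlmostRep (K : Finset G) (δ : ℝ) {d : ℕ} (π : G → Matrix.unitaryGroup (Fin d) ℂ) : Prop :=
  ∀ g ∈ K, ∀ h ∈ K, hsNorm ((π (g * h) : Matrix (Fin d) (Fin d) ℂ) -
    (π g : Matrix (Fin d) (Fin d) ℂ) * (π h : Matrix (Fin d) (Fin d) ℂ)) < δ

theorem hsNorm_nonneg {m : ℕ} (x : Matrix (Fin m) (Fin m) ℂ) : 0 ≤ hsNorm x := Real.sqrt_nonneg _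

theorem isAsymptoticRep_of_isAlmostRep {K : ℕ → Finset G} (hK : ∀ g, ∀ᶠ j in atTop, g ∈ K j)
    {d : ℕ → ℕ} (hd : ∀ j, 0 < d j) {π : ∀ j, G → Matrix.unitaryGroup (Fin (d j)) ℂ}
    (hπ : ∀ j, IsAlmostRep (K j) (1 / ((j : ℝ) + 1)) (π j)) : IsAsymptoticRep d π := by
  refine ⟨hd, fun g h => ?_⟩
  refine squeeze_zero' (Eventually.of_forall fun j => hsNorm_nonneg _) ?_
    tendsto_one_div_add_atTop_nhds_zero_nat
  filter_upwards [hK g, hK h] with j hg hh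
  exact (hπ j g hg h hh).le

/-- The finitary form of stability. -/
theorem IsHSStable.exists_finite [Countable G] (hG : IsHSStable G) (F : Finset G) {ε : ℝ}
    (hε : 0 < ε) : ∃ (K : Finset G) (δ : ℝ), 0 < δ ∧
      ∀ (d : ℕ) (π : G → Matrix.unitaryGroup (Fin d) ℂ), 0 < d → IsAlmostRep K δ π →
        ∃ (D : ℕ) (ρ : G →* Matrix.unitaryGroup (Fin D) ℂ), d ≤ D ∧
          ∀ g ∈ F, hsDist (π g : Matrix (Fin d) (Fin d) ℂ) (ρ g : Matrix (Fin D) (Fin D) ℂ) < ε := by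
  -- Counterexamples for an exhaustion of the group with tolerances 1/(j+1) assemble into one
  -- asymptotic representation, which contradicts stability.
  by_contra! hcon
  obtain ⟨K, hK⟩ := exists_exhaustion G
  choose d π hd hπ hbad using fun j : ℕ => hcon (K j) (1 / ((j : ℝ) + 1)) (by positivity)
  obtain ⟨D, ρ, hD, hρ⟩ := hG d π (isAsymptoticRep_of_isAlmostRep hK hd hπ)
  have hev : ∀ᶠ j in atTop, ∀ g ∈ F, hsDist (π j g : Matrix (Fin (d j)) (Fin (d j)) ℂ)
      (ρ j g : Matrix (Fin (D j)) (Fin (D j)) ℂ) < ε :=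
    (Finset.eventually_all F).2 fun g _ => (hρ g).eventually_lt_const hε
  obtain ⟨j, hj⟩ := hev.exists
  obtain ⟨g, hg, hge⟩ := hbad j (D j) (ρ j) (hD j)
  exact absurd (hj g hg) (not_lt.2 hge)

end Countable

/-! ### Realignment of tensor legs -/

section Reshape

open scoped Matrix.Norms.Frobenius Kronecker ComplexOrder

variable {a b : Type*}

/-- The realignment of an operator on `ℂ^a ⊗ ℂ^b` into a map from `ℂ^b ⊗ ℂ^b` to `ℂ^a ⊗ ℂ^a`. -/
def realign (Q : Matrix (a × b) (a × b) ℂ) : Matrix (a × a) (b × b) ℂ :=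
  Matrix.of fun i j => Q (i.1, j.1) (i.2, j.2)

/-- The column with the entries of a matrix. -/
def colOf (x : Matrix a b ℂ) : Matrix (a × b) Unit ℂ :=
  Matrix.of fun i _ => x i.1 i.2

theorem realign_sub (P Q : Matrix (a × b) (a × b) ℂ) : realign (P - Q) = realign P - realign Q :=
  rfl

variable [Fintype a] [Fintype b]

theorem norm_realign (Q : Matrix (a × b) (a × b) ℂ) : ‖realign Q‖ = ‖Q‖ := by
  rw [← sq_eq_sq₀ (norm_nonneg _) (norm_nonneg _), frobenius_norm_sq, frobenius_norm_sq]
  simp only [realign, Matrix.of_apply, Fintype.sum_prod_type]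
  exact Finset.sum_congr rfl fun i _ => Finset.sum_comm

theorem norm_colOf (x : Matrix a b ℂ) : ‖colOf x‖ = ‖x‖ := by
  rw [← sq_eq_sq₀ (norm_nonneg _) (norm_nonneg _), frobenius_norm_sq, frobenius_norm_sq]
  simp [colOf, Fintype.sum_prod_type]

theorem kronecker_mul_colOf {c d : Type*} (U : Matrix c a ℂ) (V : Matrix d b ℂ)
    (x : Matrix a b ℂ) : (U ⊗ₖ V) * colOf x = colOf (U * x * Vᵀ) := by
  ext i j
  simp only [colOf, Matrix.mul_apply, Matrix.of_apply, Fintype.sum_prod_type,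
    Matrix.kroneckerMap_apply, Matrix.transpose_apply, Finset.sum_mul]
  rw [Finset.sum_comm]
  refine Finset.sum_congr rfl fun p _ => Finset.sum_congr rfl fun q _ => by ring

/-- Conjugation by U ⊗ conj W applies U, conj W, conj U and W to the four indices of `Q`. Pairing
the two `a`-indices and the two `b`-indices separates U from W. Thus a projective map U enters only
through U ⊗ conj U, where its scalar cocycle disappears. -/
theorem realign_conj (U : Matrix a a ℂ) (W : Matrix b b ℂ) (Q : Matrix (a × b) (a × b) ℂ) :
    realign ((U ⊗ₖ W.map star) * Q * (U ⊗ₖ W.map star)ᴴ) =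
      (U ⊗ₖ U.map star) * realign Q * (W ⊗ₖ W.map star)ᴴ := by
  have key : ∀ F : a → b → a → b → ℂ,
      ∑ c', ∑ d', ∑ c, ∑ d, F c d c' d' = ∑ d, ∑ d', ∑ c, ∑ c', F c d c' d' := by
    intro F
    calc ∑ c', ∑ d', ∑ c, ∑ d, F c d c' d' = ∑ d', ∑ c', ∑ c, ∑ d, F c d c' d' := Finset.sum_comm
      _ = ∑ d', ∑ c', ∑ d, ∑ c, F c d c' d' :=
          Finset.sum_congr rfl fun _ _ => Finset.sum_congr rfl fun _ _ => Finset.sum_comm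
      _ = ∑ d', ∑ d, ∑ c', ∑ c, F c d c' d' := Finset.sum_congr rfl fun _ _ => Finset.sum_comm
      _ = ∑ d, ∑ d', ∑ c', ∑ c, F c d c' d' := Finset.sum_comm
      _ = _ := Finset.sum_congr rfl fun _ _ => Finset.sum_congr rfl fun _ _ => Finset.sum_comm
  ext ⟨i, i'⟩ ⟨j, j'⟩
  simp only [realign, Matrix.of_apply, Matrix.mul_apply, Matrix.conjTranspose_apply,
    Matrix.kroneckerMap_apply, Matrix.map_apply, Fintype.sum_prod_type, Finset.sum_mul, star_mul',
    star_star]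
  rw [key]
  refine Finset.sum_congr rfl fun _ _ => Finset.sum_congr rfl fun _ _ =>
    Finset.sum_congr rfl fun _ _ => Finset.sum_congr rfl fun _ _ => ?_
  ring

theorem realign_conjAvg {G : Type*} (S : Finset G) (f : G → Matrix a a ℂ) (h : G → Matrix b b ℂ)
    (Q : Matrix (a × b) (a × b) ℂ) :
    realign (conjAvg S (fun g => f g ⊗ₖ (h g).map star) (fun g => f g ⊗ₖ (h g).map star) Q) =
      conjAvg S (fun g => f g ⊗ₖ (f g).map star) (fun g => h g ⊗ₖ (h g).map star) (realign Q) := by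
  simp only [conjAvg, ← realign_conj]
  ext i j
  simp [realign, Matrix.sum_apply]

end Reshape

/-! ### Top eigenvector of a nearly pure density matrix -/

section ColumnSpectral

open scoped Matrix.Norms.Frobenius ComplexOrder

theorem norm_col_sq {n : Type*} [Fintype n] (v : Matrix n Unit ℂ) : ‖v‖ ^ 2 = ∑ i, ‖v i ()‖ ^ 2 := by
  rw [frobenius_norm_sq]; simp

variable {n : Type*} [Fintype n] [DecidableEq n]

/-- A density matrix which is close to a rank one projection has a simple top eigenvalue. -/
theorem exists_top_eigenvector {Q : Matrix n n ℂ} (hQ : Q.PosSemidef) (htr : Q.trace = 1)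
    {ξ : Matrix n Unit ℂ} (hξ : ‖ξ‖ = 1) (hclose : ‖Q - ξ * ξᴴ‖ ≤ 1 / 8) :
    ∃ (v : Matrix n Unit ℂ) (μ : ℝ), 3 / 4 ≤ μ ∧ ‖v‖ = 1 ∧ Q * v = (μ : ℂ) • v ∧
      ∀ w : Matrix n Unit ℂ, ‖w - (vᴴ * w) () () • v‖ ≤ 2 * ‖Q * w - (μ : ℂ) • w‖ := by
  have hH := hQ.isHermitian
  obtain ⟨V, hV⟩ : ∃ V : Matrix.unitaryGroup n ℂ, V = hH.eigenvectorUnitary := ⟨_, rfl⟩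
  set m := hH.eigenvalues with hm
  have hm0 : ∀ i, 0 ≤ m i := hQ.eigenvalues_nonneg
  have hV1 := conjTranspose_mul_self_of_unitary V
  have hV2 := mul_conjTranspose_self_of_unitary V
  have hspec : Q = V * Matrix.diagonal (fun i => (m i : ℂ)) * (V : Matrix n n ℂ)ᴴ := by
    have := hH.spectral_theorem
    rw [Unitary.conjStarAlgAut_apply, ← hV] at this
    exact this
  have hsum : ∑ i, m i = 1 := by
    have := hH.trace_eq_sum_eigenvalues
    rw [htr, ← hm] at this
    have h2 : ((∑ i, m i : ℝ) : ℂ) = 1 := by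
      rw [this]
      push_cast
      rfl
    exact_mod_cast h2
  have hξ' : ξᴴ * ξ = 1 := by
    have h1 := frobenius_norm_sq_eq_trace ξ
    ext i j
    have h2 : (ξᴴ * ξ) () () = ((∑ i, ‖ξ i ()‖ ^ 2 : ℝ) : ℂ) := by
      rw [Matrix.mul_apply]
      push_cast
      refine Finset.sum_congr rfl fun i _ => ?_
      rw [Matrix.conjTranspose_apply, Complex.star_def, Complex.conj_mul']
    have h3 := norm_col_sq ξ
    rw [hξ] at h3
    rw [h2, ← h3]
    simp
  -- If all eigenvalues were below 3/4, the quadratic form of `Q` at `ξ` would be at most 3/4. It is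
  -- at least 1 - 1/8 by closeness to the projection.
  obtain ⟨i₀, hi₀⟩ : ∃ i, 3 / 4 ≤ m i := by
    by_contra! hlt
    have h1 := trace_conj_diagonal_re (V : Matrix n n ℂ) m ξ
    rw [← hspec] at h1
    have h2 : ∑ i, m i * ∑ j, ‖((V : Matrix n n ℂ)ᴴ * ξ) i j‖ ^ 2 ≤ 3 / 4 := by
      calc _ ≤ ∑ i, 3 / 4 * ∑ j, ‖((V : Matrix n n ℂ)ᴴ * ξ) i j‖ ^ 2 :=
            Finset.sum_le_sum fun i _ =>
              mul_le_mul_of_nonneg_right (hlt i).le (by positivity)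
        _ = 3 / 4 := by
            rw [← Finset.mul_sum, ← frobenius_norm_sq, norm_unitary_conjTranspose_mul, hξ]
            norm_num
    have h3 : (ξᴴ * (Q * ξ)).trace.re = 1 + (ξᴴ * ((Q - ξ * ξᴴ) * ξ)).trace.re := by
      rw [Matrix.sub_mul, Matrix.mul_assoc ξ, hξ', Matrix.mul_one, Matrix.mul_sub, hξ',
        Matrix.trace_sub, Complex.sub_re]
      simp
    have h4 : |(ξᴴ * ((Q - ξ * ξᴴ) * ξ)).trace.re| ≤ 1 / 8 := by
      refine (Complex.abs_re_le_norm _).trans ?_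
      have h5 : (ξᴴ * ((Q - ξ * ξᴴ) * ξ)).trace = (ξᴴ * ((Q - ξ * ξᴴ) * ξ)) () () := by
        simp [Matrix.trace]
      have h6 : ‖(ξᴴ * ((Q - ξ * ξᴴ) * ξ)) () ()‖ = ‖ξᴴ * ((Q - ξ * ξᴴ) * ξ)‖ := by
        rw [← sq_eq_sq₀ (norm_nonneg _) (norm_nonneg _), norm_col_sq]
        simp
      rw [h5, h6]
      calc _ ≤ ‖ξᴴ‖ * (‖Q - ξ * ξᴴ‖ * ‖ξ‖) :=
            (Matrix.frobenius_norm_mul _ _).trans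
              (mul_le_mul_of_nonneg_left (Matrix.frobenius_norm_mul _ _) (norm_nonneg _))
        _ ≤ 1 / 8 := by
            rw [Matrix.frobenius_norm_conjTranspose, hξ]
            linarith
    have := abs_le.1 h4
    linarith
  -- Trace one and positivity leave at most 1/4 for every other eigenvalue. The resulting gap of 1/2
  -- is the source of the factor 2 in the conclusion.
  have hother : ∀ i, i ≠ i₀ → m i ≤ 1 / 4 := by
    intro i hi
    have : m i₀ + m i ≤ ∑ j, m j := by
      rw [← Finset.sum_pair hi.symm]
      exact Finset.sum_le_sum_of_subset_of_nonneg (Finset.subset_univ _) fun j _ _ => hm0 j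
    linarith
  let e : Matrix n Unit ℂ := Matrix.single i₀ () 1
  have hVe : (V : Matrix n n ℂ)ᴴ * ((V : Matrix n n ℂ) * e) = e := by
    rw [← Matrix.mul_assoc, hV1, Matrix.one_mul]
  refine ⟨(V : Matrix n n ℂ) * e, m i₀, hi₀, ?_, ?_, fun w => ?_⟩
  · rw [norm_unitary_mul, ← sq_eq_sq₀ (norm_nonneg _) zero_le_one, norm_col_sq]
    simp [e, Matrix.single_apply, apply_ite]
  · rw [hspec, Matrix.mul_assoc, hVe, Matrix.mul_assoc, ← Matrix.mul_smul]
    congr 1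
    ext i j
    by_cases h : i = i₀
    · subst h; simp [e]
    · simp [e, Matrix.diagonal_apply_ne _ h, Ne.symm h]
  · set y := (V : Matrix n n ℂ)ᴴ * w with hy
    have hc : (((V : Matrix n n ℂ) * e)ᴴ * w) () () = y i₀ () := by
      rw [Matrix.conjTranspose_mul, Matrix.mul_assoc, ← hy]
      simp [e, Matrix.single_apply, Matrix.mul_apply]
    have h1 : ‖w - y i₀ () • ((V : Matrix n n ℂ) * e)‖ = ‖y - y i₀ () • e‖ := by
      rw [← norm_unitary_conjTranspose_mul V, Matrix.mul_sub, Matrix.mul_smul, hVe]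
    have h2 : ‖Q * w - (m i₀ : ℂ) • w‖ =
        ‖Matrix.diagonal (fun i => (m i : ℂ) - m i₀) * y‖ := by
      rw [← norm_unitary_conjTranspose_mul V, Matrix.mul_sub, Matrix.mul_smul, ← hy, hspec,
        Matrix.mul_assoc, Matrix.mul_assoc, ← Matrix.mul_assoc, hV1, Matrix.one_mul, ← hy,
        ← Matrix.diagonal_sub, Matrix.sub_mul]
      congr 2
      ext i j
      simp [Matrix.diagonal_mul]
    rw [hc, h1, h2, ← sq_le_sq₀ (norm_nonneg _) (by positivity), mul_pow,
      frobenius_norm_diagonal_mul_sq, norm_col_sq, Finset.mul_sum]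
    refine Finset.sum_le_sum fun i _ => ?_
    by_cases h : i = i₀
    · subst h
      have : (y - y i () • e) i () = 0 := by simp [e]
      rw [this]
      simp
    · have h3 : (y - y i₀ () • e) i () = y i () := by
        simp [e, Ne.symm h]
      have h4 : (m i : ℂ) - m i₀ = ((m i - m i₀ : ℝ) : ℂ) := by push_cast; rfl
      rw [h3, h4, Complex.norm_real, Real.norm_eq_abs, sq_abs]
      have h5 := hother i h
      have h6 : (1 / 4 : ℝ) ≤ (m i - m i₀) ^ 2 := by nlinarith
      have h7 : (0 : ℝ) ≤ ‖y i ()‖ ^ 2 := by positivity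
      have h8 : ∑ j, ‖y i j‖ ^ 2 = ‖y i ()‖ ^ 2 := by simp
      rw [h8]
      nlinarith

end ColumnSpectral

/-! ### Convex classes with operator norm bounds -/

section Classes

open scoped Matrix.Norms.Frobenius Kronecker ComplexOrder

/-- Matrices of operator norm at most `c`, tested on Frobenius norms of left multiples by matrices
with `p` rows. -/
def opBall (p : ℕ) {m n : Type*} [Fintype m] [Fintype n] (c : ℝ) : Set (Matrix m n ℂ) :=
  {Y | ∀ Δ : Matrix (Fin p) m ℂ, ‖Δ * Y‖ ≤ ‖Δ‖ * c}

theorem convex_opBall (p : ℕ) {m n : Type*} [Fintype m] [Fintype n] (c : ℝ) :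
    Convex ℝ (opBall p c : Set (Matrix m n ℂ)) := by
  intro X hX Y hY s t hs ht hst Δ
  calc ‖Δ * (s • X + t • Y)‖ = ‖s • (Δ * X) + t • (Δ * Y)‖ := by
        rw [Matrix.mul_add, Matrix.mul_smul, Matrix.mul_smul]
    _ ≤ s * ‖Δ * X‖ + t * ‖Δ * Y‖ := by
        refine (norm_add_le _ _).trans_eq ?_
        rw [norm_smul, norm_smul, Real.norm_of_nonneg hs, Real.norm_of_nonneg ht]
    _ ≤ s * (‖Δ‖ * c) + t * (‖Δ‖ * c) :=
        add_le_add (mul_le_mul_of_nonneg_left (hX Δ) hs) (mul_le_mul_of_nonneg_left (hY Δ) ht)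
    _ = ‖Δ‖ * c := by rw [← add_mul, hst, one_mul]

theorem unitary_mul_mul_mem_opBall {p : ℕ} {m n : Type*} [Fintype m] [DecidableEq m] [Fintype n]
    [DecidableEq n] {c : ℝ} {Y : Matrix m n ℂ} (hY : Y ∈ (opBall p c : Set (Matrix m n ℂ)))
    (U : Matrix.unitaryGroup m ℂ) (W : Matrix.unitaryGroup n ℂ) :
    (U : Matrix m m ℂ) * Y * (W : Matrix n n ℂ)ᴴ ∈ (opBall p c : Set (Matrix m n ℂ)) := by
  intro Δ
  rw [← Matrix.mul_assoc, norm_mul_unitary_conjTranspose, ← Matrix.mul_assoc,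
    ← norm_mul_unitary U Δ]
  exact hY _

/-- Replacing an action by one which it almost intertwines changes the averages little. -/
theorem norm_conjAvg_iterate_sub_le {G : Type*} {S : Finset G} (hS : S.Nonempty) {p : ℕ}
    {m n : Type*} [Fintype m] [DecidableEq m] [Fintype n] [DecidableEq n]
    (f : G → Matrix.unitaryGroup m ℂ) (τ : G → Matrix.unitaryGroup (Fin p) ℂ)
    (R : G → Matrix.unitaryGroup n ℂ) {J : Matrix (Fin p) m ℂ} {κ c : ℝ} (hc : 0 ≤ c)
    (hJ : ∀ s ∈ S, ‖J * (f s : Matrix m m ℂ) - (τ s : Matrix (Fin p) (Fin p) ℂ) * J‖ ≤ κ)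
    {Y : Matrix m n ℂ} (hY : Y ∈ (opBall p c : Set (Matrix m n ℂ))) (k : ℕ) :
    (conjAvg S (fun g => (f g : Matrix m m ℂ)) (fun g => (R g : Matrix n n ℂ)))^[k] Y ∈
        (opBall p c : Set (Matrix m n ℂ)) ∧
      ‖(conjAvg S (fun g => (τ g : Matrix (Fin p) (Fin p) ℂ))
          (fun g => (R g : Matrix n n ℂ)))^[k] (J * Y) -
        J * (conjAvg S (fun g => (f g : Matrix m m ℂ)) (fun g => (R g : Matrix n n ℂ)))^[k] Y‖ ≤
        k * (κ * c) := by
  induction k with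
  | zero => exact ⟨hY, by simp⟩
  | succ k ih =>
    rw [Function.iterate_succ_apply', Function.iterate_succ_apply']
    set Yk := (conjAvg S (fun g => (f g : Matrix m m ℂ)) (fun g => (R g : Matrix n n ℂ)))^[k] Y
    set Xk := (conjAvg S (fun g => (τ g : Matrix (Fin p) (Fin p) ℂ))
          (fun g => (R g : Matrix n n ℂ)))^[k] (J * Y)
    obtain ⟨hYk, hdist⟩ := ih
    refine ⟨conjAvg_mem hS (convex_opBall p c) hYk fun s _ =>
      unitary_mul_mul_mem_opBall hYk (f s) (R s), ?_⟩
    have hcard : (0 : ℝ) < S.card := by exact_mod_cast hS.card_pos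
    -- The error of earlier steps is not enlarged: a ball is convex and invariant under unitaries,
    -- so the average preserves it.
    have h1 : ‖conjAvg S (fun g => (τ g : Matrix (Fin p) (Fin p) ℂ))
        (fun g => (R g : Matrix n n ℂ)) (Xk - J * Yk)‖ ≤ k * (κ * c) := by
      have : conjAvg S (fun g => (τ g : Matrix (Fin p) (Fin p) ℂ))
        (fun g => (R g : Matrix n n ℂ)) (Xk - J * Yk) ∈ Metric.closedBall 0 (k * (κ * c)) := by
        refine conjAvg_mem hS (convex_closedBall _ _) (by simpa using hdist) fun s _ => ?_
        rw [mem_closedBall_zero_iff, norm_mul_unitary_conjTranspose, norm_unitary_mul]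
        exact hdist
      simpa using this
    -- The new error of one step is the averaged intertwining defect times `Yk`. The defect is
    -- controlled only in Frobenius norm, so the product is bounded through the operator bound on
    -- `Yk`, which the iteration preserves.
    have h2 : conjAvg S (fun g => (τ g : Matrix (Fin p) (Fin p) ℂ))
        (fun g => (R g : Matrix n n ℂ)) (J * Yk) -
        J * conjAvg S (fun g => (f g : Matrix m m ℂ)) (fun g => (R g : Matrix n n ℂ)) Yk =
        -((2 : ℂ)⁻¹ • (S.card : ℂ)⁻¹ • ∑ s ∈ S, (J * (f s : Matrix m m ℂ) -
          (τ s : Matrix (Fin p) (Fin p) ℂ) * J) * Yk * (R s : Matrix n n ℂ)ᴴ) := by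
      simp only [conjAvg, Matrix.mul_smul, Matrix.mul_add, Matrix.mul_sum, Matrix.sub_mul,
        Finset.sum_sub_distrib, Matrix.mul_assoc]
      module
    have h3 : ‖conjAvg S (fun g => (τ g : Matrix (Fin p) (Fin p) ℂ))
        (fun g => (R g : Matrix n n ℂ)) (J * Yk) -
        J * conjAvg S (fun g => (f g : Matrix m m ℂ)) (fun g => (R g : Matrix n n ℂ)) Yk‖ ≤
        κ * c := by
      have h4 : ‖∑ s ∈ S, (J * (f s : Matrix m m ℂ) -
          (τ s : Matrix (Fin p) (Fin p) ℂ) * J) * Yk * (R s : Matrix n n ℂ)ᴴ‖ ≤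
          S.card * (κ * c) := by
        refine (norm_sum_le _ _).trans ?_
        rw [← nsmul_eq_mul]
        refine Finset.sum_le_card_nsmul _ _ _ fun s hs => ?_
        rw [norm_mul_unitary_conjTranspose]
        exact (hYk _).trans (mul_le_mul_of_nonneg_right (hJ s hs) hc)
      have h5 : 0 ≤ κ * c := by
        obtain ⟨s, hs⟩ := hS
        exact mul_nonneg ((norm_nonneg _).trans (hJ s hs)) hc
      rw [h2, norm_neg, norm_smul, norm_smul, norm_inv, norm_inv, Complex.norm_natCast,
        Complex.norm_ofNat]
      calc (2 : ℝ)⁻¹ * ((S.card : ℝ)⁻¹ * _) ≤ (2 : ℝ)⁻¹ * ((S.card : ℝ)⁻¹ * (S.card * (κ * c))) := by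
            gcongr
        _ = (κ * c) / 2 := by field_simp
        _ ≤ κ * c := by linarith
    have h4 := (norm_add_le _ _).trans (add_le_add h1 h3)
    rw [conjAvg_sub, sub_add_sub_cancel] at h4
    refine h4.trans_eq ?_
    push_cast
    ring

/-- Density matrices on `ℂ^a ⊗ ℂ^b` with range in the vectors which are matrices of operator norm
at most `c`. -/
def densityBall {a b : Type*} [Fintype a] [Fintype b] [DecidableEq b] (c : ℝ) :
    Set (Matrix (a × b) (a × b) ℂ) :=
  {Q | Q.PosSemidef ∧ Q.trace = 1 ∧ ∀ (Δ : Matrix a a ℂ) (W : Matrix.unitaryGroup b ℂ)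
    (y : Matrix (a × b) Unit ℂ), ‖(Δ ⊗ₖ (W : Matrix b b ℂ)) * (Q * y)‖ ≤ ‖Δ‖ * c * ‖y‖}

theorem convex_densityBall {a b : Type*} [Fintype a] [Fintype b] [DecidableEq b] (c : ℝ) :
    Convex ℝ (densityBall c : Set (Matrix (a × b) (a × b) ℂ)) := by
  rintro X ⟨hX1, hX2, hX3⟩ Y ⟨hY1, hY2, hY3⟩ s t hs ht hst
  refine ⟨(hX1.smul hs).add (hY1.smul ht), ?_, fun Δ W y => ?_⟩
  · rw [Matrix.trace_add, Matrix.trace_smul, Matrix.trace_smul, hX2, hY2, ← add_smul, hst,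
      one_smul]
  · calc ‖(Δ ⊗ₖ (W : Matrix b b ℂ)) * ((s • X + t • Y) * y)‖ =
        ‖s • ((Δ ⊗ₖ (W : Matrix b b ℂ)) * (X * y)) + t • ((Δ ⊗ₖ (W : Matrix b b ℂ)) * (Y * y))‖ := by
          rw [Matrix.add_mul, Matrix.mul_add, Matrix.smul_mul, Matrix.smul_mul, Matrix.mul_smul,
            Matrix.mul_smul]
      _ ≤ s * ‖(Δ ⊗ₖ (W : Matrix b b ℂ)) * (X * y)‖ +
          t * ‖(Δ ⊗ₖ (W : Matrix b b ℂ)) * (Y * y)‖ := by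
          refine (norm_add_le _ _).trans_eq ?_
          rw [norm_smul, norm_smul, Real.norm_of_nonneg hs, Real.norm_of_nonneg ht]
      _ ≤ s * (‖Δ‖ * c * ‖y‖) + t * (‖Δ‖ * c * ‖y‖) :=
          add_le_add (mul_le_mul_of_nonneg_left (hX3 Δ W y) hs)
            (mul_le_mul_of_nonneg_left (hY3 Δ W y) ht)
      _ = ‖Δ‖ * c * ‖y‖ := by rw [← add_mul, hst, one_mul]

/-- The unitary `U ⊗ conj W`. -/
def kronConj {a b : Type*} [Fintype a] [DecidableEq a] [Fintype b] [DecidableEq b]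
    (U : Matrix.unitaryGroup a ℂ) (W : Matrix.unitaryGroup b ℂ) : Matrix.unitaryGroup (a × b) ℂ :=
  ⟨(U : Matrix a a ℂ) ⊗ₖ (W : Matrix b b ℂ).map star,
    Matrix.kronecker_mem_unitary U.2 (Matrix.map_star_mem_unitaryGroup_iff.2 W.2)⟩

theorem kronConj_coe {a b : Type*} [Fintype a] [DecidableEq a] [Fintype b] [DecidableEq b]
    (U : Matrix.unitaryGroup a ℂ) (W : Matrix.unitaryGroup b ℂ) :
    (kronConj U W : Matrix (a × b) (a × b) ℂ) =
      (U : Matrix a a ℂ) ⊗ₖ (W : Matrix b b ℂ).map star := rfl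

theorem kronConj_mul {a b : Type*} [Fintype a] [DecidableEq a] [Fintype b] [DecidableEq b]
    (U U' : Matrix.unitaryGroup a ℂ) (W W' : Matrix.unitaryGroup b ℂ) :
    kronConj (U * U') (W * W') = kronConj U W * kronConj U' W' := by
  apply Subtype.ext
  have : ((W : Matrix b b ℂ) * (W' : Matrix b b ℂ)).map star =
      (W : Matrix b b ℂ).map star * (W' : Matrix b b ℂ).map star :=
    Matrix.map_mul (f := starRingEnd ℂ)
  simp only [kronConj_coe, Submonoid.coe_mul, this, Matrix.mul_kronecker_mul]

theorem kronConj_mul_mul_mem_densityBall {a b : Type*} [Fintype a] [DecidableEq a] [Fintype b]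
    [DecidableEq b] {c : ℝ} {Q : Matrix (a × b) (a × b) ℂ}
    (hQ : Q ∈ (densityBall c : Set (Matrix (a × b) (a × b) ℂ)))
    (U : Matrix.unitaryGroup a ℂ) (W : Matrix.unitaryGroup b ℂ) :
    (kronConj U W : Matrix (a × b) (a × b) ℂ) * Q * (kronConj U W : Matrix (a × b) (a × b) ℂ)ᴴ ∈
      (densityBall c : Set (Matrix (a × b) (a × b) ℂ)) := by
  obtain ⟨h1, h2, h3⟩ := hQ
  refine ⟨h1.mul_mul_conjTranspose_same _, ?_, fun Δ V y => ?_⟩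
  · rw [Matrix.trace_mul_comm, ← Matrix.mul_assoc, conjTranspose_mul_self_of_unitary,
      Matrix.one_mul, h2]
  -- The bound defining `densityBall` ranges over all unitaries on the second leg so that composing
  -- its test operators with U ⊗ conj W again gives a test operator, of the same norm on the first
  -- leg.
  · have h4 := h3 (Δ * (U : Matrix a a ℂ)) (V * ⟨_, Matrix.map_star_mem_unitaryGroup_iff.2 W.2⟩)
      ((kronConj U W : Matrix (a × b) (a × b) ℂ)ᴴ * y)
    rw [norm_mul_unitary, norm_unitary_conjTranspose_mul] at h4
    convert h4 using 2
    rw [Submonoid.coe_mul, Matrix.mul_kronecker_mul, ← kronConj_coe]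
    simp only [Matrix.mul_assoc]

end Classes

/-! ### The maximally entangled vector and its projection -/

section ApproximateState

open scoped Matrix.Norms.Frobenius Kronecker ComplexOrder

/-- The unitary `U ⊗ conj U` in `d * d` coordinates. -/
def tensorConj {d : ℕ} (U : Matrix.unitaryGroup (Fin d) ℂ) :
    Matrix.unitaryGroup (Fin (d * d)) ℂ :=
  ⟨(kronConj U U : Matrix (Fin d × Fin d) (Fin d × Fin d) ℂ).submatrix
      finProdFinEquiv.symm finProdFinEquiv.symm, by
    rw [Matrix.mem_unitaryGroup_iff, Matrix.star_eq_conjTranspose, Matrix.conjTranspose_submatrix,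
      Matrix.submatrix_mul_equiv, mul_conjTranspose_self_of_unitary, Matrix.submatrix_one_equiv]⟩

theorem tensorConj_coe {d : ℕ} (U : Matrix.unitaryGroup (Fin d) ℂ) :
    (tensorConj U : Matrix (Fin (d * d)) (Fin (d * d)) ℂ) =
      (kronConj U U : Matrix (Fin d × Fin d) (Fin d × Fin d) ℂ).submatrix
        finProdFinEquiv.symm finProdFinEquiv.symm := rfl

/-- The inclusion of `ℂ^d ⊗ ℂ^d` into `ℂ^p`. -/
def tensorInc (d p : ℕ) : Matrix (Fin p) (Fin d × Fin d) ℂ :=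
  ((padInc (d * d) p)ᴴ).submatrix id finProdFinEquiv

theorem tensorInc_isometry {d p : ℕ} (h : d * d ≤ p) :
    (tensorInc d p)ᴴ * tensorInc d p = 1 := by
  have h1 := Matrix.submatrix_mul (padInc (d * d) p) (padInc (d * d) p)ᴴ finProdFinEquiv id
    (finProdFinEquiv : Fin d × Fin d ≃ Fin (d * d)) Function.bijective_id
  rw [padInc_mul_conjTranspose h, Matrix.submatrix_one_equiv] at h1
  rw [tensorInc, Matrix.conjTranspose_submatrix, Matrix.conjTranspose_conjTranspose]
  exact h1.symm

theorem norm_tensorInc_intertwine {d p : ℕ} (U : Matrix.unitaryGroup (Fin d) ℂ)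
    (T : Matrix (Fin p) (Fin p) ℂ) :
    ‖tensorInc d p * (kronConj U U : Matrix (Fin d × Fin d) (Fin d × Fin d) ℂ) -
        T * tensorInc d p‖ =
      ‖(padInc (d * d) p)ᴴ * (tensorConj U : Matrix (Fin (d * d)) (Fin (d * d)) ℂ) -
        T * (padInc (d * d) p)ᴴ‖ := by
  rw [← frobenius_norm_submatrix_equiv _ (Equiv.refl (Fin p))
    (finProdFinEquiv : Fin d × Fin d ≃ Fin (d * d))]
  congr 1
  have h1 := Matrix.submatrix_mul (padInc (d * d) p)ᴴ
    (tensorConj U : Matrix (Fin (d * d)) (Fin (d * d)) ℂ) id finProdFinEquiv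
    (finProdFinEquiv : Fin d × Fin d ≃ Fin (d * d)) finProdFinEquiv.bijective
  have h2 := Matrix.submatrix_mul T (padInc (d * d) p)ᴴ id id
    (finProdFinEquiv : Fin d × Fin d ≃ Fin (d * d)) Function.bijective_id
  have h3 : (tensorConj U : Matrix (Fin (d * d)) (Fin (d * d)) ℂ).submatrix
      (finProdFinEquiv : Fin d × Fin d ≃ Fin (d * d)) finProdFinEquiv = kronConj U U := by
    rw [tensorConj_coe, Matrix.submatrix_submatrix]
    ext i j
    simp
  rw [h3] at h1
  rw [Matrix.submatrix_sub, Equiv.coe_refl, Pi.sub_apply, Pi.sub_apply, h1, h2,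
    Matrix.submatrix_id_id]
  rfl

/-- The normalized maximally entangled column. -/
noncomputable def entangled (d D : ℕ) : Matrix (Fin d × Fin D) Unit ℂ :=
  ((√d : ℝ) : ℂ)⁻¹ • colOf (padInc d D)

theorem norm_padInc {d D : ℕ} (h : d ≤ D) : ‖padInc d D‖ = √d := by
  have := norm_mul_coisometry (padInc_mul_conjTranspose h) (1 : Matrix (Fin d) (Fin d) ℂ)
  rw [Matrix.one_mul] at this
  rw [this, ← Real.sqrt_sq (norm_nonneg (1 : Matrix (Fin d) (Fin d) ℂ)), frobenius_norm_one_sq]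
  simp

theorem norm_entangled {d D : ℕ} (hd : 0 < d) (h : d ≤ D) : ‖entangled d D‖ = 1 := by
  have : (0 : ℝ) < √d := Real.sqrt_pos.2 (by exact_mod_cast hd)
  rw [entangled, norm_smul, norm_inv, Complex.norm_real, Real.norm_of_nonneg this.le, norm_colOf,
    norm_padInc h, inv_mul_cancel₀ this.ne']

/-- As a matrix the entangled vector is 1/√d times a coisometry. The right side is the normalized
Hilbert–Schmidt norm of `Δ`, so errors small in that norm are small on this vector. -/
theorem norm_kronecker_mul_entangled {d D : ℕ} (h : d ≤ D) (Δ : Matrix (Fin d) (Fin d) ℂ)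
    (W : Matrix.unitaryGroup (Fin D) ℂ) :
    ‖(Δ ⊗ₖ (W : Matrix (Fin D) (Fin D) ℂ)) * entangled d D‖ = ‖Δ‖ * (√d)⁻¹ := by
  have hW := norm_mul_unitary ⟨_, Matrix.transpose_mem_unitaryGroup_iff.2 W.2⟩ (Δ * padInc d D)
  rw [entangled, Matrix.mul_smul, kronecker_mul_colOf, norm_smul, norm_inv, Complex.norm_real,
    Real.norm_of_nonneg (Real.sqrt_nonneg _), norm_colOf, hW,
    norm_mul_coisometry (padInc_mul_conjTranspose h), mul_comm]

theorem norm_kronConj_mul_entangled_sub {d D : ℕ} (U : Matrix.unitaryGroup (Fin d) ℂ)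
    (W : Matrix.unitaryGroup (Fin D) ℂ) :
    ‖(kronConj U W : Matrix (Fin d × Fin D) (Fin d × Fin D) ℂ) * entangled d D - entangled d D‖ =
      ‖(U : Matrix (Fin d) (Fin d) ℂ) * padInc d D -
        padInc d D * (W : Matrix (Fin D) (Fin D) ℂ)‖ * (√d)⁻¹ := by
  have h1 : ((W : Matrix (Fin D) (Fin D) ℂ).map star)ᵀ = (W : Matrix (Fin D) (Fin D) ℂ)ᴴ := rfl
  rw [kronConj_coe, entangled, Matrix.mul_smul, ← smul_sub, kronecker_mul_colOf, h1, norm_smul,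
    norm_inv, Complex.norm_real, Real.norm_of_nonneg (Real.sqrt_nonneg _), mul_comm]
  congr 1
  have h2 : colOf ((U : Matrix (Fin d) (Fin d) ℂ) * padInc d D * (W : Matrix (Fin D) (Fin D) ℂ)ᴴ) -
      colOf (padInc d D) = colOf ((U : Matrix (Fin d) (Fin d) ℂ) * padInc d D *
        (W : Matrix (Fin D) (Fin D) ℂ)ᴴ - padInc d D) := rfl
  rw [h2, norm_colOf, ← norm_mul_unitary W, Matrix.sub_mul, Matrix.mul_assoc _ _ᴴ,
    conjTranspose_mul_self_of_unitary, Matrix.mul_one]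

theorem realign_entangled (d D : ℕ) :
    realign (entangled d D * (entangled d D)ᴴ) =
      (d : ℂ)⁻¹ • (padInc d D ⊗ₖ (padInc d D).map star) := by
  have hd : ((√d : ℝ) : ℂ)⁻¹ * ((√d : ℝ) : ℂ)⁻¹ = (d : ℂ)⁻¹ := by
    rw [← mul_inv, ← Complex.ofReal_mul, Real.mul_self_sqrt (Nat.cast_nonneg _)]
    simp
  ext i j
  rw [← hd]
  simp [realign, entangled, colOf, Matrix.mul_apply]
  ring

/-- The realigned projection is 1/d times a coisometry. This factor compensates the √(d²) = d in
unnormalized Frobenius errors on ℂ^d ⊗ ℂ^d. -/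
theorem realign_entangled_mem_opBall {d D : ℕ} (h : d ≤ D) (p : ℕ) :
    realign (entangled d D * (entangled d D)ᴴ) ∈
      (opBall p ((d : ℝ)⁻¹) : Set (Matrix (Fin d × Fin d) (Fin D × Fin D) ℂ)) := by
  intro Δ
  have hE := padInc_mul_conjTranspose h
  have hE' : (padInc d D).map star * ((padInc d D).map star)ᴴ = 1 := by
    have : (padInc d D).map star = padInc d D := by
      ext i j
      simp [padInc, apply_ite]
    rw [this, hE]
  have hK : (padInc d D ⊗ₖ (padInc d D).map star) * (padInc d D ⊗ₖ (padInc d D).map star)ᴴ = 1 := by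
    rw [Matrix.conjTranspose_kronecker, ← Matrix.mul_kronecker_mul, hE, hE', Matrix.one_kronecker_one]
  rw [realign_entangled, Matrix.mul_smul, norm_smul, norm_inv, Complex.norm_natCast,
    norm_mul_coisometry hK, mul_comm]

theorem trace_column_mul_conjTranspose {n : Type*} [Fintype n] (ξ : Matrix n Unit ℂ) :
    (ξ * ξᴴ).trace = ((‖ξ‖ ^ 2 : ℝ) : ℂ) := by
  rw [norm_col_sq, Matrix.trace]
  push_cast
  refine Finset.sum_congr rfl fun i _ => ?_
  rw [Matrix.diag_apply, Matrix.mul_apply]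
  simp [Complex.mul_conj']

theorem norm_column_conjTranspose_mul_le {n : Type*} [Fintype n] {ξ : Matrix n Unit ℂ}
    (y : Matrix n Unit ℂ) : ‖ξᴴ * y‖ ≤ ‖ξ‖ * ‖y‖ := by
  have := Matrix.frobenius_norm_mul ξᴴ y
  rwa [Matrix.frobenius_norm_conjTranspose] at this

theorem entangled_mem_densityBall {d D : ℕ} (hd : 0 < d) (h : d ≤ D) :
    entangled d D * (entangled d D)ᴴ ∈
      (densityBall ((√d)⁻¹) : Set (Matrix (Fin d × Fin D) (Fin d × Fin D) ℂ)) := by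
  refine ⟨Matrix.posSemidef_self_mul_conjTranspose _, ?_, fun Δ W y => ?_⟩
  · rw [trace_column_mul_conjTranspose, norm_entangled hd h]
    simp
  · rw [Matrix.mul_assoc, ← Matrix.mul_assoc]
    refine (Matrix.frobenius_norm_mul _ _).trans ?_
    rw [norm_kronecker_mul_entangled h]
    refine mul_le_mul_of_nonneg_left ?_ (by positivity)
    have := norm_column_conjTranspose_mul_le (ξ := entangled d D) y
    rwa [norm_entangled hd h, one_mul] at this

theorem norm_conj_rank_one_sub_le {n : Type*} [Fintype n] [DecidableEq n]
    (U : Matrix.unitaryGroup n ℂ) {ξ : Matrix n Unit ℂ} (hξ : ‖ξ‖ = 1) :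
    ‖(U : Matrix n n ℂ) * (ξ * ξᴴ) * (U : Matrix n n ℂ)ᴴ - ξ * ξᴴ‖ ≤
      2 * ‖(U : Matrix n n ℂ) * ξ - ξ‖ := by
  set η := (U : Matrix n n ℂ) * ξ with hη
  have hηn : ‖η‖ = 1 := by rw [hη, norm_unitary_mul, hξ]
  have h1 : (U : Matrix n n ℂ) * (ξ * ξᴴ) * (U : Matrix n n ℂ)ᴴ - ξ * ξᴴ =
      (η - ξ) * ηᴴ + ξ * (η - ξ)ᴴ := by
    simp only [hη, Matrix.sub_mul, Matrix.conjTranspose_sub, Matrix.mul_sub,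
      Matrix.conjTranspose_mul, Matrix.mul_assoc]
    abel
  rw [h1]
  refine (norm_add_le _ _).trans ?_
  have h2 := Matrix.frobenius_norm_mul (η - ξ) ηᴴ
  have h3 := Matrix.frobenius_norm_mul ξ (η - ξ)ᴴ
  rw [Matrix.frobenius_norm_conjTranspose] at h2 h3
  rw [hηn] at h2
  rw [hξ] at h3
  linarith

end ApproximateState

/-! ### Averaging the entangled state -/

section AlmostEigenvector

open scoped Matrix.Norms.Frobenius Kronecker ComplexOrder

variable {G : Type*} [Group G]

/-- The representation `ρ ⊗ conj ρ`. -/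
def kronConjHom {b : Type*} [Fintype b] [DecidableEq b] (ρ : G →* Matrix.unitaryGroup b ℂ) :
    G →* Matrix.unitaryGroup (b × b) ℂ where
  toFun g := kronConj (ρ g) (ρ g)
  map_one' := by
    have h := kronConj_mul (ρ 1) (ρ 1) (ρ 1) (ρ 1)
    rw [← map_mul, one_mul] at h
    exact left_eq_mul.1 h
  map_mul' g h := by rw [map_mul, kronConj_mul]

/-- The average of the rank one projection on the maximally entangled vector is close to that
projection and almost invariant, if the maps involved are close to representations. -/
theorem averaged_state_bounds {S : Finset G} (hS : S.Nonempty) (hsymm : ∀ s ∈ S, s⁻¹ ∈ S)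
    {gap : ℝ} (hgap0 : 0 < gap) (hgap1 : gap ≤ 1)
    (hgap : ∀ (n : ℕ) (ρ : G →* Matrix.unitaryGroup (Fin n) ℂ),
      spectrum ℝ (repLaplacian S ρ) ∩ Set.Ioo 0 gap = ∅)
    {d D p : ℕ} (hd : 0 < d) (hdD : d ≤ D) (hp : d * d ≤ p)
    (f : G → Matrix.unitaryGroup (Fin d) ℂ) (ρ : G →* Matrix.unitaryGroup (Fin D) ℂ)
    (τ : G →* Matrix.unitaryGroup (Fin p) ℂ) {ε η : ℝ} (hε : ε ≤ 1 / 2) (hη : η ≤ 1 / 2)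
    (hρ : ∀ s ∈ S, hsDist (f s : Matrix (Fin d) (Fin d) ℂ) (ρ s : Matrix (Fin D) (Fin D) ℂ) ≤ ε)
    (hτ : ∀ s ∈ S, hsDist (tensorConj (f s) : Matrix (Fin (d * d)) (Fin (d * d)) ℂ)
      (τ s : Matrix (Fin p) (Fin p) ℂ) ≤ η) (k : ℕ)
    (Q : Matrix (Fin d × Fin D) (Fin d × Fin D) ℂ)
    (hQ : Q = (conjAvg S (fun g => (kronConj (f g) (ρ g)).1)
      (fun g => (kronConj (f g) (ρ g)).1))^[k]
        (entangled d D * (entangled d D)ᴴ)) :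
    Q ∈ (densityBall ((√d)⁻¹) : Set (Matrix (Fin d × Fin D) (Fin d × Fin D) ℂ)) ∧
    ‖Q - entangled d D * (entangled d D)ᴴ‖ ≤ (2 * η + 4 * ε) / √(2 * gap) + 2 * k * η ∧
    ∀ s ∈ S, ‖(kronConj (f s) (ρ s)).1 * Q *
        (kronConj (f s) (ρ s)).1ᴴ - Q‖ ≤
      2 * η + 4 * k * η + √(4 * S.card) * (1 - gap / 2) ^ k := by
  have hcard : (0 : ℝ) < S.card := by exact_mod_cast hS.card_pos
  have hd' : (0 : ℝ) < d := by exact_mod_cast hd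
  have hsd : (0 : ℝ) < √d := Real.sqrt_pos.2 hd'
  have hη0 : 0 ≤ η := by
    obtain ⟨s, hs⟩ := hS
    exact (hsNorm_nonneg _).trans (hτ s hs)
  have hε0 : 0 ≤ ε := by
    obtain ⟨s, hs⟩ := hS
    exact (hsNorm_nonneg _).trans (hρ s hs)
  set Q₀ := entangled d D * (entangled d D)ᴴ with hQ₀
  -- After realignment, conjugation by f ⊗ conj ρ becomes `X ↦ F X R*`. Here `R` is an honest
  -- representation, and `F` is almost intertwined by `J` with the honest `τ`.
  set F : G → Matrix.unitaryGroup (Fin d × Fin d) ℂ := fun g => kronConj (f g) (f g) with hF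
  set R := kronConjHom ρ with hR
  have hRg : ∀ g, R g = kronConj (ρ g) (ρ g) := fun _ => rfl
  set J := tensorInc d p with hJdef
  have hJ1 : Jᴴ * J = 1 := tensorInc_isometry hp
  have hJ : ∀ s ∈ S, ‖J * (F s).1 - (τ s : Matrix (Fin p) (Fin p) ℂ) * J‖ ≤
      2 * η * d := by
    intro s hs
    have h1 := (norm_intertwine_le_of_hsDist hp (tensorConj (f s)) (τ s) ((hτ s hs).trans hη)).2
    refine (norm_tensorInc_intertwine _ _).trans_le (h1.trans ?_)
    have h2 : √((d * d : ℕ) : ℝ) = d := by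
      rw [Nat.cast_mul, Real.sqrt_mul_self hd'.le]
    rw [h2]
    exact mul_le_mul_of_nonneg_right (by linarith [hτ s hs]) hd'.le
  have hcmp := fun k => norm_conjAvg_iterate_sub_le hS F τ R (J := J) (κ := 2 * η * d)
    (inv_nonneg.2 hd'.le) hJ (realign_entangled_mem_opBall hdD p) k
  -- The dimension cancels: a Frobenius defect 2ηd against the operator bound 1/d costs 2η per
  -- averaging step, independently of `d`.
  have hκ : 2 * η * d * (d : ℝ)⁻¹ = 2 * η := by field_simp
  simp only [hκ] at hcmp
  have hre : ∀ k, realign ((conjAvg S (fun g => (kronConj (f g) (ρ g)).1)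
      (fun g => (kronConj (f g) (ρ g)).1))^[k] Q₀) =
      (conjAvg S (fun g => (F g).1) (fun g => (R g).1))^[k]
        (realign Q₀) := by
    intro k
    induction k with
    | zero => rfl
    | succ k ih =>
      rw [Function.iterate_succ_apply', Function.iterate_succ_apply', ← ih]
      exact realign_conjAvg S _ _ _
  set Y₀ := realign Q₀ with hY₀
  have hact : ∀ g (P : Matrix (Fin d × Fin D) (Fin d × Fin D) ℂ),
      realign ((kronConj (f g) (ρ g)).1 * P *
        (kronConj (f g) (ρ g)).1ᴴ) =
      (F g).1 * realign P * (R g).1ᴴ := by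
    intro g P
    exact realign_conj _ _ _
  obtain ⟨hYk, hXY⟩ := hcmp k
  obtain ⟨hb1, hb2⟩ := conjAvg_iterate_bounds hS hsymm hgap0 hgap τ R (J * Y₀) k
  have hQY := hre k
  rw [← hQ] at hQY
  rw [← hQY] at hYk hXY
  set Xk := (conjAvg S (fun g => (τ g : Matrix (Fin p) (Fin p) ℂ))
    (fun g => (R g).1))^[k] (J * Y₀) with hXk
  have hX0 : ‖J * Y₀‖ = 1 := by
    rw [norm_isometry_mul hJ1, hY₀, norm_realign, hQ₀]
    have h2 : ‖entangled d D * (entangled d D)ᴴ‖ = ‖entangled d D‖ := by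
      refine norm_mul_isometry_conjTranspose (W := (entangled d D)) ?_ _
      ext i j
      have h1 := trace_column_mul_conjTranspose (entangled d D)
      rw [Matrix.trace_mul_comm, norm_entangled hd hdD] at h1
      simpa [Matrix.trace] using h1
    rw [h2, norm_entangled hd hdD]
  -- The 4ε comes from the projection: a factor 2 for its two sides and a factor 2 for padding.
  -- Replacing `F` by `τ` adds 2η.
  have hstart : ∀ s ∈ S, ‖(τ s : Matrix (Fin p) (Fin p) ℂ) * (J * Y₀) * (R s).1ᴴ -
      J * Y₀‖ ≤ 2 * η + 4 * ε := by
    intro s hs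
    have h1 : ‖(kronConj (f s) (ρ s)).1 * Q₀ *
        (kronConj (f s) (ρ s)).1ᴴ - Q₀‖ ≤ 4 * ε := by
      refine (norm_conj_rank_one_sub_le _ (norm_entangled hd hdD)).trans ?_
      rw [norm_kronConj_mul_entangled_sub]
      have h2 := (norm_intertwine_le_of_hsDist hdD (f s) (ρ s) ((hρ s hs).trans hε)).1
      have h3 := mul_le_mul_of_nonneg_right h2 (inv_nonneg.2 hsd.le)
      rw [mul_assoc, mul_inv_cancel₀ hsd.ne', mul_one] at h3
      linarith [hρ s hs]
    rw [← norm_realign, realign_sub, hact, ← hY₀, ← norm_isometry_mul hJ1, Matrix.mul_sub] at h1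
    have h4 : ‖(J * (F s).1 - (τ s : Matrix (Fin p) (Fin p) ℂ) * J) * Y₀ *
        (R s).1ᴴ‖ ≤ 2 * η := by
      rw [norm_mul_unitary_conjTranspose, ← hκ]
      exact ((hcmp 0).1 _).trans (mul_le_mul_of_nonneg_right (hJ s hs) (inv_nonneg.2 hd'.le))
    have h5 : (τ s : Matrix (Fin p) (Fin p) ℂ) * (J * Y₀) * (R s).1ᴴ - J * Y₀ =
        (J * ((F s).1 * Y₀ * (R s).1ᴴ) - J * Y₀) -
        (J * (F s).1 - (τ s : Matrix (Fin p) (Fin p) ℂ) * J) * Y₀ *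
        (R s).1ᴴ := by
      simp only [Matrix.sub_mul, Matrix.mul_assoc]
      abel
    rw [h5]
    refine (norm_sub_le _ _).trans ?_
    linarith
  have hA : ‖Xk - J * Y₀‖ ≤ (2 * η + 4 * ε) / √(2 * gap) := by
    have h1 : ∑ s ∈ S, ‖(τ s : Matrix (Fin p) (Fin p) ℂ) * (J * Y₀) * (R s).1ᴴ -
        J * Y₀‖ ^ 2 ≤ S.card * (2 * η + 4 * ε) ^ 2 := by
      rw [← nsmul_eq_mul]
      exact Finset.sum_le_card_nsmul _ _ _ fun s hs =>
        pow_le_pow_left₀ (norm_nonneg _) (hstart s hs) 2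
    rw [← sq_le_sq₀ (norm_nonneg _) (by positivity), div_pow, Real.sq_sqrt (by positivity)]
    refine hb1.trans ?_
    rw [div_le_div_iff₀ (by positivity) (by positivity)]
    nlinarith
  have hB : ∀ s ∈ S, ‖(τ s : Matrix (Fin p) (Fin p) ℂ) * Xk * (R s).1ᴴ - Xk‖ ≤
      √(4 * S.card) * (1 - gap / 2) ^ k := by
    intro s hs
    have h1 : (0 : ℝ) ≤ (1 - gap / 2) ^ k := pow_nonneg (by linarith) k
    rw [← sq_le_sq₀ (norm_nonneg _) (by positivity), mul_pow, Real.sq_sqrt (by positivity)]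
    rw [hX0, one_pow, mul_one] at hb2
    exact (Finset.single_le_sum (f := fun s => ‖(τ s : Matrix (Fin p) (Fin p) ℂ) * Xk *
      (R s).1ᴴ - Xk‖ ^ 2) (fun _ _ => by positivity) hs).trans hb2
  refine ⟨?_, ?_, fun s hs => ?_⟩
  · rw [hQ]
    clear * - hS hd hdD
    induction k with
    | zero => exact entangled_mem_densityBall hd hdD
    | succ k ih =>
      rw [Function.iterate_succ_apply']
      exact conjAvg_mem hS (convex_densityBall _) ih fun s _ =>
        kronConj_mul_mul_mem_densityBall ih _ _
  · rw [← norm_realign, realign_sub, ← hY₀, ← norm_isometry_mul hJ1, Matrix.mul_sub]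
    have h1 : J * realign Q - J * Y₀ = (Xk - J * Y₀) - (Xk - J * realign Q) := by abel
    rw [h1]
    refine (norm_sub_le _ _).trans ?_
    linarith
  · rw [← norm_realign, realign_sub, hact, ← norm_isometry_mul hJ1, Matrix.mul_sub]
    -- Replacing `F` by `τ` costs 2η, passing between `Q` and the honest average `Xk` costs 2kη
    -- twice, and `Xk` itself is almost invariant by the spectral gap.
    have h1 : J * ((F s).1 * realign Q * (R s).1ᴴ) - J * realign Q =
        (J * (F s).1 - (τ s : Matrix (Fin p) (Fin p) ℂ) * J) * realign Q *
          (R s).1ᴴ -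
        (τ s : Matrix (Fin p) (Fin p) ℂ) * (Xk - J * realign Q) * (R s).1ᴴ +
        ((τ s : Matrix (Fin p) (Fin p) ℂ) * Xk * (R s).1ᴴ - Xk) +
        (Xk - J * realign Q) := by
      simp only [Matrix.sub_mul, Matrix.mul_sub, Matrix.mul_assoc]
      abel
    have h2 : ‖(J * (F s).1 - (τ s : Matrix (Fin p) (Fin p) ℂ) * J) * realign Q *
        (R s).1ᴴ‖ ≤ 2 * η := by
      rw [norm_mul_unitary_conjTranspose, ← hκ]
      exact (hYk _).trans (mul_le_mul_of_nonneg_right (hJ s hs) (inv_nonneg.2 hd'.le))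
    have h3 : ‖(τ s : Matrix (Fin p) (Fin p) ℂ) * (Xk - J * realign Q) * (R s).1ᴴ‖ ≤
        k * (2 * η) := by
      rw [norm_mul_unitary_conjTranspose, norm_unitary_mul]
      exact hXY
    rw [h1]
    refine (norm_add₃_le).trans ?_
    have h4 := norm_sub_le ((J * (F s).1 - (τ s : Matrix (Fin p) (Fin p) ℂ) * J) *
      realign Q * (R s).1ᴴ)
      ((τ s : Matrix (Fin p) (Fin p) ℂ) * (Xk - J * realign Q) * (R s).1ᴴ)
    linarith [hB s hs]

/-- Under the spectral gap, a map which is close to a representation, and whose tensor square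
`f ⊗ conj f` is very close to one, yields a common almost eigenvector of all `f(s) ⊗ conj ρ(s)`,
which is moreover bounded as an operator. -/
theorem exists_almost_eigenvector {S : Finset G} (hS : S.Nonempty) (hsymm : ∀ s ∈ S, s⁻¹ ∈ S)
    {gap : ℝ} (hgap0 : 0 < gap) (hgap1 : gap ≤ 1)
    (hgap : ∀ (n : ℕ) (ρ : G →* Matrix.unitaryGroup (Fin n) ℂ),
      spectrum ℝ (repLaplacian S ρ) ∩ Set.Ioo 0 gap = ∅)
    {d D p : ℕ} (hd : 0 < d) (hdD : d ≤ D) (hp : d * d ≤ p)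
    (f : G → Matrix.unitaryGroup (Fin d) ℂ) (ρ : G →* Matrix.unitaryGroup (Fin D) ℂ)
    (τ : G →* Matrix.unitaryGroup (Fin p) ℂ) {ε η : ℝ} (hε : ε ≤ 1 / 2) (hη : η ≤ 1 / 2)
    (hρ : ∀ s ∈ S, hsDist (f s : Matrix (Fin d) (Fin d) ℂ) (ρ s : Matrix (Fin D) (Fin D) ℂ) ≤ ε)
    (hτ : ∀ s ∈ S, hsDist (tensorConj (f s) : Matrix (Fin (d * d)) (Fin (d * d)) ℂ)
      (τ s : Matrix (Fin p) (Fin p) ℂ) ≤ η) (k : ℕ)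
    (hsmall : (2 * η + 4 * ε) / √(2 * gap) + 2 * k * η ≤ 1 / 8) :
    ∃ v : Matrix (Fin d × Fin D) Unit ℂ, ‖v‖ = 1 ∧
      (∀ (Δ : Matrix (Fin d) (Fin d) ℂ) (W : Matrix.unitaryGroup (Fin D) ℂ),
        ‖(Δ ⊗ₖ (W : Matrix (Fin D) (Fin D) ℂ)) * v‖ ≤ 2 * (‖Δ‖ / √d)) ∧
      ∀ s ∈ S, ∃ c : ℂ, ‖(kronConj (f s) (ρ s)).1 * v - c • v‖ ≤
        2 * (2 * η + 4 * k * η + √(4 * S.card) * (1 - gap / 2) ^ k) := by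
  obtain ⟨⟨hpsd, htr, hball⟩, hclose, hinv⟩ := averaged_state_bounds hS hsymm hgap0 hgap1 hgap hd
    hdD hp f ρ τ hε hη hρ hτ k _ rfl
  set Q := (conjAvg S (fun g => (kronConj (f g) (ρ g)).1)
      (fun g => (kronConj (f g) (ρ g)).1))^[k]
        (entangled d D * (entangled d D)ᴴ)
  obtain ⟨v, μ, hμ, hv, hQv, hw⟩ := exists_top_eigenvector hpsd htr (norm_entangled hd hdD)
    (hclose.trans hsmall)
  refine ⟨v, hv, fun Δ W => ?_, fun s hs => ⟨_, (hw _).trans ?_⟩⟩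
  -- Since `Q * v = μ v` with μ ≥ 3/4, the bound on the range of `Q` passes to `v` after division by
  -- μ; the factor 2 is generous.
  · have h1 := hball Δ W v
    rw [hQv, Matrix.mul_smul, norm_smul, Complex.norm_real, Real.norm_of_nonneg (by linarith), hv,
      mul_one, ← div_eq_mul_inv] at h1
    have h2 : 0 ≤ ‖(Δ ⊗ₖ (W : Matrix (Fin D) (Fin D) ℂ)) * v‖ := norm_nonneg _
    nlinarith
  · refine mul_le_mul_of_nonneg_left (le_trans ?_ (hinv s hs)) zero_le_two
    set A := kronConj (f s) (ρ s)
    -- `A * v` is an eigenvector of A Q A*, which is close to `Q`. Simplicity of the top eigenvalue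
    -- then makes `A * v` nearly proportional to `v`.
    have h1 : Q * (A.1 * v) - (μ : ℂ) • (A.1 * v) =
        -((A.1 * Q * A.1ᴴ - Q) * (A.1 * v)) := by
      rw [← Matrix.mul_smul, ← hQv, Matrix.sub_mul, Matrix.mul_assoc _ _ᴴ, ← Matrix.mul_assoc _ᴴ,
        conjTranspose_mul_self_of_unitary, Matrix.one_mul, Matrix.mul_assoc, neg_sub]
    rw [h1, norm_neg]
    refine (Matrix.frobenius_norm_mul _ _).trans ?_
    rw [norm_unitary_mul, hv, mul_one]

end AlmostEigenvector

/-! ### Characters from common almost eigenvectors -/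

section Character

open scoped Matrix.Norms.Frobenius

/-- Almost multiplicative unitaries with a common almost eigenvector define a character along an
ultrafilter. -/
theorem exists_character_of_almost_eigenvector {G : Type*} [Group G] {I : Type*} (l : Filter I)
    [l.NeBot] {n : I → Type*} [∀ i, Fintype (n i)] [∀ i, DecidableEq (n i)]
    (α : ∀ i, G → Matrix.unitaryGroup (n i) ℂ) (v : ∀ i, Matrix (n i) Unit ℂ)
    (hv : ∀ᶠ i in l, ‖v i‖ = 1)
    (hmul : ∀ g h, Tendsto (fun i => ‖(α i (g * h)).1 * v i - (α i g).1 * ((α i h).1 * v i)‖)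
      l (𝓝 0))
    {T : Set G} (hT : Subgroup.closure T = ⊤)
    (heig : ∀ t ∈ T, ∃ c : I → ℂ, Tendsto (fun i => ‖(α i t).1 * v i - c i • v i‖) l (𝓝 0)) :
    ∃ U : Ultrafilter I, ↑U ≤ l ∧ ∃ χ : G →* ℂ, ∀ g,
      Tendsto (fun i => ‖(α i g).1 * v i - χ g • v i‖) U (𝓝 0) := by
  -- The approximate eigenvalues on generators vary with the index and need not converge. They are
  -- bounded, so an ultrafilter gives them limits, and the relation `E g c` then extends over
  -- products and inverses.
  set U := Ultrafilter.of l
  have hU : ↑U ≤ l := Ultrafilter.of_le l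
  have hv' : ∀ᶠ i in (U : Filter I), ‖v i‖ = 1 := hU hv
  let E : G → ℂ → Prop := fun g c =>
    Tendsto (fun i => ‖(α i g).1 * v i - c • v i‖) (U : Filter I) (𝓝 0)
  -- From multiplicativity at (1, 1): a unitary factor `α i 1` cancels, which leaves the distance
  -- from `α i 1 * v i` to `v i`.
  have hE1 : E 1 1 := by
    refine ((hmul 1 1).mono_left hU).congr fun i => ?_
    rw [mul_one, ← Matrix.mul_sub, norm_unitary_mul, one_smul, norm_sub_rev]
  have hEmul : ∀ g h c c', E g c → E h c' → E (g * h) (c * c') := by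
    intro g h c c' hg hh
    have hlim := (((hmul g h).mono_left hU).add hh).add (hg.const_mul ‖c'‖)
    simp only [mul_zero, add_zero] at hlim
    refine squeeze_zero (fun _ => norm_nonneg _) (fun i => ?_) hlim
    have : (α i (g * h)).1 * v i - (c * c') • v i =
        ((α i (g * h)).1 * v i - (α i g).1 * ((α i h).1 * v i)) +
        (α i g).1 * ((α i h).1 * v i - c' • v i) + c' • ((α i g).1 * v i - c • v i) := by
      rw [Matrix.mul_sub, Matrix.mul_smul, smul_sub, smul_smul, mul_comm c' c]
      abel
    rw [this]
    refine norm_add₃_le.trans ?_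
    rw [norm_unitary_mul, norm_smul]
  have hEuniq : ∀ g c c', E g c → E g c' → c = c' := by
    intro g c c' h1 h2
    have h3 := h1.add h2
    rw [add_zero] at h3
    have h4 : Tendsto (fun _ : I => ‖c - c'‖) (U : Filter I) (𝓝 0) := by
      refine squeeze_zero' (Eventually.of_forall fun _ => norm_nonneg _) ?_ h3
      filter_upwards [hv'] with i hi
      have h5 : ‖c - c'‖ = ‖(c - c') • v i‖ := by rw [norm_smul, hi, mul_one]
      have h6 : (c - c') • v i = ((α i g).1 * v i - c' • v i) - ((α i g).1 * v i - c • v i) := by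
        rw [sub_smul]
        abel
      rw [h5, h6, add_comm]
      exact norm_sub_le _ _
    have h5 := tendsto_nhds_unique h4 tendsto_const_nhds
    exact sub_eq_zero.1 (norm_eq_zero.1 h5.symm)
  have hEnorm : ∀ g c, E g c → c ≠ 0 := by
    rintro g c h1 rfl
    have h2 : Tendsto (fun _ : I => (1 : ℝ)) (U : Filter I) (𝓝 0) := by
      refine h1.congr' ?_
      filter_upwards [hv'] with i hi
      rw [zero_smul, sub_zero, norm_unitary_mul, hi]
    exact one_ne_zero (tendsto_nhds_unique h2 tendsto_const_nhds).symm
  have hEinv : ∀ g c, E g c → E g⁻¹ c⁻¹ := by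
    intro g c hg
    have hc := hEnorm g c hg
    have hlim := ((hg.add ((hmul g⁻¹ g).mono_left hU)).add hE1).const_mul ‖c⁻¹‖
    simp only [mul_zero, add_zero, inv_mul_cancel] at hlim
    refine squeeze_zero (fun _ => norm_nonneg _) (fun i => ?_) hlim
    have : (α i g⁻¹).1 * v i - c⁻¹ • v i = c⁻¹ • (-((α i g⁻¹).1 * ((α i g).1 * v i - c • v i)) -
        ((α i 1).1 * v i - (α i g⁻¹).1 * ((α i g).1 * v i)) +
        ((α i 1).1 * v i - (1 : ℂ) • v i)) := by
      have h3 : -((α i g⁻¹).1 * ((α i g).1 * v i - c • v i)) -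
          ((α i 1).1 * v i - (α i g⁻¹).1 * ((α i g).1 * v i)) +
          ((α i 1).1 * v i - (1 : ℂ) • v i) = c • ((α i g⁻¹).1 * v i) - v i := by
        rw [Matrix.mul_sub, Matrix.mul_smul, one_smul]
        abel
      rw [h3, smul_sub, smul_smul, inv_mul_cancel₀ hc, one_smul]
    rw [this, norm_smul]
    refine mul_le_mul_of_nonneg_left ?_ (norm_nonneg _)
    refine (norm_add_le _ _).trans (add_le_add ((norm_sub_le _ _).trans ?_) le_rfl)
    rw [norm_neg, norm_unitary_mul]
  have hEgen : ∀ t ∈ T, ∃ c, E t c := by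
    intro t ht
    obtain ⟨c, hc⟩ := heig t ht
    replace hc := hc.mono_left hU
    have hbd : ∀ᶠ i in (U : Filter I), c i ∈ Metric.closedBall (0 : ℂ) 2 := by
      filter_upwards [hv', hc.eventually_lt_const one_pos] with i hi hlt
      rw [mem_closedBall_zero_iff]
      have h1 : ‖c i‖ = ‖c i • v i‖ := by rw [norm_smul, hi, mul_one]
      have h2 : c i • v i = (α i t).1 * v i - ((α i t).1 * v i - c i • v i) := by abel
      have h3 := norm_sub_le ((α i t).1 * v i) ((α i t).1 * v i - c i • v i)
      rw [← h2, ← h1, norm_unitary_mul, hi] at h3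
      linarith
    obtain ⟨x, -, hx⟩ := (isCompact_closedBall (0 : ℂ) 2).ultrafilter_le_nhds (U.map c)
      (le_principal_iff.2 hbd)
    have hx' : Tendsto c (U : Filter I) (𝓝 x) := hx
    refine ⟨x, ?_⟩
    have h1 : Tendsto (fun i => ‖c i - x‖) (U : Filter I) (𝓝 0) :=
      tendsto_iff_norm_sub_tendsto_zero.1 hx'
    have h2 := hc.add h1
    rw [add_zero] at h2
    refine squeeze_zero' (Eventually.of_forall fun _ => norm_nonneg _) ?_ h2
    filter_upwards [hv'] with i hi
    have h3 : (α i t).1 * v i - x • v i =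
        ((α i t).1 * v i - c i • v i) + (c i - x) • v i := by
      rw [sub_smul]
      abel
    rw [h3]
    refine (norm_add_le _ _).trans_eq ?_
    rw [norm_smul, hi, mul_one]
  have hEall : ∀ g, ∃ c, E g c := by
    intro g
    have hg : g ∈ Subgroup.closure T := by rw [hT]; trivial
    induction hg using Subgroup.closure_induction with
    | mem t ht => exact hEgen t ht
    | one => exact ⟨1, hE1⟩
    | mul g h _ _ hg hh =>
      obtain ⟨c, hc⟩ := hg
      obtain ⟨c', hc'⟩ := hh
      exact ⟨_, hEmul g h c c' hc hc'⟩
    | inv g _ hg =>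
      obtain ⟨c, hc⟩ := hg
      exact ⟨_, hEinv g c hc⟩
  choose χ hχ using hEall
  exact ⟨U, hU, ⟨⟨χ, hEuniq 1 _ _ (hχ 1) hE1⟩, fun g h =>
    hEuniq (g * h) _ _ (hχ _) (hEmul g h _ _ (hχ g) (hχ h))⟩, hχ⟩

/-- The values of a character of a group with finite abelianization are roots of unity. -/
theorem character_pow_card_abelianization {G : Type*} [Group G] [Finite (Abelianization G)]
    (χ : G →* ℂ) (g : G) : χ g ^ Nat.card (Abelianization G) = 1 := by
  let ψ : Abelianization G →* ℂˣ := Abelianization.lift χ.toHomUnits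
  have h1 : (ψ (Abelianization.of g)) ^ Nat.card (Abelianization G) = 1 := by
    rw [← map_pow, pow_card_eq_one', map_one]
  have h2 : ψ (Abelianization.of g) = χ.toHomUnits g := by simp [ψ]
  rw [h2] at h1
  have h3 := congrArg Units.val h1
  simpa using h3

end Character

/-! ### The normalized Hilbert–Schmidt norm and `U ⊗ conj U` -/

section HSNorm

open scoped Matrix.Norms.Frobenius Kronecker

variable {m : ℕ}

theorem hsNorm_add_le (x y : Matrix (Fin m) (Fin m) ℂ) : hsNorm (x + y) ≤ hsNorm x + hsNorm y := by
  rw [hsNorm_eq, hsNorm_eq, hsNorm_eq, ← add_div]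
  exact div_le_div_of_nonneg_right (norm_add_le _ _) (Real.sqrt_nonneg _)

theorem hsNorm_sub_comm (x y : Matrix (Fin m) (Fin m) ℂ) : hsNorm (x - y) = hsNorm (y - x) := by
  rw [hsNorm_eq, hsNorm_eq, norm_sub_rev]

theorem hsNorm_sub_le (x y z : Matrix (Fin m) (Fin m) ℂ) :
    hsNorm (x - z) ≤ hsNorm (x - y) + hsNorm (y - z) := by
  have := hsNorm_add_le (x - y) (y - z)
  rwa [sub_add_sub_cancel] at this

theorem hsNorm_unitary_mul (U : Matrix.unitaryGroup (Fin m) ℂ) (x : Matrix (Fin m) (Fin m) ℂ) :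
    hsNorm (U.1 * x) = hsNorm x := by
  rw [hsNorm_eq, hsNorm_eq, norm_unitary_mul]

theorem hsNorm_mul_unitary (U : Matrix.unitaryGroup (Fin m) ℂ) (x : Matrix (Fin m) (Fin m) ℂ) :
    hsNorm (x * U.1) = hsNorm x := by
  rw [hsNorm_eq, hsNorm_eq, norm_mul_unitary]

theorem hsNorm_smul (c : ℂ) (x : Matrix (Fin m) (Fin m) ℂ) : hsNorm (c • x) = ‖c‖ * hsNorm x := by
  rw [hsNorm_eq, hsNorm_eq, norm_smul, mul_div_assoc]

theorem hsNorm_unitary_le (U : Matrix.unitaryGroup (Fin m) ℂ) : hsNorm U.1 ≤ 1 := by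
  rw [hsNorm_eq, norm_unitary, Fintype.card_fin]
  exact div_self_le_one _

theorem hsNorm_sub_smul_le (U : Matrix.unitaryGroup (Fin m) ℂ) (c : ℂ) :
    hsNorm (U.1 - c • U.1) ≤ ‖1 - c‖ := by
  have h : U.1 - c • U.1 = (1 - c) • U.1 := by rw [sub_smul, one_smul]
  rw [h, hsNorm_smul]
  exact mul_le_of_le_one_right (norm_nonneg _) (hsNorm_unitary_le U)

/-- `U ⊗ conj U` depends on `U` only up to a scalar, and in a Lipschitz way. -/
theorem hsNorm_tensorConj_sub_le (U V : Matrix.unitaryGroup (Fin m) ℂ) {c : ℂ} (hc : ‖c‖ = 1) :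
    hsNorm ((tensorConj U).1 - (tensorConj V).1) ≤ 2 * hsNorm (U.1 - c • V.1) := by
  set X := U.1 - c • V.1 with hX
  have hcc : c * star c = 1 := by
    rw [Complex.star_def, Complex.mul_conj', hc]; norm_num
  -- The difference telescopes after `V` is replaced by `c • V`, which leaves V ⊗ conj V unchanged
  -- because |c| = 1.
  have h1 : (kronConj U U).1 - (kronConj V V).1 =
      X ⊗ₖ (U.1).map star + (c • V.1) ⊗ₖ X.map star := by
    ext ⟨i, i'⟩ ⟨j, j'⟩
    simp only [kronConj_coe, hX, Matrix.sub_apply, Matrix.add_apply, Matrix.kroneckerMap_apply,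
      Matrix.map_apply, Matrix.smul_apply, smul_eq_mul, star_sub, star_mul']
    linear_combination (V.1 i j * star (V.1 i' j')) * hcc
  have h2 : (tensorConj U).1 - (tensorConj V).1 =
      ((kronConj U U).1 - (kronConj V V).1).submatrix finProdFinEquiv.symm
        finProdFinEquiv.symm := rfl
  have hU : ‖U.1‖ = √m := by rw [norm_unitary, Fintype.card_fin]
  have hV : ‖V.1‖ = √m := by rw [norm_unitary, Fintype.card_fin]
  have h3 : ‖(kronConj U U).1 - (kronConj V V).1‖ ≤ 2 * ‖X‖ * √m := by
    rw [h1]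
    refine (norm_add_le _ _).trans_eq ?_
    rw [frobenius_norm_kronecker, frobenius_norm_kronecker, frobenius_norm_map_star,
      frobenius_norm_map_star, norm_smul, hc, hU, hV]
    ring
  rw [hsNorm_eq, hsNorm_eq, h2, frobenius_norm_submatrix_equiv, Nat.cast_mul,
    Real.sqrt_mul_self (Nat.cast_nonneg _)]
  rcases Nat.eq_zero_or_pos m with h0 | h0
  · subst h0
    simp
  · have h4 : (0 : ℝ) < √m := Real.sqrt_pos.2 (by exact_mod_cast h0)
    have h5 : √(m : ℝ) * √m = m := Real.mul_self_sqrt (Nat.cast_nonneg _)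
    rw [div_le_iff₀ (by exact_mod_cast h0)]
    refine h3.trans_eq ?_
    nth_rewrite 3 [← h5]
    field_simp

theorem tensorConj_mul (U V : Matrix.unitaryGroup (Fin m) ℂ) :
    tensorConj (U * V) = tensorConj U * tensorConj V := by
  apply Subtype.ext
  rw [tensorConj_coe, kronConj_mul, Submonoid.coe_mul, Submonoid.coe_mul, tensorConj_coe,
    tensorConj_coe, Matrix.submatrix_mul_equiv]

end HSNorm

/-! ### Powers of an asymptotically scalar element -/

section ScalarCentral

variable {G : Type*} [Group G]

/-- If `z` is asymptotically the scalar `ω`, then `z ^ c` acts asymptotically as `ω ^ c`. -/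
theorem IsAsymptoticRep.tendsto_mul_zpow {d : ℕ → ℕ}
    {σ : ∀ k, G → Matrix.unitaryGroup (Fin (d k)) ℂ} (hσ : IsAsymptoticRep d σ) {z : G} {ω : ℂ}
    (hω : ‖ω‖ = 1) (hz : Tendsto (fun k => hsNorm ((σ k z).1 - ω • 1)) atTop (𝓝 0)) (c : ℤ) :
    ∀ g, Tendsto (fun k => hsNorm ((σ k (g * z ^ c)).1 - ω ^ c • (σ k g).1)) atTop (𝓝 0) := by
  have hω0 : ω ≠ 0 := by
    rintro rfl
    simp at hω
  have hstep : ∀ g, Tendsto (fun k => hsNorm ((σ k (g * z)).1 - ω • (σ k g).1)) atTop (𝓝 0) := by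
    intro g
    have h := (hσ.2 g z).add hz
    rw [add_zero] at h
    refine squeeze_zero (fun _ => hsNorm_nonneg _) (fun k => ?_) h
    refine (hsNorm_sub_le _ ((σ k g).1 * (σ k z).1) _).trans (add_le_add le_rfl (le_of_eq ?_))
    have : (σ k g).1 * (σ k z).1 - ω • (σ k g).1 = (σ k g).1 * ((σ k z).1 - ω • 1) := by
      rw [Matrix.mul_sub, Matrix.mul_smul, Matrix.mul_one]
    rw [this, hsNorm_unitary_mul]
  induction c using Int.induction_on with
  | zero => intro g; simp [hsNorm]
  | succ c ih =>
    intro g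
    have h := (hstep (g * z ^ (c : ℤ))).add (ih g)
    rw [add_zero] at h
    refine squeeze_zero (fun _ => hsNorm_nonneg _) (fun k => ?_) h
    rw [_root_.zpow_add_one, zpow_add_one₀ hω0, ← mul_assoc]
    refine (hsNorm_sub_le _ (ω • (σ k (g * z ^ (c : ℤ))).1) _).trans
      (add_le_add le_rfl (le_of_eq ?_))
    rw [mul_comm, mul_smul, ← smul_sub, hsNorm_smul, hω, one_mul]
  | pred c ih =>
    intro g
    have h := (hstep (g * z ^ (-(c : ℤ) - 1))).add (ih g)
    rw [add_zero] at h
    refine squeeze_zero (fun _ => hsNorm_nonneg _) (fun k => ?_) h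
    have e1 : g * z ^ (-(c : ℤ) - 1) * z = g * z ^ (-(c : ℤ)) := by
      rw [mul_assoc, ← _root_.zpow_add_one]
      simp
    have e2 : ω ^ (-(c : ℤ)) = ω * ω ^ (-(c : ℤ) - 1) := by
      rw [mul_comm, ← zpow_add_one₀ hω0]
      simp
    rw [e1, e2]
    have h2 := hsNorm_sub_le (ω • (σ k (g * z ^ (-(c : ℤ) - 1))).1) (σ k (g * z ^ (-(c : ℤ)))).1
      ((ω * ω ^ (-(c : ℤ) - 1)) • (σ k g).1)
    rw [mul_smul, ← smul_sub, hsNorm_smul, hω, one_mul] at h2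
    rw [mul_smul, hsNorm_sub_comm (σ k (g * z ^ (-(c : ℤ)))).1]
    exact h2

end ScalarCentral

/-! ### Countability, and powers of scalars near 1 -/

section Countability

theorem countable_of_closure_finset {G : Type*} [Group G] {S : Finset G}
    (hS : Subgroup.closure (S : Set G) = ⊤) : Countable G := by
  have h1 : Countable (FreeGroup S) := Quot.mk_surjective.countable (α := List (S × Bool))
  have h2 : Function.Surjective (FreeGroup.lift (fun s : S => (s : G))) := by
    rw [← MonoidHom.range_eq_top, FreeGroup.range_lift_eq_closure]
    simpa using hS
  exact h2.countable

theorem norm_zpow_sub_one_le {ω : ℂ} (hω : ‖ω‖ = 1) (c : ℤ) :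
    ‖ω ^ c - 1‖ ≤ c.natAbs * ‖ω - 1‖ := by
  have hω0 : ω ≠ 0 := by
    rintro rfl
    simp at hω
  have hnat : ∀ n : ℕ, ‖ω ^ n - 1‖ ≤ n * ‖ω - 1‖ := by
    intro n
    induction n with
    | zero => simp
    | succ n ih =>
      have : ω ^ (n + 1) - 1 = ω * (ω ^ n - 1) + (ω - 1) := by ring
      rw [this]
      refine (norm_add_le _ _).trans ?_
      rw [norm_mul, hω, one_mul]
      push_cast
      linarith
  rcases Int.natAbs_eq c with h | h
  · conv_lhs => rw [h]
    rw [zpow_natCast]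
    exact hnat _
  · conv_lhs => rw [h]
    rw [_root_.zpow_neg, zpow_natCast]
    have h1 : (ω ^ c.natAbs)⁻¹ - 1 = -((ω ^ c.natAbs)⁻¹ * (ω ^ c.natAbs - 1)) := by
      have := pow_ne_zero c.natAbs hω0
      field_simp
      ring
    rw [h1, norm_neg, norm_mul, norm_inv, norm_pow, hω, one_pow, inv_one, one_mul]
    exact hnat _

end Countability

/-! ### Rigidity of the central scalar -/

section Contradiction

open scoped Matrix.Norms.Frobenius Kronecker

theorem kronecker_sub_left {k l m n : Type*} (A B : Matrix k l ℂ) (C : Matrix m n ℂ) :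
    (A - B) ⊗ₖ C = A ⊗ₖ C - B ⊗ₖ C := by
  ext
  simp [sub_mul]

variable {G Gt : Type*} [Group G] [Group Gt]

/-- Pairs (k, n) are sent to infinity with n first, then k. The error kη(n) needs n large depending
on k, while the error (1 - gap/2)^k needs k large. -/
theorem curry_atTop_neBot : ((atTop : Filter ℕ).curry (atTop : Filter ℕ)).NeBot := by
  rw [neBot_iff, ne_eq, ← empty_mem_iff_bot, mem_curry_iff]
  simpa using fun n : ℕ => ⟨⟨n, le_rfl⟩, fun m : ℕ => ⟨m, le_rfl⟩⟩

theorem tendsto_snd_curry {β : Type*} {l : Filter β} {f : ℕ → β} (hf : Tendsto f atTop l) :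
    Tendsto (fun i : ℕ × ℕ => f i.2) ((atTop : Filter ℕ).curry (atTop : Filter ℕ)) l :=
  hf.comp (tendsto_snd.mono_left curry_le_prod)

/-- A stable group with a spectral gap has no central extension with finite abelianization which
has asymptotic representations with central character of large order near `1`. -/
theorem exists_forall_not_tendsto_central (hT : HasPropertyTFD G) (hstable : IsHSStable G)
    (q : Gt →* G) (hq : Function.Surjective q) (z : Gt) (hz : q.ker = Subgroup.zpowers z)
    [Finite (Abelianization Gt)] :
    ∃ r > 0, ∀ ω : ℂ, ‖ω‖ = 1 → ‖ω - 1‖ < r → ω ^ Nat.card (Abelianization Gt) ≠ 1 →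
      ∀ (d : ℕ → ℕ) (σ : ∀ k, Gt → Matrix.unitaryGroup (Fin (d k)) ℂ), IsAsymptoticRep d σ →
        ¬ Tendsto (fun k => hsNorm ((σ k z).1 - ω • 1)) atTop (𝓝 0) := by
  classical
  obtain ⟨S, hS, hsymm, hgen, gap, hgap0, hgap1, hgap⟩ := hT.exists_nonempty
  have hcount : Countable G := countable_of_closure_finset hgen
  -- Small enough that 4ε/√(2 gap) < 1/8, the closeness needed for a simple top eigenvalue. It
  -- depends only on the gap, so `K`, `δ` and the radius below do not depend on ω.
  set ε : ℝ := √gap / 100 with hε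
  have hsg : 0 < √gap := Real.sqrt_pos.2 hgap0
  have hsg1 : √gap ≤ 1 := Real.sqrt_le_one.2 hgap1
  obtain ⟨K, δ, hδ, hKδ⟩ := hstable.exists_finite S (ε := ε) (by positivity)
  set sec : G → Gt := Function.surjInv hq
  have hsec : ∀ g, q (sec g) = g := Function.surjInv_eq hq
  have hcoc : ∀ g h, ∃ c : ℤ, sec g * sec h = sec (g * h) * z ^ c := by
    intro g h
    have : (sec (g * h))⁻¹ * (sec g * sec h) ∈ q.ker := by
      rw [MonoidHom.mem_ker, map_mul, map_inv, map_mul, hsec, hsec, hsec, inv_mul_cancel]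
    rw [hz, Subgroup.mem_zpowers_iff] at this
    obtain ⟨c, hc⟩ := this
    exact ⟨c, by rw [hc, mul_inv_cancel_left]⟩
  choose c hc using hcoc
  -- `M` bounds every cocycle exponent on `K`. Hence |ω - 1| < δ/(M + 1) keeps all the scalars `ω ^
  -- c g h` within δ of 1.
  set M : ℕ := ∑ g ∈ K, ∑ h ∈ K, (c g h).natAbs with hM
  refine ⟨δ / (M + 1), by positivity, fun ω hω hωr hωN d σ hσ hσz => ?_⟩
  have hcocM : ∀ g ∈ K, ∀ h ∈ K, ‖1 - ω ^ c g h‖ < δ := by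
    intro g hg h hh
    have h1 : (c g h).natAbs ≤ M :=
      (Finset.single_le_sum (f := fun h => (c g h).natAbs) (fun _ _ => Nat.zero_le _) hh).trans
        (Finset.single_le_sum (f := fun g => ∑ h ∈ K, (c g h).natAbs)
          (fun _ _ => Nat.zero_le _) hg)
    have h2 : ((c g h).natAbs : ℝ) ≤ M := by exact_mod_cast h1
    rw [lt_div_iff₀ (by positivity)] at hωr
    rw [norm_sub_rev]
    refine (norm_zpow_sub_one_le hω _).trans_lt ?_
    nlinarith [norm_nonneg (ω - 1)]
  have hzpow := fun c g => hσ.tendsto_mul_zpow hω hσz c g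
  have hproj : ∀ g h, Tendsto (fun k => hsNorm ((σ k (sec g)).1 * (σ k (sec h)).1 -
      ω ^ c g h • (σ k (sec (g * h))).1)) atTop (𝓝 0) := by
    intro g h
    have h1 := (hσ.2 (sec g) (sec h)).add (hzpow (c g h) (sec (g * h)))
    rw [add_zero] at h1
    refine squeeze_zero (fun _ => hsNorm_nonneg _) (fun k => ?_) h1
    rw [← hc, hsNorm_sub_comm (σ k (sec g * sec h)).1 ((σ k (sec g)).1 * (σ k (sec h)).1)]
    exact hsNorm_sub_le _ _ _
  -- the almost representations `σ ∘ sec` of `G`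
  have hgood : ∀ᶠ n in atTop, IsAlmostRep K δ (fun g => σ n (sec g)) := by
    refine (Finset.eventually_all K).2 fun g hg => (Finset.eventually_all K).2 fun h hh => ?_
    have h1 := (hproj g h).eventually_lt_const (sub_pos.2 (hcocM g hg h hh))
    filter_upwards [h1] with n hn
    have h2 := hsNorm_sub_le (σ n (sec (g * h))).1 (ω ^ c g h • (σ n (sec (g * h))).1)
      ((σ n (sec g)).1 * (σ n (sec h)).1)
    have h3 := hsNorm_sub_smul_le (σ n (sec (g * h))) (ω ^ c g h)
    rw [hsNorm_sub_comm (ω ^ c g h • (σ n (sec (g * h))).1)] at h2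
    linarith
  have hρex : ∀ n, ∃ (D : ℕ) (ρ : G →* Matrix.unitaryGroup (Fin D) ℂ), d n ≤ D ∧
      (IsAlmostRep K δ (fun g => σ n (sec g)) → ∀ g ∈ S, hsDist (σ n (sec g)).1 (ρ g).1 ≤ ε) := by
    intro n
    by_cases hn : IsAlmostRep K δ (fun g => σ n (sec g))
    · obtain ⟨D, ρ, hD, hρ⟩ := hKδ (d n) _ (hσ.1 n) hn
      exact ⟨D, ρ, hD, fun _ g hg => (hρ g hg).le⟩
    · exact ⟨d n, 1, le_rfl, fun h => absurd h hn⟩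
  choose D ρ hdD hρ using hρex
  -- the asymptotic representation `σ ⊗ conj σ` of `G`
  have htens : IsAsymptoticRep (fun n => d n * d n) (fun n g => tensorConj (σ n (sec g))) := by
    refine ⟨fun n => Nat.mul_pos (hσ.1 n) (hσ.1 n), fun g h => ?_⟩
    have h1 := (hproj g h).const_mul 2
    rw [mul_zero] at h1
    refine squeeze_zero (fun _ => hsNorm_nonneg _) (fun n => ?_) h1
    have h2 : ((tensorConj (σ n (sec g))).1 * (tensorConj (σ n (sec h))).1) =
        (tensorConj (σ n (sec g) * σ n (sec h))).1 := by
      rw [tensorConj_mul]; rfl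
    rw [h2, hsNorm_sub_comm]
    refine hsNorm_tensorConj_sub_le _ _ ?_
    rw [norm_zpow, hω, _root_.one_zpow]
  obtain ⟨p, τ, hp, hτ⟩ := hstable _ _ htens
  set η : ℕ → ℝ := fun n => ∑ s ∈ S, hsDist (tensorConj (σ n (sec s))).1 (τ n s).1 with hη
  have hηlim : Tendsto η atTop (𝓝 0) := by
    have := tendsto_finsetSum S fun s _ => hτ s
    simpa using this
  have hτη : ∀ n, ∀ s ∈ S, hsDist (tensorConj (σ n (sec s))).1 (τ n s).1 ≤ η n := fun n s hs =>
    Finset.single_le_sum (f := fun s => hsDist (tensorConj (σ n (sec s))).1 (τ n s).1)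
      (fun _ _ => hsNorm_nonneg _) hs
  -- almost eigenvectors
  let P : ℕ → ℕ → Prop := fun k n => IsAlmostRep K δ (fun g => σ n (sec g)) ∧ η n ≤ 1 / 2 ∧
    (2 * η n + 4 * ε) / √(2 * gap) + 2 * k * η n ≤ 1 / 8
  -- For fixed `k` all terms with `η n` vanish in the limit, and what remains is below 1/8 by the
  -- choice of ε.
  have hPev : ∀ k, ∀ᶠ n in atTop, P k n := by
    intro k
    have h1 : Tendsto (fun n => (2 * η n + 4 * ε) / √(2 * gap) + 2 * k * η n) atTop
        (𝓝 ((2 * 0 + 4 * ε) / √(2 * gap) + 2 * k * 0)) :=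
      (((hηlim.const_mul 2).add_const _).div_const _).add (hηlim.const_mul _)
    have h2 : (2 * 0 + 4 * ε) / √(2 * gap) + 2 * k * 0 < 1 / 8 := by
      have h3 : √gap ≤ √(2 * gap) := Real.sqrt_le_sqrt (by linarith)
      rw [mul_zero, mul_zero, zero_add, add_zero, div_lt_iff₀ (by linarith), hε]
      linarith
    filter_upwards [hgood, hηlim.eventually_lt_const (show (0 : ℝ) < 1 / 2 by norm_num),
      h1.eventually_lt_const h2] with n hn1 hn2 hn3
    exact ⟨hn1, hn2.le, hn3.le⟩
  have hvex : ∀ i : ℕ × ℕ, ∃ v : Matrix (Fin (d i.2) × Fin (D i.2)) Unit ℂ, P i.1 i.2 →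
      ‖v‖ = 1 ∧
      (∀ (Δ : Matrix (Fin (d i.2)) (Fin (d i.2)) ℂ) (W : Matrix.unitaryGroup (Fin (D i.2)) ℂ),
        ‖(Δ ⊗ₖ W.1) * v‖ ≤ 2 * (‖Δ‖ / √(d i.2))) ∧
      ∀ s ∈ S, ∃ c : ℂ, ‖(kronConj (σ i.2 (sec s)) (ρ i.2 s)).1 * v - c • v‖ ≤
        2 * (2 * η i.2 + 4 * i.1 * η i.2 + √(4 * S.card) * (1 - gap / 2) ^ i.1) := by
    intro i
    by_cases hi : P i.1 i.2
    · obtain ⟨v, hv⟩ := exists_almost_eigenvector hS hsymm hgap0 hgap1 hgap (hσ.1 i.2) (hdD i.2)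
        (hp i.2) (fun g => σ i.2 (sec g)) (ρ i.2) (τ i.2) (by linarith) hi.2.1 (hρ i.2 hi.1)
        (hτη i.2) i.1 hi.2.2
      exact ⟨v, fun _ => hv⟩
    · exact ⟨0, fun h => absurd h hi⟩
  choose v hv using hvex
  set l := (atTop : Filter ℕ).curry (atTop : Filter ℕ) with hl
  have hlne : l.NeBot := curry_atTop_neBot
  have hPl : ∀ᶠ i in l, P i.1 i.2 :=
    eventually_curry_iff.2 (Eventually.of_forall hPev)
  let α : ∀ i : ℕ × ℕ, Gt → Matrix.unitaryGroup (Fin (d i.2) × Fin (D i.2)) ℂ :=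
    fun i g => kronConj (σ i.2 g) (ρ i.2 (q g))
  have hstar : ∀ {b : ℕ} (W : Matrix.unitaryGroup (Fin b) ℂ),
      (W.1).map star ∈ Matrix.unitaryGroup (Fin b) ℂ :=
    fun W => Matrix.map_star_mem_unitaryGroup_iff.2 W.2
  -- The maps `α` are not almost multiplicative in operator norm. They are so on `v i`, because its
  -- operator bound converts Hilbert–Schmidt defects of σ into vector norms.
  have hmul : ∀ g h, Tendsto (fun i => ‖(α i (g * h)).1 * v i - (α i g).1 * ((α i h).1 * v i)‖)
      l (𝓝 0) := by
    intro g h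
    have h1 := (tendsto_snd_curry (hσ.2 g h)).const_mul 2
    rw [mul_zero] at h1
    refine squeeze_zero' (Eventually.of_forall fun _ => norm_nonneg _) ?_ h1
    filter_upwards [hPl] with i hi
    have h2 := (hv i hi).2.1 ((σ i.2 (g * h)).1 - (σ i.2 g).1 * (σ i.2 h).1)
      ⟨_, hstar (ρ i.2 (q g * q h))⟩
    rw [← hsNorm_eq] at h2
    have h3 : (α i (g * h)).1 * v i - (α i g).1 * ((α i h).1 * v i) =
        (((σ i.2 (g * h)).1 - (σ i.2 g).1 * (σ i.2 h).1) ⊗ₖ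
          ((ρ i.2 (q g * q h)).1).map star) * v i := by
      have h4 : (α i g).1 * (α i h).1 = (kronConj (σ i.2 g * σ i.2 h) (ρ i.2 (q g * q h))).1 := by
        rw [map_mul, kronConj_mul]; rfl
      have h5 : (α i (g * h)).1 = (kronConj (σ i.2 (g * h)) (ρ i.2 (q g * q h))).1 := by
        rw [← map_mul]
      rw [← Matrix.mul_assoc, ← Matrix.sub_mul, h4, h5, kronConj_coe, kronConj_coe,
        ← kronecker_sub_left]
      rfl
    rw [h3]
    exact h2
  -- As `q z = 1`, the factor from ρ is the identity, so `z` acts on `v i` through σ alone, that is,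
  -- asymptotically by ω.
  have hzlim : Tendsto (fun i => ‖(α i z).1 * v i - ω • v i‖) l (𝓝 0) := by
    have h1 := (tendsto_snd_curry hσz).const_mul 2
    rw [mul_zero] at h1
    refine squeeze_zero' (Eventually.of_forall fun _ => norm_nonneg _) ?_ h1
    filter_upwards [hPl] with i hi
    have h2 := (hv i hi).2.1 ((σ i.2 z).1 - ω • 1) 1
    rw [← hsNorm_eq] at h2
    have h3 : (α i z).1 * v i - ω • v i = (((σ i.2 z).1 - ω • 1) ⊗ₖ
        (1 : Matrix.unitaryGroup (Fin (D i.2)) ℂ).1) * v i := by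
      have h4 : q z = 1 := by
        rw [← MonoidHom.mem_ker, hz]
        exact Subgroup.mem_zpowers z
      have h5 : ((1 : Matrix.unitaryGroup (Fin (D i.2)) ℂ).1).map star = 1 :=
        Matrix.map_one _ (star_zero _) (star_one _)
      have h6 : (α i z).1 = (σ i.2 z).1 ⊗ₖ (1 : Matrix (Fin (D i.2)) (Fin (D i.2)) ℂ) := by
        change (σ i.2 z).1 ⊗ₖ ((ρ i.2 (q z)).1).map star = _
        rw [h4, map_one, h5]
      rw [h6, kronecker_sub_left, Matrix.smul_kronecker, Matrix.sub_mul, Matrix.smul_mul]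
      simp
    rw [h3]
    exact h2
  have hTgen : Subgroup.closure (sec '' (S : Set G) ∪ {z}) = ⊤ := by
    set H := Subgroup.closure (sec '' (S : Set G) ∪ {z}) with hH
    have hker : q.ker ≤ H := by
      rw [hz, Subgroup.zpowers_le]
      exact Subgroup.subset_closure (Or.inr rfl)
    have hmap : H.map q = ⊤ := by
      rw [eq_top_iff, ← hgen, Subgroup.closure_le]
      intro s hs
      exact ⟨sec s, Subgroup.subset_closure (Or.inl ⟨s, hs, rfl⟩), hsec s⟩
    have h1 := Subgroup.comap_map_eq_self hker
    rw [hmap, Subgroup.comap_top] at h1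
    exact h1.symm
  have hblim : Tendsto (fun i : ℕ × ℕ =>
      2 * (2 * η i.2 + 4 * i.1 * η i.2 + √(4 * S.card) * (1 - gap / 2) ^ i.1)) l (𝓝 0) := by
    have hη0 : ∀ n, 0 ≤ η n := fun n => Finset.sum_nonneg fun _ _ => hsNorm_nonneg _
    have hb0 : ∀ k : ℕ, 0 ≤ √(4 * S.card) * (1 - gap / 2) ^ k := fun k =>
      mul_nonneg (Real.sqrt_nonneg _) (pow_nonneg (by linarith) k)
    rw [tendsto_order]
    constructor
    · intro a ha
      refine Eventually.of_forall fun i => ha.trans_le ?_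
      have h1 := hη0 i.2
      have h2 := hb0 i.1
      positivity
    · intro a ha
      refine eventually_curry_iff.2 ?_
      have h1 : Tendsto (fun k : ℕ => √(4 * S.card) * (1 - gap / 2) ^ k) atTop (𝓝 0) := by
        have := (tendsto_pow_atTop_nhds_zero_of_lt_one (show 0 ≤ 1 - gap / 2 by linarith)
          (by linarith)).const_mul √(4 * S.card)
        rwa [mul_zero] at this
      filter_upwards [h1.eventually_lt_const (show 0 < a / 4 by linarith)] with k hk
      have h2 : Tendsto (fun n => 2 * η n + 4 * k * η n) atTop (𝓝 (2 * 0 + 4 * k * 0)) :=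
        (hηlim.const_mul _).add (hηlim.const_mul _)
      filter_upwards [h2.eventually_lt_const
        (show 2 * 0 + 4 * (k : ℝ) * 0 < a / 4 by linarith)] with n hn
      linarith
  have heig : ∀ t ∈ sec '' (S : Set G) ∪ {z}, ∃ c : ℕ × ℕ → ℂ,
      Tendsto (fun i => ‖(α i t).1 * v i - c i • v i‖) l (𝓝 0) := by
    rintro t (⟨s, hs, rfl⟩ | rfl)
    · have h1 : ∀ i : ℕ × ℕ, ∃ c : ℂ, P i.1 i.2 → ‖(α i (sec s)).1 * v i - c • v i‖ ≤
          2 * (2 * η i.2 + 4 * i.1 * η i.2 + √(4 * S.card) * (1 - gap / 2) ^ i.1) := by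
        intro i
        by_cases hi : P i.1 i.2
        · obtain ⟨c, hc⟩ := (hv i hi).2.2 s hs
          refine ⟨c, fun _ => ?_⟩
          have h2 : α i (sec s) = kronConj (σ i.2 (sec s)) (ρ i.2 s) := by
            change kronConj _ (ρ i.2 (q (sec s))) = _
            rw [hsec]
          rw [h2]
          exact hc
        · exact ⟨0, fun h => absurd h hi⟩
      choose c hc using h1
      refine ⟨c, squeeze_zero' (Eventually.of_forall fun _ => norm_nonneg _) ?_ hblim⟩
      filter_upwards [hPl] with i hi using hc i hi
    · exact ⟨fun _ => ω, hzlim⟩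
  obtain ⟨U, hU, χ, hχ⟩ := exists_character_of_almost_eigenvector l α v
    (hPl.mono fun i hi => (hv i hi).1) hmul hTgen heig
  have hχz : χ z = ω := by
    have h1 := (hχ z).add (hzlim.mono_left hU)
    rw [add_zero] at h1
    have h2 : Tendsto (fun _ : ℕ × ℕ => ‖ω - χ z‖) (U : Filter (ℕ × ℕ)) (𝓝 0) := by
      refine squeeze_zero' (Eventually.of_forall fun _ => norm_nonneg _) ?_ h1
      filter_upwards [hU hPl] with i hi
      have h3 : ‖ω - χ z‖ = ‖(ω - χ z) • v i‖ := by rw [norm_smul, (hv i hi).1, mul_one]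
      have h4 : (ω - χ z) • v i = ((α i z).1 * v i - χ z • v i) - ((α i z).1 * v i - ω • v i) := by
        rw [sub_smul]
        abel
      rw [h3, h4]
      exact norm_sub_le _ _
    exact (sub_eq_zero.1 (norm_eq_zero.1 (tendsto_nhds_unique h2 tendsto_const_nhds).symm)).symm
  exact hωN (hχz ▸ character_pow_card_abelianization χ z)

end Contradiction

/-! ### Compression to an almost invariant subspace -/

section Compression

open scoped Matrix.Norms.Frobenius ComplexOrder

/-- Compressing almost multiplicative unitaries to an almost invariant subspace. -/
theorem exists_compression {G : Type*} [Group G] {d m : ℕ} (π : G → Matrix.unitaryGroup (Fin d) ℂ)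
    {W : Matrix (Fin d) (Fin m) ℂ} (hW : Wᴴ * W = 1) :
    ∃ σ : G → Matrix.unitaryGroup (Fin m) ℂ,
      (∀ g, ‖(σ g).1 - Wᴴ * (π g).1 * W‖ ≤ ‖W * Wᴴ * (π g).1 - (π g).1 * (W * Wᴴ)‖) ∧
      ∀ g h, ‖(σ (g * h)).1 - (σ g).1 * (σ h).1‖ ≤ ‖(π (g * h)).1 - (π g).1 * (π h).1‖ +
        ‖W * Wᴴ * (π (g * h)).1 - (π (g * h)).1 * (W * Wᴴ)‖ +
        ‖W * Wᴴ * (π g).1 - (π g).1 * (W * Wᴴ)‖ +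
        2 * ‖W * Wᴴ * (π h).1 - (π h).1 * (W * Wᴴ)‖ := by
  choose σ hσ using fun g => exists_unitary_norm_sub_le (Wᴴ * (π g).1 * W)
  have hσ' : ∀ g, ‖Wᴴ * (π g).1 * W - (σ g).1‖ ≤
      ‖W * Wᴴ * (π g).1 - (π g).1 * (W * Wᴴ)‖ := by
    intro g
    refine (hσ g).trans ?_
    -- The failure of the compression to be unitary is itself a compression of π(g)* times the
    -- commutator of the projection with π(g).
    have h1 : (Wᴴ * (π g).1 * W)ᴴ * (Wᴴ * (π g).1 * W) - 1 =
        Wᴴ * ((π g).1ᴴ * (W * Wᴴ * (π g).1 - (π g).1 * (W * Wᴴ))) * W := by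
      have h2 : (π g).1ᴴ * ((π g).1 * (W * Wᴴ)) = W * Wᴴ := by
        rw [← Matrix.mul_assoc, conjTranspose_mul_self_of_unitary, Matrix.one_mul]
      have h3 : Wᴴ * (W * Wᴴ) * W = 1 := by
        rw [← Matrix.mul_assoc, hW, Matrix.one_mul, hW]
      rw [Matrix.mul_sub, Matrix.mul_sub, Matrix.sub_mul, h2, h3]
      simp only [Matrix.conjTranspose_mul, Matrix.conjTranspose_conjTranspose, Matrix.mul_assoc]
    rw [h1]
    refine (norm_mul_isometry_le hW _).trans ((norm_isometry_conjTranspose_mul_le hW _).trans ?_)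
    rw [norm_unitary_conjTranspose_mul]
  refine ⟨σ, fun g => by rw [norm_sub_rev]; exact hσ' g, fun g h => ?_⟩
  have h1 : (σ (g * h)).1 - (σ g).1 * (σ h).1 =
      -(Wᴴ * (π (g * h)).1 * W - (σ (g * h)).1) +
      Wᴴ * ((π (g * h)).1 - (π g).1 * (π h).1) * W -
      Wᴴ * ((π g).1 * ((W * Wᴴ * (π h).1 - (π h).1 * (W * Wᴴ)) * W)) +
      (Wᴴ * ((π g).1 * (W * (Wᴴ * (π h).1 * W - (σ h).1))) +
      (Wᴴ * (π g).1 * W - (σ g).1) * (σ h).1) := by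
    have h2 : (π h).1 * (W * Wᴴ) * W = (π h).1 * W := by
      rw [Matrix.mul_assoc, Matrix.mul_assoc, hW, Matrix.mul_one]
    rw [Matrix.sub_mul _ _ W, h2]
    simp only [Matrix.mul_sub, Matrix.sub_mul, Matrix.mul_assoc]
    abel
  rw [h1]
  have n1 : ‖-(Wᴴ * (π (g * h)).1 * W - (σ (g * h)).1)‖ ≤ _ := (norm_neg _).trans_le (hσ' (g * h))
  have n2 : ‖Wᴴ * ((π (g * h)).1 - (π g).1 * (π h).1) * W‖ ≤ _ :=
    (norm_mul_isometry_le hW _).trans (norm_isometry_conjTranspose_mul_le hW _)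
  have n3 : ‖Wᴴ * ((π g).1 * ((W * Wᴴ * (π h).1 - (π h).1 * (W * Wᴴ)) * W))‖ ≤
      ‖W * Wᴴ * (π h).1 - (π h).1 * (W * Wᴴ)‖ := by
    refine (norm_isometry_conjTranspose_mul_le hW _).trans ?_
    rw [norm_unitary_mul]
    exact norm_mul_isometry_le hW _
  have n4 : ‖Wᴴ * ((π g).1 * (W * (Wᴴ * (π h).1 * W - (σ h).1)))‖ ≤
      ‖W * Wᴴ * (π h).1 - (π h).1 * (W * Wᴴ)‖ := by
    refine (norm_isometry_conjTranspose_mul_le hW _).trans ?_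
    rw [norm_unitary_mul, norm_isometry_mul hW]
    exact hσ' h
  have n5 : ‖(Wᴴ * (π g).1 * W - (σ g).1) * (σ h).1‖ ≤ _ :=
    (norm_mul_unitary _ _).trans_le (hσ' g)
  refine (norm_add_le _ _).trans ?_
  refine (add_le_add ((norm_sub_le _ _).trans (add_le_add (norm_add_le _ _) le_rfl))
    (norm_add_le _ _)).trans ?_
  linarith

end Compression

/-! ### Choosing a spectral cut -/

section Threshold

/-- A pigeonhole choice of a spectral threshold which cuts few matrix entries. -/
theorem exists_threshold {n ι : Type*} [Fintype n] (a : n → ℝ) (K : Finset ι)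
    (x : ι → n → n → ℝ) (hx : ∀ g i j, 0 ≤ x g i j) {t₀ : ℝ} (ht₀ : 0 < t₀) {L : ℕ} (hL : 0 < L) :
    ∃ t, t₀ ≤ t ∧ t ≤ 2 * t₀ ∧
      ∑ g ∈ K, ∑ i, ∑ j, (if (a i ≤ t ↔ a j ≤ t) then 0 else x g i j) ≤
        (∑ g ∈ K, ∑ i, ∑ j, x g i j) / L +
          (L / t₀) ^ 2 * ∑ g ∈ K, ∑ i, ∑ j, (a i - a j) ^ 2 * x g i j := by
  classical
  have hL' : (0 : ℝ) < L := by exact_mod_cast hL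
  -- `L` equally spaced candidates between `t₀` and `2 * t₀`; one that does no worse than the
  -- average is selected at the end.
  let t : ℕ → ℝ := fun r => t₀ + t₀ * r / L
  -- Eigenvalues closer than the spacing `t₀ / L` are separated by at most one candidate. Any other
  -- pair is separated by at most `L` of them, and the quadratic term then exceeds `L`.
  have hstrad : ∀ i j, ((Finset.range L).filter fun r => ¬ (a i ≤ t r ↔ a j ≤ t r)).card ≤
      1 + L * ((L / t₀) ^ 2 * (a i - a j) ^ 2) := by
    intro i j
    by_cases hw : (a i - a j) ^ 2 < (t₀ / L) ^ 2
    · have hcard : ((Finset.range L).filter fun r => ¬ (a i ≤ t r ↔ a j ≤ t r)).card ≤ 1 := by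
        have hstep : ∀ r r' : ℕ, r < r' → t r + t₀ / L ≤ t r' := by
          intro r r' hrr
          have h1 : (r : ℝ) + 1 ≤ r' := by exact_mod_cast hrr
          have h2 : t r' - t r = t₀ / L * (r' - r) := by simp only [t]; ring
          have h3 : 0 < t₀ / L := by positivity
          nlinarith
        have habs := abs_lt_of_sq_lt_sq hw (by positivity)
        rw [abs_lt] at habs
        have hno : ∀ r r' : ℕ, r < r' → ¬ (a i ≤ t r ↔ a j ≤ t r) →
            ¬ (a i ≤ t r' ↔ a j ≤ t r') → False := by
          intro r r' hrr h1 h2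
          have h3 := hstep r r' hrr
          have h4 : 0 < t₀ / L := by positivity
          by_cases hi : a i ≤ t r
          · have hj : t r < a j := by by_contra! h; exact h1 ⟨fun _ => h, fun _ => hi⟩
            have hj' : t r' < a j := by
              by_contra! h; exact h2 ⟨fun _ => h, fun _ => by linarith⟩
            linarith
          · have hj : a j ≤ t r := by
              by_contra! h; exact h1 ⟨fun h' => absurd h' hi, fun h' => absurd h' (not_le.2 h)⟩
            have hi' : t r' < a i := by
              by_contra! h; exact h2 ⟨fun _ => by linarith, fun _ => h⟩
            linarith
        rw [Finset.card_le_one]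
        intro r hr r' hr'
        simp only [Finset.mem_filter] at hr hr'
        rcases lt_trichotomy r r' with h | h | h
        · exact (hno r r' h hr.2 hr'.2).elim
        · exact h
        · exact (hno r' r h hr'.2 hr.2).elim
      have h1 : (((Finset.range L).filter fun r => ¬ (a i ≤ t r ↔ a j ≤ t r)).card : ℝ) ≤ 1 := by
        exact_mod_cast hcard
      have h2 : 0 ≤ L * ((L / t₀) ^ 2 * (a i - a j) ^ 2) := by positivity
      linarith
    · have h1 : (((Finset.range L).filter fun r => ¬ (a i ≤ t r ↔ a j ≤ t r)).card : ℝ) ≤ L := by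
        have := Finset.card_filter_le (Finset.range L) fun r => ¬ (a i ≤ t r ↔ a j ≤ t r)
        rw [Finset.card_range] at this
        exact_mod_cast this
      have h2 : 1 ≤ (L / t₀) ^ 2 * (a i - a j) ^ 2 := by
        have h3 : (L / t₀) ^ 2 * (t₀ / L) ^ 2 = 1 := by field_simp
        rw [← h3]
        exact mul_le_mul_of_nonneg_left (not_lt.1 hw) (by positivity)
      nlinarith
  have hsum : ∑ r ∈ Finset.range L,
      ∑ g ∈ K, ∑ i, ∑ j, (if (a i ≤ t r ↔ a j ≤ t r) then 0 else x g i j) ≤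
      ∑ r ∈ Finset.range L, ((∑ g ∈ K, ∑ i, ∑ j, x g i j) / L +
          (L / t₀) ^ 2 * ∑ g ∈ K, ∑ i, ∑ j, (a i - a j) ^ 2 * x g i j) := by
    rw [Finset.sum_const, Finset.card_range, nsmul_eq_mul, mul_add, mul_div_cancel₀ _ hL'.ne',
      Finset.mul_sum, Finset.mul_sum, ← Finset.sum_add_distrib, Finset.sum_comm]
    refine Finset.sum_le_sum fun g _ => ?_
    rw [Finset.mul_sum, Finset.mul_sum, ← Finset.sum_add_distrib, Finset.sum_comm]
    refine Finset.sum_le_sum fun i _ => ?_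
    rw [Finset.mul_sum, Finset.mul_sum, ← Finset.sum_add_distrib, Finset.sum_comm]
    refine Finset.sum_le_sum fun j _ => ?_
    have h1 : ∑ r ∈ Finset.range L, (if (a i ≤ t r ↔ a j ≤ t r) then 0 else x g i j) =
        ((Finset.range L).filter fun r => ¬ (a i ≤ t r ↔ a j ≤ t r)).card * x g i j := by
      rw [← nsmul_eq_mul, ← Finset.sum_const, Finset.sum_filter]
      refine Finset.sum_congr rfl fun r _ => ?_
      split_ifs <;> simp_all
    rw [h1]
    have h2 := mul_le_mul_of_nonneg_right (hstrad i j) (hx g i j)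
    linarith
  obtain ⟨r, hr, hle⟩ := Finset.exists_le_of_sum_le (Finset.nonempty_range_iff.2 hL.ne') hsum
  have hrL : (r : ℝ) / L ≤ 1 := by
    rw [div_le_one hL']
    exact_mod_cast (Finset.mem_range.1 hr).le
  refine ⟨t r, ?_, ?_, hle⟩
  · simp only [t]
    have : 0 ≤ t₀ * r / L := by positivity
    linarith
  · simp only [t]
    rw [mul_div_assoc]
    nlinarith

end Threshold

/-! ### Spectral mass from small moments -/

section Traces

open scoped Matrix.Norms.Frobenius ComplexOrder

variable {n : Type*} [Fintype n] [DecidableEq n]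

/-- The trace of `((u + ω)* (u + ω)) ^ N` as a trigonometric polynomial in `u`. -/
theorem trace_gram_pow (u : Matrix.unitaryGroup n ℂ) {ω : ℂ} (hω : ‖ω‖ = 1) (N : ℕ) :
    (((u.1 + ω • 1)ᴴ * (u.1 + ω • 1)) ^ N).trace =
      ∑ k ∈ Finset.range (2 * N + 1), ((2 * N).choose k : ℂ) *
        ((star ω ^ N * ω ^ (2 * N - k)) * ((u.1ᴴ) ^ N * u.1 ^ k).trace) := by
  have hωω : star ω * ω = 1 := by
    rw [Complex.star_def, Complex.conj_mul', hω]; norm_num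
  have hu := conjTranspose_mul_self_of_unitary u
  have hu' := mul_conjTranspose_self_of_unitary u
  -- On the unit circle |u + ω|² = conj(ω) conj(u) (u + ω)², so the `N`-th power expands by the
  -- binomial theorem.
  have h1 : (u.1 + ω • 1)ᴴ * (u.1 + ω • 1) = (star ω • u.1ᴴ) * (u.1 + ω • 1) ^ 2 := by
    have h2 : (u.1 + ω • 1)ᴴ = (star ω • u.1ᴴ) * (u.1 + ω • 1) := by
      rw [Matrix.mul_add, Matrix.smul_mul, hu, Matrix.smul_mul, Matrix.mul_smul, smul_smul, hωω,
        Matrix.mul_one, one_smul, Matrix.conjTranspose_add, Matrix.conjTranspose_smul,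
        Matrix.conjTranspose_one, add_comm]
    rw [h2, pow_two, Matrix.mul_assoc]
  have hc1 : Commute u.1ᴴ u.1 := by rw [Commute, SemiconjBy, hu, hu']
  have hc2 : Commute (star ω • u.1ᴴ) (u.1 + ω • 1) :=
    (hc1.add_right ((Commute.one_right _).smul_right ω)).smul_left _
  have hc3 : Commute u.1 (ω • (1 : Matrix n n ℂ)) := (Commute.one_right _).smul_right ω
  rw [h1, (hc2.pow_right 2).mul_pow, ← pow_mul, hc3.add_pow, Finset.mul_sum, Matrix.trace_sum]
  refine Finset.sum_congr rfl fun k _ => ?_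
  have h3 : (star ω • u.1ᴴ) ^ N *
      (u.1 ^ k * (ω • (1 : Matrix n n ℂ)) ^ (2 * N - k) * ((2 * N).choose k : Matrix n n ℂ)) =
      (((2 * N).choose k : ℂ) * (star ω ^ N * ω ^ (2 * N - k))) • ((u.1ᴴ) ^ N * u.1 ^ k) := by
    have h4 : ((2 * N).choose k : Matrix n n ℂ) = ((2 * N).choose k : ℂ) • 1 := by
      rw [← Algebra.algebraMap_eq_smul_one, map_natCast]
    rw [h4, smul_pow, smul_pow, one_pow]
    simp only [Matrix.smul_mul, Matrix.mul_smul, Matrix.mul_one, smul_smul]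
    congr 1
    ring
  rw [h3, Matrix.trace_smul, smul_eq_mul, mul_assoc]

/-- The product is `u ^ (k - N)`, or the adjoint of `u ^ (N - k)`, and the real part of the trace
does not see the adjoint. -/
theorem abs_re_trace_le {u : Matrix.unitaryGroup n ℂ} {N : ℕ} {t : ℝ}
    (ht : ∀ j, 1 ≤ j → j ≤ N → |((u.1) ^ j).trace.re| ≤ t) {k : ℕ} (hk : k ≤ 2 * N) (hkN : k ≠ N) :
    |((u.1ᴴ) ^ N * u.1 ^ k).trace.re| ≤ t := by
  have hu := conjTranspose_mul_self_of_unitary u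
  have hcancel : ∀ j, (u.1ᴴ) ^ j * u.1 ^ j = 1 := by
    intro j
    induction j with
    | zero => simp
    | succ j ih =>
      rw [pow_succ, pow_succ', Matrix.mul_assoc, ← Matrix.mul_assoc _ u.1, hu, Matrix.one_mul, ih]
  rcases lt_or_gt_of_ne hkN with h | h
  · obtain ⟨j, rfl⟩ := Nat.exists_eq_add_of_lt h
    have h1 : (u.1ᴴ) ^ (k + j + 1) * u.1 ^ k = (u.1 ^ (j + 1))ᴴ := by
      rw [add_assoc, add_comm k, pow_add, Matrix.mul_assoc, hcancel, Matrix.mul_one,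
        Matrix.conjTranspose_pow]
    rw [h1, Matrix.trace_conjTranspose, Complex.star_def, Complex.conj_re]
    exact ht _ (by omega) (by omega)
  · obtain ⟨j, rfl⟩ := Nat.exists_eq_add_of_lt h
    have h1 : (u.1ᴴ) ^ N * u.1 ^ (N + j + 1) = u.1 ^ (j + 1) := by
      rw [add_assoc, pow_add, ← Matrix.mul_assoc, hcancel, Matrix.one_mul]
    rw [h1]
    exact ht _ (by omega) (by omega)

/-- If the first moments of `u` have small real parts, then the spectral measure of `u` has
substantial mass near `ω` or near its conjugate. -/
theorem exists_trace_gram_pow_ge {d N : ℕ} (hN : 0 < N) (u : Matrix.unitaryGroup (Fin d) ℂ)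
    (ht : ∀ j, 1 ≤ j → j ≤ N → |((u.1) ^ j).trace.re| ≤ d / (4 * N)) {ω : ℂ} (hω : ‖ω‖ = 1) :
    ∃ ω', (ω' = ω ∨ ω' = star ω) ∧
      (4 : ℝ) ^ N * (d / (4 * N)) ≤ (((u.1 + ω' • 1)ᴴ * (u.1 + ω' • 1)) ^ N).trace.re := by
  have hN' : (0 : ℝ) < N := by exact_mod_cast hN
  have hωω : star ω * ω = 1 := by
    rw [Complex.star_def, Complex.conj_mul', hω]; norm_num
  have hω' : ‖star ω‖ = 1 := by rw [norm_star, hω]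
  -- Only real parts of the moments are controlled. Adding the expansions for ω and its conjugate
  -- replaces each coefficient `c k` by twice its real part, so both traces cannot be small.
  by_contra! hcon
  have h1 := hcon ω (Or.inl rfl)
  have h2 := hcon (star ω) (Or.inr rfl)
  rw [trace_gram_pow u hω] at h1
  rw [trace_gram_pow u hω'] at h2
  set T : ℕ → ℂ := fun k => ((u.1ᴴ) ^ N * u.1 ^ k).trace with hT
  set c : ℕ → ℂ := fun k => star ω ^ N * ω ^ (2 * N - k) with hc
  have hcn : ∀ k, ‖c k‖ = 1 := by
    intro k
    rw [hc, norm_mul, norm_pow, norm_pow, hω', hω, one_pow, one_pow, one_mul]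
  have hcN : c N = 1 := by
    have : 2 * N - N = N := by omega
    simp only [hc]
    rw [this, ← mul_pow, hωω, one_pow]
  have hTN : (T N).re = d := by
    have h3 : (u.1ᴴ) ^ N * u.1 ^ N = 1 := by
      have h4 : Commute u.1ᴴ u.1 := by
        rw [Commute, SemiconjBy, conjTranspose_mul_self_of_unitary,
          mul_conjTranspose_self_of_unitary]
      rw [← h4.mul_pow, conjTranspose_mul_self_of_unitary, one_pow]
    simp only [hT]
    rw [h3]
    simp
  have hadd : (∑ k ∈ Finset.range (2 * N + 1), ((2 * N).choose k : ℂ) * (c k * T k)).re +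
      (∑ k ∈ Finset.range (2 * N + 1), ((2 * N).choose k : ℂ) *
        ((star (star ω) ^ N * star ω ^ (2 * N - k)) * T k)).re =
      ∑ k ∈ Finset.range (2 * N + 1), ((2 * N).choose k : ℝ) * (2 * (c k).re * (T k).re) := by
    rw [Complex.re_sum, Complex.re_sum, ← Finset.sum_add_distrib]
    refine Finset.sum_congr rfl fun k _ => ?_
    have h3 : star (star ω) ^ N * star ω ^ (2 * N - k) = star (c k) := by
      simp only [hc, star_mul', star_pow]
    have h4 : ∀ x y : ℂ, (x * y).re + (star x * y).re = 2 * x.re * y.re := by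
      intro x y
      simp only [Complex.mul_re, Complex.star_def, Complex.conj_re, Complex.conj_im]
      ring
    rw [h3, ← Complex.ofReal_natCast, Complex.re_ofReal_mul, Complex.re_ofReal_mul, ← mul_add, h4]
  have hlow : ∑ k ∈ Finset.range (2 * N + 1), ((2 * N).choose k : ℝ) * (2 * (c k).re * (T k).re) ≥
      2 * (N.centralBinom * d) - 2 * (4 ^ N * (d / (4 * N))) := by
    have hchoose : ∑ k ∈ Finset.range (2 * N + 1), ((2 * N).choose k : ℝ) = 4 ^ N := by
      have := Nat.sum_range_choose (2 * N)
      rw [pow_mul] at this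
      exact_mod_cast this
    have hmem : N ∈ Finset.range (2 * N + 1) := Finset.mem_range.2 (by omega)
    rw [← Finset.add_sum_erase _ _ hmem, hcN, hTN, Nat.centralBinom]
    have h3 : ∑ k ∈ (Finset.range (2 * N + 1)).erase N,
        ((2 * N).choose k : ℝ) * (2 * (c k).re * (T k).re) ≥
        ∑ k ∈ (Finset.range (2 * N + 1)).erase N,
        -(2 * (((2 * N).choose k : ℝ) * (d / (4 * N)))) := by
      refine Finset.sum_le_sum fun k hk => ?_
      obtain ⟨hk1, hk2⟩ := Finset.mem_erase.1 hk
      have h4 := abs_re_trace_le ht (Nat.lt_succ_iff.1 (Finset.mem_range.1 hk2)) hk1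
      have h5 : |(c k).re| ≤ 1 := (Complex.abs_re_le_norm _).trans (hcn k).le
      have h6 : |(c k).re * (T k).re| ≤ d / (4 * N) := by
        rw [abs_mul]
        calc _ ≤ 1 * (d / (4 * N) : ℝ) := mul_le_mul h5 h4 (abs_nonneg _) zero_le_one
          _ = _ := one_mul _
      have h7 := (abs_le.1 h6).1
      have h8 : (0 : ℝ) ≤ ((2 * N).choose k : ℝ) := Nat.cast_nonneg _
      nlinarith
    have h9 : ∑ k ∈ (Finset.range (2 * N + 1)).erase N,
        -(2 * (((2 * N).choose k : ℝ) * (d / (4 * N)))) ≥ -(2 * (4 ^ N * (d / (4 * N)))) := by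
      rw [Finset.sum_neg_distrib, ← Finset.mul_sum, ← Finset.sum_mul, ← hchoose]
      have : ∑ k ∈ (Finset.range (2 * N + 1)).erase N, ((2 * N).choose k : ℝ) ≤
          ∑ k ∈ Finset.range (2 * N + 1), ((2 * N).choose k : ℝ) :=
        Finset.sum_le_sum_of_subset_of_nonneg (Finset.erase_subset _ _)
          fun _ _ _ => Nat.cast_nonneg _
      have h10 := mul_le_mul_of_nonneg_right this (show (0 : ℝ) ≤ d / (4 * N) by positivity)
      linarith
    simp only [Complex.one_re]
    linarith
  -- The central binomial coefficient is at least 4^N/(2N), so the term `k = N` outweighs all others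
  -- when the moments are at most d/(4N).
  have hcb : (4 : ℝ) ^ N ≤ 2 * N * N.centralBinom := by
    exact_mod_cast Nat.four_pow_le_two_mul_self_mul_centralBinom N hN
  have hfin : 4 ^ N * (d / (4 * N)) * 2 ≤ (N.centralBinom * d : ℝ) := by
    have h3 : (4 : ℝ) ^ N * (d / (4 * N)) * 2 = 4 ^ N * (d / (2 * N)) := by
      field_simp
      ring
    rw [h3, mul_div_assoc', div_le_iff₀ (by positivity)]
    nlinarith [mul_le_mul_of_nonneg_right hcb (Nat.cast_nonneg (α := ℝ) d)]
  linarith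

/-- A lower bound for the number of eigenvalues `≤ t`, when `4 - A` is positive with a large
moment. -/
theorem card_eigenvalues_le {d N : ℕ} (hN : 0 < N) (a : Fin d → ℝ) (ha : ∀ i, 0 ≤ a i ∧ a i ≤ 4)
    {t₀ t : ℝ} (htt : t₀ ≤ t)
    (hsmall : (1 - t₀ / 4) ^ N ≤ 1 / (8 * N))
    (hlow : (4 : ℝ) ^ N * (d / (4 * N)) ≤ ∑ i, (4 - a i) ^ N) :
    d / (8 * N) ≤ ((Finset.univ.filter fun i => a i ≤ t).card : ℝ) := by
  have hN' : (0 : ℝ) < N := by exact_mod_cast hN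
  -- Eigenvalues above `t` contribute at most 4^N/(8N) each, together at most half of the lower
  -- bound; the other half must come from eigenvalues below.
  have h1 : ∑ i, (4 - a i) ^ N ≤
      4 ^ N * (Finset.univ.filter fun i => a i ≤ t).card + 4 ^ N * (d / (8 * N)) := by
    calc ∑ i, (4 - a i) ^ N ≤ ∑ i, ((if a i ≤ t then (4 : ℝ) ^ N else 0) + (4 : ℝ) ^ N * (1 / (8 * N))) := by
          refine Finset.sum_le_sum fun i _ => ?_
          obtain ⟨h0, h4⟩ := ha i
          split_ifs with h
          · have := pow_le_pow_left₀ (by linarith) (show 4 - a i ≤ 4 by linarith) N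
            have h5 : (0 : ℝ) ≤ 4 ^ N * (1 / (8 * N)) := by positivity
            linarith
          · have h5 := pow_le_pow_left₀ (by linarith) (show 4 - a i ≤ 4 * (1 - t₀ / 4) by
              push Not at h; linarith) N
            rw [mul_pow] at h5
            have h6 := mul_le_mul_of_nonneg_left hsmall (show (0 : ℝ) ≤ 4 ^ N by positivity)
            linarith
      _ = _ := by
          rw [Finset.sum_add_distrib, ← Finset.sum_filter, Finset.sum_const, Finset.sum_const,
            Finset.card_univ, Fintype.card_fin, nsmul_eq_mul, nsmul_eq_mul]
          ring
  have h2 : (0 : ℝ) < 4 ^ N := by positivity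
  have h3 : (4 : ℝ) ^ N * (d / (4 * N)) = 4 ^ N * (d / (8 * N)) + 4 ^ N * (d / (8 * N)) := by
    field_simp
    ring
  have h4 : (4 : ℝ) ^ N * (d / (8 * N)) ≤ 4 ^ N * (Finset.univ.filter fun i => a i ≤ t).card := by
    linarith
  exact le_of_mul_le_mul_left h4 h2

end Traces

/-! ### Almost invariant spectral subspaces -/

section Corner

open scoped Matrix.Norms.Frobenius ComplexOrder

/-- The columns of the identity matrix which belong to `I`. -/
noncomputable def selectCols {d : ℕ} (I : Finset (Fin d)) : Matrix (Fin d) (Fin I.card) ℂ :=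
  Matrix.of fun i k => if i = I.equivFin.symm k then 1 else 0

theorem selectCols_isometry {d : ℕ} (I : Finset (Fin d)) :
    (selectCols I)ᴴ * selectCols I = 1 := by
  ext k k'
  rw [Matrix.mul_apply, Finset.sum_eq_single (I.equivFin.symm k : Fin d)]
  · simp only [selectCols, Matrix.conjTranspose_apply, Matrix.of_apply, if_true, star_one, one_mul,
      Matrix.one_apply, Subtype.coe_inj, EmbeddingLike.apply_eq_iff_eq]
  · intro b _ hb
    simp [selectCols, hb]
  · simp

theorem selectCols_mul_conjTranspose {d : ℕ} (I : Finset (Fin d)) :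
    selectCols I * (selectCols I)ᴴ = Matrix.diagonal fun i => if i ∈ I then 1 else 0 := by
  ext i j
  rw [Matrix.mul_apply, Matrix.diagonal_apply]
  simp only [selectCols, Matrix.conjTranspose_apply, Matrix.of_apply]
  by_cases hi : i ∈ I
  · rw [Finset.sum_eq_single (I.equivFin ⟨i, hi⟩)]
    · simp [hi, apply_ite, eq_comm]
    · intro k _ hk
      have : i ≠ I.equivFin.symm k := by
        intro h
        apply hk
        rw [← I.equivFin.symm_apply_eq]
        exact Subtype.ext h.symm
      simp [this]
    · simp
  · rw [Finset.sum_eq_zero]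
    · simp [hi]
    · intro k _
      have : i ≠ I.equivFin.symm k := by
        rintro rfl
        exact hi (I.equivFin.symm k).2
      simp [this]

theorem norm_diagonal_commutator_sq {n : Type*} [Fintype n] [DecidableEq n] (a : n → ℂ)
    (x : Matrix n n ℂ) : ‖Matrix.diagonal a * x - x * Matrix.diagonal a‖ ^ 2 =
      ∑ i, ∑ j, ‖a i - a j‖ ^ 2 * ‖x i j‖ ^ 2 := by
  rw [frobenius_norm_sq]
  refine Finset.sum_congr rfl fun i _ => Finset.sum_congr rfl fun j _ => ?_
  rw [Matrix.sub_apply, Matrix.diagonal_mul, Matrix.mul_diagonal, mul_comm (x i j), ← sub_mul,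
    norm_mul, mul_pow]

theorem norm_conj_commutator {n : Type*} [Fintype n] [DecidableEq n] (V : Matrix.unitaryGroup n ℂ)
    (D g : Matrix n n ℂ) :
    ‖V.1 * D * V.1ᴴ * g - g * (V.1 * D * V.1ᴴ)‖ =
      ‖D * (V.1ᴴ * g * V.1) - V.1ᴴ * g * V.1 * D‖ := by
  rw [← norm_unitary_conjTranspose_mul V, ← norm_mul_unitary V]
  have h := conjTranspose_mul_self_of_unitary V
  congr 1
  have h1 : ∀ X : Matrix n n ℂ, V.1ᴴ * (V.1 * X) = X := fun X => by
    rw [← Matrix.mul_assoc, h, Matrix.one_mul]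
  simp only [Matrix.mul_sub, Matrix.sub_mul, Matrix.mul_assoc, h1, h, Matrix.mul_one]

/-- |u - ω|² = 2 - conj(ω) u - ω u*, and [u*, g] = -u* [u, g] u* has the same norm as [u, g]. -/
theorem norm_gram_commutator_le {n : Type*} [Fintype n] [DecidableEq n]
    (u : Matrix.unitaryGroup n ℂ) {ω : ℂ} (hω : ‖ω‖ = 1) (g : Matrix n n ℂ) :
    ‖(u.1 - ω • 1)ᴴ * (u.1 - ω • 1) * g - g * ((u.1 - ω • 1)ᴴ * (u.1 - ω • 1))‖ ≤
      2 * ‖u.1 * g - g * u.1‖ := by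
  have hωω : star ω * ω = 1 := by
    rw [Complex.star_def, Complex.conj_mul', hω]; norm_num
  have hu := conjTranspose_mul_self_of_unitary u
  have hu' := mul_conjTranspose_self_of_unitary u
  have h1 : (u.1 - ω • 1)ᴴ * (u.1 - ω • 1) = (2 : ℂ) • 1 - star ω • u.1 - ω • u.1ᴴ := by
    rw [Matrix.conjTranspose_sub, Matrix.conjTranspose_smul, Matrix.conjTranspose_one,
      Matrix.sub_mul, Matrix.mul_sub, Matrix.mul_sub, hu, Matrix.mul_smul, Matrix.mul_one,
      Matrix.smul_mul, Matrix.one_mul, Matrix.smul_mul, Matrix.one_mul, smul_smul, hωω, one_smul]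
    module
  have h2 : (u.1 - ω • 1)ᴴ * (u.1 - ω • 1) * g - g * ((u.1 - ω • 1)ᴴ * (u.1 - ω • 1)) =
      ω • (u.1ᴴ * (u.1 * g - g * u.1) * u.1ᴴ) - star ω • (u.1 * g - g * u.1) := by
    have h3 : u.1ᴴ * (u.1 * g - g * u.1) * u.1ᴴ = g * u.1ᴴ - u.1ᴴ * g := by
      rw [Matrix.mul_sub, Matrix.sub_mul, ← Matrix.mul_assoc, hu, Matrix.one_mul,
        Matrix.mul_assoc, Matrix.mul_assoc, hu', Matrix.mul_one]
    rw [h3, h1]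
    simp only [Matrix.sub_mul, Matrix.mul_sub, Matrix.smul_mul, Matrix.mul_smul, Matrix.one_mul,
      Matrix.mul_one, smul_sub]
    abel
  rw [h2]
  refine (norm_sub_le _ _).trans_eq ?_
  rw [norm_smul, norm_smul, norm_star, hω, norm_mul_unitary_conjTranspose,
    norm_unitary_conjTranspose_mul]
  ring

/-- A unitary `u` with small first moments, which almost commutes with given unitaries, has an
almost invariant spectral subspace of substantial dimension on which it is almost scalar. -/
theorem exists_corner {G : Type*} {d N L : ℕ} (hd : 0 < d) (hN : 0 < N) (hL : 0 < L)
    (π : G → Matrix.unitaryGroup (Fin d) ℂ) (u : Matrix.unitaryGroup (Fin d) ℂ) {ω : ℂ}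
    (hω : ‖ω‖ = 1) {t₀ : ℝ} (ht₀ : 0 < t₀) (hsmall : (1 - t₀ / 4) ^ N ≤ 1 / (8 * N))
    (hmom : ∀ j, 1 ≤ j → j ≤ N → |((u.1) ^ j).trace.re| ≤ d / (4 * N)) (K : Finset G) {κ : ℝ}
    (hκ : ∀ g ∈ K, ‖u.1 * (π g).1 - (π g).1 * u.1‖ ^ 2 ≤ κ * d) :
    ∃ (ω' : ℂ) (m : ℕ) (W : Matrix (Fin d) (Fin m) ℂ), (ω' = ω ∨ ω' = star ω) ∧ 0 < m ∧
      Wᴴ * W = 1 ∧ (d : ℝ) / (8 * N) ≤ m ∧ ‖(u.1 - ω' • 1) * W‖ ^ 2 ≤ 2 * t₀ * m ∧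
      ∀ g ∈ K, ‖W * Wᴴ * (π g).1 - (π g).1 * (W * Wᴴ)‖ ^ 2 ≤
        K.card * (1 / L + (L / t₀) ^ 2 * (4 * κ)) * d := by
  obtain ⟨ω', hωor, htr⟩ := exists_trace_gram_pow_ge hN u hmom hω
  have hω'1 : ‖ω'‖ = 1 := by
    rcases hωor with rfl | rfl
    · exact hω
    · rw [norm_star, hω]
  have hωω : star ω' * ω' = 1 := by
    rw [Complex.star_def, Complex.conj_mul', hω'1]; norm_num
  have hd' : (0 : ℝ) < d := by exact_mod_cast hd
  have hN' : (0 : ℝ) < N := by exact_mod_cast hN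
  set A := (u.1 - ω' • 1)ᴴ * (u.1 - ω' • 1) with hAdef
  have hpsd : A.PosSemidef := Matrix.posSemidef_conjTranspose_mul_self _
  have hA := hpsd.isHermitian
  obtain ⟨V, hV⟩ : ∃ V : Matrix.unitaryGroup (Fin d) ℂ, V = hA.eigenvectorUnitary := ⟨_, rfl⟩
  set a := hA.eigenvalues with ha
  have ha0 : ∀ i, 0 ≤ a i := hpsd.eigenvalues_nonneg
  have hV1 := conjTranspose_mul_self_of_unitary V
  have hV2 := mul_conjTranspose_self_of_unitary V
  have hspec : A = V.1 * Matrix.diagonal (fun i => (a i : ℂ)) * V.1ᴴ := by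
    have := hA.spectral_theorem
    rw [Unitary.conjStarAlgAut_apply, ← hV] at this
    exact this
  -- By the parallelogram identity |u + ω'|² = 4 - |u - ω'|². High moments of the former therefore
  -- count eigenvalues of `u` near ω'.
  have hB : (u.1 + ω' • 1)ᴴ * (u.1 + ω' • 1) =
      V.1 * Matrix.diagonal (fun i => ((4 - a i : ℝ) : ℂ)) * V.1ᴴ := by
    have h1 : (u.1 + ω' • 1)ᴴ * (u.1 + ω' • 1) = (4 : ℂ) • 1 - A := by
      have hu := conjTranspose_mul_self_of_unitary u
      have hone : (star ω' • (1 : Matrix (Fin d) (Fin d) ℂ)) * (ω' • 1) = 1 := by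
        rw [Matrix.smul_mul, Matrix.one_mul, smul_smul, hωω, one_smul]
      rw [hAdef, Matrix.conjTranspose_sub, Matrix.conjTranspose_add, Matrix.conjTranspose_smul,
        Matrix.conjTranspose_one]
      simp only [Matrix.add_mul, Matrix.mul_add, Matrix.sub_mul, Matrix.mul_sub, hone, hu]
      module
    have h2 : Matrix.diagonal (fun i => ((4 - a i : ℝ) : ℂ)) =
        (4 : ℂ) • 1 - Matrix.diagonal (fun i => (a i : ℂ)) := by
      rw [← Matrix.diagonal_one, ← Matrix.diagonal_smul, Matrix.diagonal_sub]
      congr 1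
      ext i
      simp
    rw [h1, h2, Matrix.mul_sub, Matrix.sub_mul, ← hspec, Matrix.mul_smul, Matrix.mul_one,
      Matrix.smul_mul, hV2]
  have ha4 : ∀ i, a i ≤ 4 := by
    intro i
    have h1 : ((u.1 + ω' • 1)ᴴ * (u.1 + ω' • 1)).PosSemidef :=
      Matrix.posSemidef_conjTranspose_mul_self _
    have h2 := h1.conjTranspose_mul_mul_same V.1
    have h3 : V.1ᴴ * ((u.1 + ω' • 1)ᴴ * (u.1 + ω' • 1)) * V.1 =
        Matrix.diagonal (fun i => ((4 - a i : ℝ) : ℂ)) := by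
      rw [hB, Matrix.mul_assoc V.1, ← Matrix.mul_assoc V.1ᴴ, hV1, Matrix.one_mul, Matrix.mul_assoc,
        hV1, Matrix.mul_one]
    rw [h3] at h2
    have h4 := h2.diag_nonneg (i := i)
    rw [Matrix.diagonal_apply_eq] at h4
    have h5 : 0 ≤ 4 - a i := by exact_mod_cast h4
    linarith
  have htr' : (4 : ℝ) ^ N * (d / (4 * N)) ≤ ∑ i, (4 - a i) ^ N := by
    refine htr.trans_eq ?_
    rw [hB, conj_diagonal_pow hV1, Matrix.mul_assoc, Matrix.trace_mul_comm, Matrix.mul_assoc, hV1,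
      Matrix.mul_one, Matrix.trace_diagonal]
    simp only [← Complex.ofReal_pow, ← Complex.ofReal_sum, Complex.ofReal_re]
  obtain ⟨t, ht1, ht2, hcut⟩ := exists_threshold a K
    (fun g i j => ‖(V.1ᴴ * (π g).1 * V.1) i j‖ ^ 2) (fun _ _ _ => by positivity) ht₀ hL
  set I := Finset.univ.filter fun i => a i ≤ t with hI
  have hcard := card_eigenvalues_le hN a (fun i => ⟨ha0 i, ha4 i⟩) ht1 hsmall htr'
  have hE := selectCols_isometry I
  refine ⟨ω', I.card, V.1 * selectCols I, hωor, ?_, ?_, hcard, ?_, fun g hg => ?_⟩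
  · have : (0 : ℝ) < I.card := lt_of_lt_of_le (by positivity) hcard
    exact_mod_cast this
  · rw [Matrix.conjTranspose_mul, Matrix.mul_assoc, ← Matrix.mul_assoc V.1ᴴ, hV1, Matrix.one_mul,
      hE]
  · have h1 := trace_conj_diagonal_re V.1 a (V.1 * selectCols I)
    rw [← hspec, ← Matrix.mul_assoc V.1ᴴ, hV1, Matrix.one_mul] at h1
    have h2 : ‖(u.1 - ω' • 1) * (V.1 * selectCols I)‖ ^ 2 =
        ((V.1 * selectCols I)ᴴ * (A * (V.1 * selectCols I))).trace.re := by
      rw [frobenius_norm_sq_eq_trace, Matrix.conjTranspose_mul]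
      simp only [hAdef, Matrix.mul_assoc]
    rw [h2, h1]
    calc ∑ i, a i * ∑ j, ‖selectCols I i j‖ ^ 2 ≤
          ∑ i, (2 * t₀) * ∑ j, ‖selectCols I i j‖ ^ 2 := by
          refine Finset.sum_le_sum fun i _ => ?_
          by_cases hi : i ∈ I
          · refine mul_le_mul_of_nonneg_right ?_ (by positivity)
            exact (Finset.mem_filter.1 hi).2.trans ht2
          · have h3 : ∑ j, ‖selectCols I i j‖ ^ 2 = 0 := by
              refine Finset.sum_eq_zero fun k _ => ?_
              have : i ≠ I.equivFin.symm k := by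
                rintro rfl
                exact hi (I.equivFin.symm k).2
              simp [selectCols, this]
            rw [h3, mul_zero, mul_zero]
      _ = 2 * t₀ * I.card := by
          rw [← Finset.mul_sum, ← frobenius_norm_sq, ← Matrix.mul_one (selectCols I),
            norm_isometry_mul hE, frobenius_norm_one_sq, Fintype.card_fin]
  · have hsumx : ∀ g, ∑ i, ∑ j, ‖(V.1ᴴ * (π g).1 * V.1) i j‖ ^ 2 = d := by
      intro g
      rw [← frobenius_norm_sq, norm_mul_unitary, norm_unitary_conjTranspose_mul, norm_unitary,
        Real.sq_sqrt (Nat.cast_nonneg _), Fintype.card_fin]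
    have hcomm : ∀ g ∈ K, ∑ i, ∑ j, (a i - a j) ^ 2 * ‖(V.1ᴴ * (π g).1 * V.1) i j‖ ^ 2 ≤
        4 * κ * d := by
      intro g hg
      have h1 := norm_diagonal_commutator_sq (fun i => (a i : ℂ)) (V.1ᴴ * (π g).1 * V.1)
      rw [← norm_conj_commutator, ← hspec] at h1
      have h2 : ∑ i, ∑ j, (a i - a j) ^ 2 * ‖(V.1ᴴ * (π g).1 * V.1) i j‖ ^ 2 =
          ∑ i, ∑ j, ‖(a i : ℂ) - a j‖ ^ 2 * ‖(V.1ᴴ * (π g).1 * V.1) i j‖ ^ 2 := by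
        refine Finset.sum_congr rfl fun i _ => Finset.sum_congr rfl fun j _ => ?_
        rw [← Complex.ofReal_sub, Complex.norm_real, Real.norm_eq_abs, sq_abs]
      rw [h2, ← h1]
      have h3 := norm_gram_commutator_le u hω'1 (π g).1
      have h4 := pow_le_pow_left₀ (norm_nonneg _) h3 2
      rw [mul_pow] at h4
      have h5 := hκ g hg
      refine h4.trans ?_
      linarith
    -- In the eigenbasis, commuting with the spectral projection keeps exactly the matrix entries
    -- whose two eigenvalues lie on opposite sides of `t`.
    have hg1 : ‖V.1 * selectCols I * (V.1 * selectCols I)ᴴ * (π g).1 -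
        (π g).1 * (V.1 * selectCols I * (V.1 * selectCols I)ᴴ)‖ ^ 2 =
        ∑ i, ∑ j, (if (a i ≤ t ↔ a j ≤ t) then 0 else ‖(V.1ᴴ * (π g).1 * V.1) i j‖ ^ 2) := by
      have h1 : V.1 * selectCols I * (V.1 * selectCols I)ᴴ =
          V.1 * Matrix.diagonal (fun i => if i ∈ I then 1 else 0) * V.1ᴴ := by
        rw [Matrix.conjTranspose_mul, ← selectCols_mul_conjTranspose]
        simp only [Matrix.mul_assoc]
      rw [h1, norm_conj_commutator, norm_diagonal_commutator_sq]
      refine Finset.sum_congr rfl fun i _ => Finset.sum_congr rfl fun j _ => ?_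
      have h2 : ∀ i, i ∈ I ↔ a i ≤ t := fun i => by simp [hI]
      simp only [h2]
      by_cases hi : a i ≤ t <;> by_cases hj : a j ≤ t <;> simp [hi, hj]
    rw [hg1]
    refine (Finset.single_le_sum (f := fun g => ∑ i, ∑ j, (if (a i ≤ t ↔ a j ≤ t) then (0 : ℝ) else
      ‖(V.1ᴴ * (π g).1 * V.1) i j‖ ^ 2)) (fun g _ => Finset.sum_nonneg fun i _ =>
        Finset.sum_nonneg fun j _ => by split_ifs <;> positivity) hg).trans (hcut.trans ?_)
    have h1 : ∑ g ∈ K, ∑ i, ∑ j, ‖(V.1ᴴ * (π g).1 * V.1) i j‖ ^ 2 = K.card * d := by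
      simp only [hsumx, Finset.sum_const, nsmul_eq_mul]
    have h2 := Finset.sum_le_card_nsmul K _ _ hcomm
    rw [nsmul_eq_mul] at h2
    have h3 := mul_le_mul_of_nonneg_left h2 (show (0 : ℝ) ≤ (L / t₀) ^ 2 by positivity)
    rw [h1]
    refine (add_le_add le_rfl h3).trans_eq ?_
    ring

end Corner

/-! ### Asymptotic representations with prescribed central scalar -/

section Cut

open scoped Matrix.Norms.Frobenius ComplexOrder

variable {G : Type*} [Group G]

theorem hsNorm_unitary_sub_one_sq {d : ℕ} (hd : 0 < d) (U : Matrix.unitaryGroup (Fin d) ℂ) :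
    hsNorm (U.1 - 1) ^ 2 = 2 - 2 * (U.1.trace.re / d) := by
  have hd' : (0 : ℝ) < d := by exact_mod_cast hd
  have h1 : (U.1 - 1)ᴴ * (U.1 - 1) = 1 + 1 - (U.1 + U.1ᴴ) := by
    rw [Matrix.conjTranspose_sub, Matrix.conjTranspose_one, Matrix.sub_mul, Matrix.mul_sub,
      Matrix.mul_one, Matrix.one_mul, conjTranspose_mul_self_of_unitary]
    abel
  rw [hsNorm_eq, div_pow, Real.sq_sqrt hd'.le, frobenius_norm_sq_eq_trace, h1, Matrix.trace_sub,
    Matrix.trace_add, Matrix.trace_add, Matrix.trace_conjTranspose, Matrix.trace_one]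
  simp
  field_simp
  ring

theorem IsAsymptoticRep.tendsto_pow {d : ℕ → ℕ} {π : ∀ k, G → Matrix.unitaryGroup (Fin (d k)) ℂ}
    (hπ : IsAsymptoticRep d π) (z : G) (j : ℕ) :
    Tendsto (fun k => hsNorm ((π k (z ^ j)).1 - (π k z).1 ^ j)) atTop (𝓝 0) := by
  induction j with
  | zero =>
    -- The case `j = 0` says that `π k 1` tends to the identity, which follows from multiplicativity
    -- at (1, 1).
    refine (hπ.2 1 1).congr fun k => ?_
    have h1 : (π k (1 * 1)).1 - (π k 1).1 * (π k 1).1 = (π k 1).1 * (1 - (π k 1).1) := by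
      rw [Matrix.mul_sub, Matrix.mul_one, one_mul]
    rw [h1, hsNorm_unitary_mul, hsNorm_sub_comm, _root_.pow_zero, _root_.pow_zero]
  | succ j ih =>
    have h := (hπ.2 (z ^ j) z).add ih
    rw [add_zero] at h
    refine squeeze_zero (fun _ => hsNorm_nonneg _) (fun k => ?_) h
    rw [_root_.pow_succ, _root_.pow_succ]
    refine (hsNorm_sub_le _ ((π k (z ^ j)).1 * (π k z).1) _).trans
      (add_le_add le_rfl (le_of_eq ?_))
    rw [← Matrix.sub_mul, hsNorm_mul_unitary]

/-- In an asymptotically regular representation, elements of infinite order have asymptotically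
vanishing moments. -/
theorem IsAsymptoticRep.tendsto_trace_pow {d : ℕ → ℕ}
    {π : ∀ k, G → Matrix.unitaryGroup (Fin (d k)) ℂ} (hπ : IsAsymptoticRep d π) {z : G} {j : ℕ}
    (hz : Tendsto (fun k => hsNorm ((π k (z ^ j)).1 - (π k 1).1)) atTop (𝓝 √2)) :
    Tendsto (fun k => ((π k z).1 ^ j).trace.re / d k) atTop (𝓝 0) := by
  have h0 := hπ.tendsto_pow z 0
  have h1 := (hπ.tendsto_pow z j).add h0
  rw [add_zero] at h1
  have h2 : Tendsto (fun k => hsNorm ((π k z).1 ^ j - 1)) atTop (𝓝 √2) := by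
    refine tendsto_of_tendsto_of_dist hz (squeeze_zero (fun _ => dist_nonneg) (fun k => ?_) h1)
    rw [Real.dist_eq, abs_le, _root_.pow_zero, _root_.pow_zero]
    have e1 := hsNorm_sub_le (π k (z ^ j)).1 ((π k z).1 ^ j) (π k 1).1
    have e2 := hsNorm_sub_le ((π k z).1 ^ j) 1 (π k 1).1
    have e3 := hsNorm_sub_le ((π k z).1 ^ j) (π k (z ^ j)).1 1
    have e4 := hsNorm_sub_le (π k (z ^ j)).1 (π k 1).1 1
    rw [hsNorm_sub_comm 1] at e2
    rw [hsNorm_sub_comm _ (π k (z ^ j)).1] at e3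
    constructor <;> linarith
  have h3 : Tendsto (fun k => 1 - hsNorm ((π k z).1 ^ j - 1) ^ 2 / 2) atTop
      (𝓝 (1 - √2 ^ 2 / 2)) := ((h2.pow 2).div_const 2).const_sub 1
  have h4 : (1 : ℝ) - √2 ^ 2 / 2 = 0 := by
    rw [Real.sq_sqrt (by norm_num)]; norm_num
  rw [h4] at h3
  refine h3.congr fun k => ?_
  have h5 := hsNorm_unitary_sub_one_sq (hπ.1 k) (π k z ^ j)
  rw [SubmonoidClass.coe_pow] at h5
  rw [h5]
  ring

/-- Cutting down to an almost spectral subspace of a central element. -/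
theorem IsAsymptoticRep.exists_isAlmostRep_near_scalar {d : ℕ → ℕ}
    {π : ∀ k, G → Matrix.unitaryGroup (Fin (d k)) ℂ} (hπ : IsAsymptoticRep d π) {z : G}
    (hcen : ∀ g, z * g = g * z)
    (hmom : ∀ j : ℕ, 1 ≤ j → Tendsto (fun k => ((π k z).1 ^ j).trace.re / d k) atTop (𝓝 0))
    {ω : ℂ} (hω : ‖ω‖ = 1) (K : Finset G) {δ : ℝ} (hδ : 0 < δ) :
    ∃ (ω' : ℂ) (m : ℕ) (σ : G → Matrix.unitaryGroup (Fin m) ℂ), (ω' = ω ∨ ω' = star ω) ∧ 0 < m ∧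
      IsAlmostRep K δ σ ∧ hsNorm ((σ z).1 - ω' • 1) < δ := by
  classical
  -- The constants are chosen in the order `t₀`, `N`, `B`, `L`, `κ`, and only then the index `k`.
  -- Here `2 * t₀ ≤ (δ / 4) ^ 2` makes the corner scalar up to δ/4.
  obtain ⟨t₀, ht₀, ht₀1, ht₀δ⟩ : ∃ t₀ : ℝ, 0 < t₀ ∧ t₀ ≤ 1 ∧ t₀ ≤ δ ^ 2 / 32 :=
    ⟨min 1 (δ ^ 2 / 32), by positivity, min_le_left _ _, min_le_right _ _⟩
  obtain ⟨N, hN, hsmall⟩ : ∃ N : ℕ, 0 < N ∧ (1 - t₀ / 4) ^ N ≤ 1 / (8 * N) := by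
    have h := (tendsto_self_mul_const_pow_of_lt_one (show 0 ≤ 1 - t₀ / 4 by linarith)
      (by linarith)).eventually_lt_const (show (0 : ℝ) < 1 / 8 by norm_num)
    obtain ⟨N, hN1, hN2⟩ := (h.and (eventually_gt_atTop 0)).exists
    refine ⟨N, hN2, ?_⟩
    have hN3 : (0 : ℝ) < N := by exact_mod_cast hN2
    rw [le_div_iff₀ (by positivity)]
    linarith
  have hN' : (0 : ℝ) < N := by exact_mod_cast hN
  set K' := insert z (K ∪ (K ×ˢ K).image fun p => p.1 * p.2) with hK'
  -- The corner may have dimension only d/(8N); `B` absorbs this loss, so that commutators are at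
  -- most δ/16 on the scale of the corner.
  obtain ⟨B, hB0, hB⟩ : ∃ B : ℝ, 0 < B ∧ B * (8 * N) = (δ / 16) ^ 2 :=
    ⟨(δ / 16) ^ 2 / (8 * N), by positivity, by field_simp⟩
  obtain ⟨L, hL⟩ := exists_nat_gt (2 * K'.card / B)
  have hL0 : (0 : ℝ) < L := lt_of_le_of_lt (by positivity) hL
  rw [div_lt_iff₀ hB0] at hL
  obtain ⟨κ, hκ0, hκ⟩ : ∃ κ : ℝ, 0 < κ ∧ (K'.card + 1) * ((L / t₀) ^ 2 * (4 * κ)) = B / 2 :=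
    ⟨B / (8 * (K'.card + 1) * (L / t₀) ^ 2), by positivity, by field_simp; norm_num⟩
  have hKB : K'.card * (1 / L + (L / t₀) ^ 2 * (4 * κ)) ≤ B := by
    have h1 : K'.card * (1 / (L : ℝ)) ≤ B / 2 := by
      rw [mul_one_div, div_le_iff₀ hL0]
      linarith
    have h2 : 0 ≤ (L / t₀) ^ 2 * (4 * κ) := by positivity
    rw [mul_add]
    linarith
  set Λ := √(8 * N : ℝ) with hΛ
  have hΛ0 : 0 < Λ := Real.sqrt_pos.2 (by positivity)
  have hev1 : ∀ᶠ k in atTop, ∀ j ∈ Finset.Icc 1 N,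
      |((π k z).1 ^ j).trace.re / d k| < 1 / (4 * N) := by
    refine (Finset.eventually_all _).2 fun j hj => ?_
    have h1 := (hmom j (Finset.mem_Icc.1 hj).1).abs
    rw [abs_zero] at h1
    exact h1.eventually_lt_const (by positivity)
  have hev2 : ∀ᶠ k in atTop, ∀ g ∈ K',
      hsNorm ((π k z).1 * (π k g).1 - (π k g).1 * (π k z).1) < √κ := by
    refine (Finset.eventually_all _).2 fun g _ => ?_
    have h1 := (hπ.2 z g).add (hπ.2 g z)
    rw [add_zero] at h1
    filter_upwards [h1.eventually_lt_const (Real.sqrt_pos.2 hκ0)] with k hk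
    refine lt_of_le_of_lt ?_ hk
    rw [hcen g, hsNorm_sub_comm (π k (g * z)).1 ((π k z).1 * (π k g).1)]
    exact hsNorm_sub_le _ _ _
  have hev3 : ∀ᶠ k in atTop, IsAlmostRep K (δ / (4 * Λ)) (π k) := by
    refine (Finset.eventually_all _).2 fun g _ => (Finset.eventually_all _).2 fun h _ => ?_
    exact (hπ.2 g h).eventually_lt_const (by positivity)
  obtain ⟨k, hk1, hk2, hk3⟩ := (hev1.and (hev2.and hev3)).exists
  have hd := hπ.1 k
  have hd' : (0 : ℝ) < d k := by exact_mod_cast hd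
  have hsd : 0 < √(d k : ℝ) := Real.sqrt_pos.2 hd'
  obtain ⟨ω', m, W, hor, hm, hW, hdm, hscal, hcomm⟩ := exists_corner (κ := κ) hd hN
    (show 0 < L by exact_mod_cast hL0) (π k) (π k z) hω ht₀ hsmall
    (fun j h1 h2 => by
      have h3 := hk1 j (Finset.mem_Icc.2 ⟨h1, h2⟩)
      rw [abs_div, abs_of_pos hd', div_lt_iff₀ hd'] at h3
      refine h3.le.trans_eq ?_
      ring) K'
    (fun g hg => by
      have h3 := hk2 g hg
      rw [hsNorm_eq, div_lt_iff₀ hsd] at h3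
      calc _ ≤ (√κ * √(d k)) ^ 2 := pow_le_pow_left₀ (norm_nonneg _) h3.le 2
        _ = κ * d k := by rw [mul_pow, Real.sq_sqrt hκ0.le, Real.sq_sqrt hd'.le])
  have hm' : (0 : ℝ) < m := by exact_mod_cast hm
  have hsm : 0 < √(m : ℝ) := Real.sqrt_pos.2 hm'
  have hdm' : (d k : ℝ) ≤ 8 * N * m := by
    rw [div_le_iff₀ (by positivity)] at hdm
    linarith
  have hcomm' : ∀ g ∈ K', ‖W * Wᴴ * (π k g).1 - (π k g).1 * (W * Wᴴ)‖ ≤ δ / 16 * √m := by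
    intro g hg
    refine abs_le_of_sq_le_sq' ?_ (by positivity) |>.2
    calc _ ≤ B * d k := (hcomm g hg).trans (mul_le_mul_of_nonneg_right hKB hd'.le)
      _ ≤ B * (8 * N * m) := mul_le_mul_of_nonneg_left hdm' hB0.le
      _ = (δ / 16 * √m) ^ 2 := by rw [mul_pow, Real.sq_sqrt hm'.le, ← hB]; ring
  obtain ⟨σ, hσ1, hσ2⟩ := exists_compression (π k) hW
  refine ⟨ω', m, σ, hor, hm, fun g hg h hh => ?_, ?_⟩
  · have h1 := hk3 g hg h hh
    rw [hsNorm_eq, div_lt_iff₀ hsd] at h1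
    have h2 : √(d k : ℝ) ≤ Λ * √m := by
      rw [hΛ, ← Real.sqrt_mul (by positivity)]
      exact Real.sqrt_le_sqrt hdm'
    have h3 : δ / (4 * Λ) * √(d k : ℝ) ≤ δ / 4 * √m :=
      (mul_le_mul_of_nonneg_left h2 (by positivity)).trans_eq (by field_simp)
    have h4 := hσ2 g h
    have c1 := hcomm' g (by simp [hK', hg])
    have c2 := hcomm' h (by simp [hK', hh])
    have c3 := hcomm' (g * h) (Finset.mem_insert_of_mem (Finset.mem_union_right _
      (Finset.mem_image.2 ⟨(g, h), Finset.mk_mem_product hg hh, rfl⟩)))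
    have h5 : 0 < δ * √m := by positivity
    rw [hsNorm_eq, div_lt_iff₀ hsm]
    linarith
  · have h1 : (σ z).1 - ω' • 1 = ((σ z).1 - Wᴴ * (π k z).1 * W) +
        Wᴴ * (((π k z).1 - ω' • 1) * W) := by
      rw [Matrix.sub_mul, Matrix.mul_sub, Matrix.smul_mul, Matrix.one_mul, Matrix.mul_smul, hW,
        Matrix.mul_assoc]
      abel
    have h2 := (hσ1 z).trans (hcomm' z (by simp [hK']))
    have h3 := norm_isometry_conjTranspose_mul_le hW (((π k z).1 - ω' • 1) * W)
    have h4 : ‖((π k z).1 - ω' • 1) * W‖ ≤ δ / 4 * √m := by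
      refine abs_le_of_sq_le_sq' ?_ (by positivity) |>.2
      rw [mul_pow, Real.sq_sqrt hm'.le]
      refine hscal.trans (mul_le_mul_of_nonneg_right ?_ hm'.le)
      linarith
    have h5 : 0 < δ * √m := by positivity
    rw [hsNorm_eq, div_lt_iff₀ hsm, h1]
    have h6 := norm_add_le ((σ z).1 - Wᴴ * (π k z).1 * W) (Wᴴ * (((π k z).1 - ω' • 1) * W))
    linarith

/-- A hyperlinear group has, for a central element `z` of infinite order and each `ω` on the unit
circle, an asymptotic representation which sends `z` to `ω` or to its conjugate. -/
theorem IsAsymptoticRep.exists_tendsto_scalar [Countable G] {d : ℕ → ℕ}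
    {π : ∀ k, G → Matrix.unitaryGroup (Fin (d k)) ℂ} (hπ : IsAsymptoticRep d π) {z : G}
    (hcen : ∀ g, z * g = g * z)
    (hmom : ∀ j : ℕ, 1 ≤ j → Tendsto (fun k => ((π k z).1 ^ j).trace.re / d k) atTop (𝓝 0))
    {ω : ℂ} (hω : ‖ω‖ = 1) :
    ∃ (ω' : ℂ) (m : ℕ → ℕ) (σ : ∀ k, G → Matrix.unitaryGroup (Fin (m k)) ℂ),
      (ω' = ω ∨ ω' = star ω) ∧ IsAsymptoticRep m σ ∧
      Tendsto (fun k => hsNorm ((σ k z).1 - ω' • 1)) atTop (𝓝 0) := by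
  classical
  -- The choice between ω and its conjugate may depend on `K` and `δ`. If each failed for some pair,
  -- the union of the two sets with the smaller tolerance would be contradictory, so one choice
  -- works throughout.
  have key : ∃ ω' : ℂ, (ω' = ω ∨ ω' = star ω) ∧ ∀ (K : Finset G) (δ : ℝ), 0 < δ →
      ∃ (m : ℕ) (σ : G → Matrix.unitaryGroup (Fin m) ℂ), 0 < m ∧ IsAlmostRep K δ σ ∧
        hsNorm ((σ z).1 - ω' • 1) < δ := by
    by_contra! hcon
    obtain ⟨K₁, δ₁, hδ₁, h₁⟩ := hcon ω (Or.inl rfl)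
    obtain ⟨K₂, δ₂, hδ₂, h₂⟩ := hcon (star ω) (Or.inr rfl)
    obtain ⟨ω', m, σ, hor, hm, hσ, hσz⟩ := hπ.exists_isAlmostRep_near_scalar hcen hmom hω
      (K₁ ∪ K₂) (lt_min hδ₁ hδ₂)
    rcases hor with rfl | rfl
    · refine absurd (h₁ m σ hm fun g hg h hh => ?_) (not_le.2 (hσz.trans_le (min_le_left _ _)))
      exact (hσ g (Finset.mem_union_left _ hg) h (Finset.mem_union_left _ hh)).trans_le
        (min_le_left _ _)
    · refine absurd (h₂ m σ hm fun g hg h hh => ?_) (not_le.2 (hσz.trans_le (min_le_right _ _)))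
      exact (hσ g (Finset.mem_union_right _ hg) h (Finset.mem_union_right _ hh)).trans_le
        (min_le_right _ _)
  obtain ⟨ω', hor, hω'⟩ := key
  obtain ⟨K, hK⟩ := exists_exhaustion G
  choose m σ hm hσ hσz using fun j : ℕ => hω' (K j) (1 / ((j : ℝ) + 1)) (by positivity)
  exact ⟨ω', m, σ, hor, isAsymptoticRep_of_isAlmostRep hK hm hσ,
    squeeze_zero (fun _ => hsNorm_nonneg _) (fun j => (hσz j).le)
      tendsto_one_div_add_atTop_nhds_zero_nat⟩

end Cut

/-! ### Choice of the scalar and conclusion -/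

/-- Points of the unit circle arbitrarily close to `1` which are not `n`-th roots of unity. -/
theorem exists_near_one_pow_ne_one {n : ℕ} (hn : 0 < n) {r : ℝ} (hr : 0 < r) :
    ∃ ω : ℂ, ‖ω‖ = 1 ∧ ‖ω - 1‖ < r ∧ ω ^ n ≠ 1 := by
  have hn' : (1 : ℝ) ≤ n := by exact_mod_cast hn
  -- With 0 < nθ ≤ 1 < π the number exp(inθ) has positive imaginary part, so it is not 1.
  obtain ⟨θ, hθ0, hθ1, hθr⟩ : ∃ θ : ℝ, 0 < θ ∧ θ ≤ 1 / n ∧ θ ≤ r / 2 :=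
    ⟨min (1 / n) (r / 2), by positivity, min_le_left _ _, min_le_right _ _⟩
  rw [le_div_iff₀ (by positivity)] at hθ1
  refine ⟨Complex.exp (θ * Complex.I), Complex.norm_exp_ofReal_mul_I θ, ?_, ?_⟩
  · have h := Real.norm_exp_I_mul_ofReal_sub_one_le (x := θ)
    rw [mul_comm, Real.norm_of_nonneg hθ0.le] at h
    linarith
  · rw [← Complex.exp_nat_mul]
    intro h
    have h2 := congrArg Complex.im h
    have h3 : (n : ℂ) * (θ * Complex.I) = ((θ * n : ℝ) : ℂ) * Complex.I := by
      push_cast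
      ring
    rw [h3, Complex.exp_ofReal_mul_I_im, Complex.one_im] at h2
    have h4 : 0 < θ * n := by positivity
    exact (Real.sin_pos_of_pos_of_lt_pi h4 (by linarith [Real.pi_gt_three])).ne' h2

theorem theorem1p3 {Γ : Type*} {Γt : Type*} [Group Γ] [Group Γt]
    (hT : HasPropertyTFD Γ)
    (E : GroupExtension (Multiplicative ℤ) Γt Γ)
    (hcentral : E.inl.range ≤ Subgroup.center Γt)
    (hab : Finite (Abelianization Γt))
    (hstable : IsHSStable Γ) :
    ¬ IsHyperlinear Γt := by
  rintro ⟨d, π, hπ, hfree⟩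
  set z := E.inl (Multiplicative.ofAdd 1) with hz
  have hpow : ∀ c : ℤ, z ^ c = E.inl (Multiplicative.ofAdd c) := by
    intro c
    rw [hz, ← map_zpow, ← ofAdd_zsmul, smul_eq_mul, mul_one]
  have hker : E.rightHom.ker = Subgroup.zpowers z := by
    rw [← E.range_inl_eq_ker_rightHom]
    ext g
    simp only [MonoidHom.mem_range, Subgroup.mem_zpowers_iff, hpow]
    rfl
  have hcen : ∀ g, z * g = g * z := fun g =>
    ((Subgroup.mem_center_iff.1 (hcentral ⟨_, rfl⟩)) g).symm
  have hcount : Countable Γt := by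
    obtain ⟨S, -, hgen, -⟩ := hT
    have := countable_of_closure_finset hgen
    have hsec := Function.surjInv_eq E.rightHom_surjective
    refine Function.Surjective.countable (α := Γ × ℤ)
      (f := fun p => Function.surjInv E.rightHom_surjective p.1 * z ^ p.2) fun g => ?_
    have h : (Function.surjInv E.rightHom_surjective (E.rightHom g))⁻¹ * g ∈ E.rightHom.ker := by
      rw [MonoidHom.mem_ker, map_mul, map_inv, hsec, inv_mul_cancel]
    rw [hker] at h
    obtain ⟨c, hc⟩ := Subgroup.mem_zpowers_iff.1 h
    exact ⟨(E.rightHom g, c), by simp only [hc, mul_inv_cancel_left]⟩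
  have hne : ∀ j : ℕ, 1 ≤ j → z ^ j ≠ 1 := by
    intro j hj h
    rw [← zpow_natCast, hpow, ← map_one E.inl] at h
    have h1 : (j : ℤ) = 0 := Multiplicative.ofAdd.injective (E.inl_injective h)
    omega
  obtain ⟨r, hr, hcon⟩ := exists_forall_not_tendsto_central hT hstable E.rightHom
    E.rightHom_surjective z hker
  obtain ⟨ω, hω, hωr, hωN⟩ := exists_near_one_pow_ne_one
    (Nat.card_pos (α := Abelianization Γt)) hr
  obtain ⟨ω', m, σ, hor, hσ, hσz⟩ := hπ.exists_tendsto_scalar hcen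
    (fun j hj => hπ.tendsto_trace_pow (hfree _ _ (hne j hj))) hω
  -- The conjugate of ω is as close to 1 as ω and is likewise not a root of unity of the given
  -- order, so both cases are excluded.
  rcases hor with rfl | rfl
  · exact hcon _ hω hωr hωN m σ hσ hσz
  · refine hcon _ (by rw [norm_star, hω]) ?_ ?_ m σ hσ hσz
    · rwa [← star_one ℂ, ← star_sub, norm_star]
    · rw [← star_pow, ne_eq, star_eq_iff_star_eq, star_one]
      exact fun h => hωN h.symm
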